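/- All graphs are finite and simple. In the problem $k$-in-a-tree the input is a graph $G$ on $n$ vertices and a set $K \subseteq V(G)$ of terminals (of arbitrary size $k$), and the question is whether some induced subgraph of $G$ is a tree that contains every vertex of $K$ (a tree being a non-empty connected acyclic graph). A cluster graph is a graph each of whose connected components is a clique, and the distance to cluster of $G$ is the size of a smallest set $U \subseteq V(G)$ such that $G \setminus U$ is a cluster graph. Theorem. There is an algorithm for $k$-in-a-tree that runs in time $2^{O(q)} n^{O(1)}$ on graphs with distance to cluster at most $q$. That is, there are a single deterministic algorithm (a program of a unit-cost random access machine whose arithmetic operations are addition and truncated subtraction of natural numbers, which is given only $n$, the adjacency matrix of $G$ and the indicator vector of $K$) and constants $a, b, c \in \mathbb{N}$ such that, for every $n$-vertex graph $G$, every $K \subseteq V(G)$ and every $q \in \mathbb{N}$ for which $G$ has distance to cluster at most $q$, the algorithm on input $(G, K)$ halts after at most $a \cdot 2^{bq} \cdot (n+1)^{c}$ steps and correctly decides whether $(G, K)$ is a yes-instance. -/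

import Mathlib

namespace KInATree

/-! ### Graph notions -/

/-- A cluster graph: every connected component is a clique. -/
def IsClusterGraph {V : Type*} (G : SimpleGraph V) : Prop :=
  ∀ C : G.ConnectedComponent, G.IsClique C.supp

/-- `U` is a cluster modulator of `G`: deleting `U` leaves a cluster graph. -/
def IsClusterModulator {V : Type*} (G : SimpleGraph V) (U : Finset V) : Prop :=
  IsClusterGraph (G.induce ((U : Set V)ᶜ))

/-- The distance to cluster of `G`: the smallest size of a cluster modulator. -/
noncomputable def distToCluster {V : Type*} (G : SimpleGraph V) : ℕ :=
  sInf {m : ℕ | ∃ U : Finset V, U.card = m ∧ IsClusterModulator G U}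

/-- On a finite vertex set the minimum defining `distToCluster` is attained. -/
theorem exists_modulator_card_eq_distToCluster {V : Type*} [Fintype V] (G : SimpleGraph V) :
    ∃ U : Finset V, U.card = distToCluster G ∧ IsClusterModulator G U := by
  have h : {m : ℕ | ∃ U : Finset V, U.card = m ∧ IsClusterModulator G U}.Nonempty := by
    refine ⟨_, Finset.univ, rfl, ?_⟩
    intro C u _
    exact absurd (Finset.mem_coe.2 (Finset.mem_univ u.1)) u.2
  exact Nat.sInf_mem h

/-- `(G, K)` is a yes-instance of `k`-in-a-tree: some induced subgraph of `G` is a tree and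
contains every vertex of `K`. -/
def HasInducedTree {V : Type*} (G : SimpleGraph V) (K : Finset V) : Prop :=
  ∃ S : Set V, (K : Set V) ⊆ S ∧ (G.induce S).IsTree

/-! ### Machine model

Structured programs of a random access machine. The machine has natural-number registers
`var 0, var 1, …` and arrays `arr 0, arr 1, …` with natural-number indices and entries; registers
and arrays are named by literals in the program, so that a program uses finitely many of them,
while array cells are addressed by computed indices. The arithmetic operations are addition and
truncated subtraction only (no multiplication), and each elementary operation costs one step, so
that running times agree with those of a Turing machine up to a polynomial. -/

/-- The memory of the machine. -/
structure State where
  /-- the contents of the registers -/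
  var : ℕ → ℕ
  /-- `arr a i` is the entry with index `i` of the array `a` -/
  arr : ℕ → ℕ → ℕ

/-- Expressions of the programming language. -/
inductive Expr where
  /-- a numeral -/
  | const (c : ℕ)
  /-- the content of the register `x` -/
  | var (x : ℕ)
  /-- addition -/
  | add (e f : Expr)
  /-- truncated subtraction -/
  | sub (e f : Expr)
  /-- the entry of the array `a` at the index given by an expression -/
  | read (a : ℕ) (e : Expr)

/-- The value of an expression. -/
def Expr.eval (s : State) : Expr → ℕ
  | .const c => c
  | .var x => s.var x
  | .add e f => e.eval s + f.eval s
  | .sub e f => e.eval s - f.eval s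
  | .read a e => s.arr a (e.eval s)

/-- The number of steps needed to evaluate an expression: one for each of its nodes. -/
def Expr.cost : Expr → ℕ
  | .const _ => 1
  | .var _ => 1
  | .add e f => e.cost + f.cost + 1
  | .sub e f => e.cost + f.cost + 1
  | .read _ e => e.cost + 1

/-- Programs. Tests are expressions; a test succeeds if its value is not `0`. -/
inductive Prog where
  /-- do nothing -/
  | skip
  /-- `var x := e` -/
  | assign (x : ℕ) (e : Expr)
  /-- `arr a [i] := e` -/
  | store (a : ℕ) (i e : Expr)
  /-- sequential composition -/
  | seq (p r : Prog)
  /-- conditional -/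
  | cond (b : Expr) (p r : Prog)
  /-- repeat `p` as long as the test `b` succeeds -/
  | loop (b : Expr) (p : Prog)

/-- The memory after the register `x` has been set to `v`. -/
def State.assign (s : State) (x v : ℕ) : State where
  var := Function.update s.var x v
  arr := s.arr

/-- The memory after the entry `i` of the array `a` has been set to `v`. -/
def State.store (s : State) (a i v : ℕ) : State where
  var := s.var
  arr := Function.update s.arr a (Function.update (s.arr a) i v)

/-- `Runs p s s' t`: started with memory `s`, the program `p` halts with memory `s'` after exactly
`t` steps. -/
inductive Runs : Prog → State → State → ℕ → Prop where
  | skip (s : State) : Runs .skip s s 1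
  | assign (s : State) (x : ℕ) (e : Expr) :
      Runs (.assign x e) s (s.assign x (e.eval s)) (e.cost + 1)
  | store (s : State) (a : ℕ) (i e : Expr) :
      Runs (.store a i e) s (s.store a (i.eval s) (e.eval s)) (i.cost + e.cost + 1)
  | seq {p r : Prog} {s₁ s₂ s₃ : State} {t u : ℕ} :
      Runs p s₁ s₂ t → Runs r s₂ s₃ u → Runs (.seq p r) s₁ s₃ (t + u)
  | cond_true {b : Expr} {p r : Prog} {s₁ s₂ : State} {t : ℕ} :
      b.eval s₁ ≠ 0 → Runs p s₁ s₂ t → Runs (.cond b p r) s₁ s₂ (b.cost + 1 + t)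
  | cond_false {b : Expr} {p r : Prog} {s₁ s₂ : State} {t : ℕ} :
      b.eval s₁ = 0 → Runs r s₁ s₂ t → Runs (.cond b p r) s₁ s₂ (b.cost + 1 + t)
  | loop_exit {b : Expr} {p : Prog} {s : State} :
      b.eval s = 0 → Runs (.loop b p) s s (b.cost + 1)
  | loop_step {b : Expr} {p : Prog} {s₁ s₂ s₃ : State} {t u : ℕ} :
      b.eval s₁ ≠ 0 → Runs p s₁ s₂ t → Runs (.loop b p) s₂ s₃ u →
        Runs (.loop b p) s₁ s₃ (b.cost + 1 + t + u)

/-- Programs are deterministic: the final memory and the number of steps are determined by the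
program and the initial memory. -/
theorem Runs.deterministic {p : Prog} {s s' s'' : State} {t u : ℕ}
    (h : Runs p s s' t) (h' : Runs p s s'' u) : s' = s'' ∧ t = u := by
  induction h generalizing s'' u with
  | skip | assign | store => cases h'; exact ⟨rfl, rfl⟩
  | seq _ _ ih₁ ih₂ =>
    cases h' with
    | seq h₁ h₂ =>
      obtain ⟨rfl, rfl⟩ := ih₁ h₁
      obtain ⟨rfl, rfl⟩ := ih₂ h₂
      exact ⟨rfl, rfl⟩
  | cond_true hb _ ih | cond_false hb _ ih =>
    cases h' with
    | cond_true hb' h₁ =>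
      first
        | exact absurd hb hb'
        | (obtain ⟨rfl, rfl⟩ := ih h₁; exact ⟨rfl, rfl⟩)
    | cond_false hb' h₁ =>
      first
        | exact absurd hb' hb
        | (obtain ⟨rfl, rfl⟩ := ih h₁; exact ⟨rfl, rfl⟩)
  | loop_exit hb =>
    cases h' with
    | loop_exit => exact ⟨rfl, rfl⟩
    | loop_step hb' => exact absurd hb hb'
  | loop_step hb _ _ ih₁ ih₂ =>
    cases h' with
    | loop_exit hb' => exact absurd hb' hb
    | loop_step _ h₁ h₂ =>
      obtain ⟨rfl, rfl⟩ := ih₁ h₁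
      obtain ⟨rfl, rfl⟩ := ih₂ h₂
      exact ⟨rfl, rfl⟩

open Classical in
/-- The initial memory that presents the instance `(G, K)` with vertices `0, …, n - 1`: register
`0` holds `n`, array `0` is the adjacency matrix of `G` row by row (the entry of `i, j` has index
`i * n + j`), array `1` is the indicator vector of `K`, and all else is `0`. -/
noncomputable def inputState {n : ℕ} (G : SimpleGraph (Fin n)) (K : Finset (Fin n)) : State where
  var x := if x = 0 then n else 0
  arr a m :=
    if a = 0 then
      if ∃ i j : Fin n, m = (i : ℕ) * n + (j : ℕ) ∧ G.Adj i j then 1 else 0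
    else if a = 1 then
      if ∃ i ∈ K, m = (i : ℕ) then 1 else 0
    else 0

/-- On the instance `(G, K)` the program `p` halts after at most `T` steps, and register `0` then
holds the answer: `1` if `(G, K)` is a yes-instance of `k`-in-a-tree, and `0` if not. -/
def SolvesWithin (p : Prog) {n : ℕ} (G : SimpleGraph (Fin n)) (K : Finset (Fin n)) (T : ℕ) :
    Prop :=
  ∃ (s : State) (t : ℕ), Runs p (inputState G K) s t ∧ t ≤ T ∧
    (HasInducedTree G K → s.var 0 = 1) ∧ (¬ HasInducedTree G K → s.var 0 = 0)

end KInATree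

/-! A graph is a cluster graph exactly when it has no induced path on three vertices. Collecting
vertex-disjoint induced paths greedily gives a modulator `U` of at most three times the optimal
size, since every modulator meets each of these paths (`IsApprox.union`, `den_greedy`). Guess a
vertex `r` of the tree and put `W = U ∪ {r}`. Outside `W` the graph is a disjoint union of cliques,
and a tree, having no triangle, takes at most two vertices from each of them. A solution is
therefore a set `X ⊆ W` with `r ∈ X` together with a polynomial number of options for each clique
(`hasInducedTree_iff_exists_pick`).

A connected graph is a tree iff it has one edge fewer than vertices. There are no edges between
different cliques, so this count is a sum of independent contributions of the cliques; the
contributions are shifted to be nonnegative (`IsCliqueSplit.isTree_iff`). Connectivity is a parity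
condition: count the cuts that no edge crosses and that have `r` on a fixed side. A connected graph
has exactly one. In a disconnected graph, switching the sides of all vertices outside a proper
closed set containing `r` is an involution without fixed points, so the number is even
(`IsCliqueSplit.sum_isUncrossed`). For a fixed trace `A ⊆ X` of the cut the cliques choose their
sides independently, so the parity is a sum over `A` of a product with one factor per clique
(`sum_prod_cutFactor`).

Each option for a clique thus becomes a vector over the field with two elements, indexed by the
subsets of `W`. The question is whether some entrywise product of options, of prescribed total
weight, has odd coordinate sum. Multiplication by a fixed vector and the coordinate sum are linear,
so for each weight it is enough to store a basis of the span of the partial products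
(`span_reach_succ`, `exists_ne_zero_of_span_eq`). A basis has at most as many vectors as there are
coordinates, so the dynamic program is polynomial in `n` and `2 ^ |W|`, where `|W|` is at most `3 *
q + 1`.

For the running time the algorithm is written in a small language whose loops have bounds stored in
a read-only array. If all bounds are at most `B`, a fixed program costs a fixed polynomial in `B`
(`Cmd.runs_compile`, `Cmd.polyBound_cost`), and `B` can be taken as a constant times `2 ^ (3 * q) *
(n + 1)`. -/

namespace KInATree

/-! ### A language of bounded loops -/

/-- Array contents. -/
abbrev Mem := ℕ → ℕ → ℕ

/-- Values of the bound variables. -/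
abbrev Env := ℕ → ℕ

/-- Terms with bounded sums: `sum k b f` is the sum of `f` over all values of the bound variable
`k` below the entry `b` of the array `2`. -/
inductive Tm where
  | const (c : ℕ)
  | bv (k : ℕ)
  | add (e f : Tm)
  | sub (e f : Tm)
  | read (a : ℕ) (e : Tm)
  | ite (e f g : Tm)
  | sum (k b : ℕ) (f : Tm)

/-- The value of a term. -/
def Tm.eval : Tm → Env → Mem → ℕ
  | .const c, _, _ => c
  | .bv k, η, _ => η k
  | .add e f, η, A => e.eval η A + f.eval η A
  | .sub e f, η, A => e.eval η A - f.eval η A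
  | .read a e, η, A => A a (e.eval η A)
  | .ite e f g, η, A => if e.eval η A ≠ 0 then f.eval η A else g.eval η A
  | .sum k b f, η, A => ∑ i ∈ Finset.range (A 2 b), f.eval (Function.update η k i) A

/-- A bound on the running time of a compiled term if all loop bounds are at most `B`. -/
def Tm.cost (B : ℕ) : Tm → ℕ
  | .const _ => 2
  | .bv _ => 2
  | .add e f => e.cost B + f.cost B + 4
  | .sub e f => e.cost B + f.cost B + 4
  | .read _ e => e.cost B + 3
  | .ite e f g => e.cost B + f.cost B + g.cost B + 2
  | .sum _ _ f => B * (f.cost B + 12) + 13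

/-- A program that leaves the value of a term in the register `d`, changing no register below `d`;
`ρ k` is the register that holds the bound variable `k`. -/
def Tm.compile : Tm → (ℕ → ℕ) → ℕ → Prog
  | .const c, _, d => .assign d (.const c)
  | .bv k, ρ, d => .assign d (.var (ρ k))
  | .add e f, ρ, d => .seq (e.compile ρ d) (.seq (f.compile ρ (d + 1))
      (.assign d (.add (.var d) (.var (d + 1)))))
  | .sub e f, ρ, d => .seq (e.compile ρ d) (.seq (f.compile ρ (d + 1))
      (.assign d (.sub (.var d) (.var (d + 1)))))
  | .read a e, ρ, d => .seq (e.compile ρ d) (.assign d (.read a (.var d)))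
  | .ite e f g, ρ, d => .seq (e.compile ρ d) (.cond (.var d) (f.compile ρ d) (g.compile ρ d))
  | .sum k b f, ρ, d =>
      .seq (.assign d (.read 2 (.const b))) (.seq (.assign (d + 1) (.const 0))
        (.seq (.assign (d + 2) (.const 0)) (.seq
          (.loop (.sub (.var d) (.var (d + 1)))
            (.seq (f.compile (Function.update ρ k (d + 1)) (d + 3))
              (.seq (.assign (d + 2) (.add (.var (d + 2)) (.var (d + 3))))
                (.assign (d + 1) (.add (.var (d + 1)) (.const 1))))))
          (.assign d (.var (d + 2))))))

/-- Commands: `forr k b p` repeats `p` with the bound variable `k` running through all values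
below the entry `b` of the array `2`. -/
inductive Cmd where
  | store (a : ℕ) (i e : Tm)
  | seq (p r : Cmd)
  | forr (k b : ℕ) (p : Cmd)

/-- The effect of a command on the memory. -/
def Cmd.den : Cmd → Env → Mem → Mem
  | .store a i e, η, A => Function.update A a (Function.update (A a) (i.eval η A) (e.eval η A))
  | .seq p r, η, A => r.den η (p.den η A)
  | .forr k b p, η, A =>
      Nat.rec A (fun i A' => p.den (Function.update η k i) A') (A 2 b)

/-- Whether a command contains a store instruction for the array `a`. -/
def Cmd.writes (a : ℕ) : Cmd → Bool
  | .store a' _ _ => a == a'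
  | .seq p r => p.writes a || r.writes a
  | .forr _ _ p => p.writes a

/-- A bound on the running time of a compiled command if all loop bounds are at most `B`. -/
def Cmd.cost (B : ℕ) : Cmd → ℕ
  | .store _ i e => i.cost B + e.cost B + 3
  | .seq p r => p.cost B + r.cost B
  | .forr _ _ p => B * (p.cost B + 8) + 9

/-- The program of a command; it changes no register below `d`. -/
def Cmd.compile : Cmd → (ℕ → ℕ) → ℕ → Prog
  | .store a i e, ρ, d => .seq (i.compile ρ d) (.seq (e.compile ρ (d + 1))
      (.store a (.var d) (.var (d + 1))))
  | .seq p r, ρ, d => .seq (p.compile ρ d) (r.compile ρ d)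
  | .forr k b p, ρ, d =>
      .seq (.assign d (.read 2 (.const b))) (.seq (.assign (d + 1) (.const 0))
        (.loop (.sub (.var d) (.var (d + 1)))
          (.seq (p.compile (Function.update ρ k (d + 1)) (d + 2))
            (.assign (d + 1) (.add (.var (d + 1)) (.const 1))))))

/-- The invariant pins down both the bound in `d` and the counter in `c`, so the test `d - c` first
fails after exactly `N` rounds. Each test costs 4 steps. -/
theorem runs_counting_loop {p : Prog} {d c N C : ℕ} (I : ℕ → State → Prop)
    (hI : ∀ i σ, I i σ → σ.var d = N ∧ σ.var c = i)
    (hp : ∀ i < N, ∀ σ, I i σ → ∃ σ' t, Runs p σ σ' t ∧ I (i + 1) σ' ∧ t ≤ C)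
    (σ : State) (h0 : I 0 σ) :
    ∃ σ' t, Runs (.loop (.sub (.var d) (.var c)) p) σ σ' t ∧ I N σ' ∧ t ≤ N * (C + 4) + 4 := by
  have key : ∀ m i, i + m = N → ∀ σ, I i σ →
      ∃ σ' t, Runs (.loop (.sub (.var d) (.var c)) p) σ σ' t ∧ I N σ' ∧
        t ≤ m * (C + 4) + 4 := by
    intro m
    induction m with
    | zero =>
      intro i hi σ hσ
      obtain ⟨h1, h2⟩ := hI i σ hσ
      obtain rfl : i = N := by omega
      exact ⟨σ, _, .loop_exit (by simp [Expr.eval, h1, h2]), hσ, by simp [Expr.cost]⟩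
    | succ m ih =>
      intro i hi σ hσ
      obtain ⟨h1, h2⟩ := hI i σ hσ
      obtain ⟨σ₁, t₁, r₁, I₁, c₁⟩ := hp i (by omega) σ hσ
      obtain ⟨σ₂, t₂, r₂, I₂, c₂⟩ := ih (i + 1) (by omega) σ₁ I₁
      refine ⟨σ₂, _, .loop_step (by simp only [Expr.eval, h1, h2]; omega) r₁ r₂, I₂, ?_⟩
      simp only [Expr.cost]
      rw [Nat.succ_mul]
      omega
  exact key N 0 (by omega) σ h0

/-- Registers below `d` hold the bound variables and pending intermediate results. The clause that
they are preserved lets a subterm, compiled at a higher base, run without disturbing them. -/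
theorem Tm.runs_compile {A : Mem} {B : ℕ} (hB : ∀ b, A 2 b ≤ B) (e : Tm) :
    ∀ (η : Env) (ρ : ℕ → ℕ) (d : ℕ) (σ : State), σ.arr = A → (∀ k, ρ k < d) →
      (∀ k, σ.var (ρ k) = η k) →
      ∃ σ' t, Runs (e.compile ρ d) σ σ' t ∧ σ'.arr = A ∧ σ'.var d = e.eval η A ∧
        (∀ x < d, σ'.var x = σ.var x) ∧ t ≤ e.cost B := by
  induction e with
  | const c =>
    intro η ρ d σ hA hρ hη
    exact ⟨_, _, .assign _ _ _, hA, by simp [State.assign, Expr.eval, Tm.eval],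
      fun x hx => by simp [State.assign, hx.ne], by simp [Expr.cost, Tm.cost]⟩
  | bv k =>
    intro η ρ d σ hA hρ hη
    exact ⟨_, _, .assign _ _ _, hA, by simp [State.assign, Expr.eval, Tm.eval, hη],
      fun x hx => by simp [State.assign, hx.ne], by simp [Expr.cost, Tm.cost]⟩
  | add e f ihe ihf | sub e f ihe ihf =>
    intro η ρ d σ hA hρ hη
    obtain ⟨σ₁, t₁, r₁, a₁, v₁, p₁, c₁⟩ := ihe η ρ d σ hA hρ hη
    obtain ⟨σ₂, t₂, r₂, a₂, v₂, p₂, c₂⟩ := ihf η ρ (d + 1) σ₁ a₁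
      (fun k => (hρ k).trans (Nat.lt_succ_self d)) (fun k => by rw [p₁ _ (hρ k), hη])
    refine ⟨_, _, .seq r₁ (.seq r₂ (.assign _ _ _)), a₂, ?_, ?_, ?_⟩
    · simp [State.assign, Expr.eval, Tm.eval, v₂, p₂ d (Nat.lt_succ_self d), v₁]
    · intro x hx
      simp only [State.assign, Function.update_of_ne hx.ne]
      rw [p₂ x (by omega), p₁ x hx]
    · simp only [Expr.cost, Tm.cost]
      omega
  | read a e ihe =>
    intro η ρ d σ hA hρ hη
    obtain ⟨σ₁, t₁, r₁, a₁, v₁, p₁, c₁⟩ := ihe η ρ d σ hA hρ hη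
    refine ⟨_, _, .seq r₁ (.assign _ _ _), a₁, ?_, ?_, ?_⟩
    · simp [State.assign, Expr.eval, Tm.eval, v₁, a₁]
    · intro x hx
      simp only [State.assign, Function.update_of_ne hx.ne]
      rw [p₁ x hx]
    · simp only [Expr.cost, Tm.cost]
      omega
  | ite e f g ihe ihf ihg =>
    intro η ρ d σ hA hρ hη
    obtain ⟨σ₁, t₁, r₁, a₁, v₁, p₁, c₁⟩ := ihe η ρ d σ hA hρ hη
    have hη₁ : ∀ k, σ₁.var (ρ k) = η k := fun k => by rw [p₁ _ (hρ k), hη]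
    by_cases h : e.eval η A = 0
    · obtain ⟨σ₂, t₂, r₂, a₂, v₂, p₂, c₂⟩ := ihg η ρ d σ₁ a₁ hρ hη₁
      refine ⟨_, _, .seq r₁ (.cond_false (by simp [Expr.eval, v₁, h]) r₂), a₂, ?_, ?_, ?_⟩
      · simp [Tm.eval, h, v₂]
      · intro x hx
        rw [p₂ x hx, p₁ x hx]
      · simp only [Expr.cost, Tm.cost]
        omega
    · obtain ⟨σ₂, t₂, r₂, a₂, v₂, p₂, c₂⟩ := ihf η ρ d σ₁ a₁ hρ hη₁
      refine ⟨_, _, .seq r₁ (.cond_true (by simp [Expr.eval, v₁, h]) r₂), a₂, ?_, ?_, ?_⟩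
      · simp [Tm.eval, h, v₂]
      · intro x hx
        rw [p₂ x hx, p₁ x hx]
      · simp only [Expr.cost, Tm.cost]
        omega
  | sum k b f ihf =>
    intro η ρ d σ hA hρ hη
    let σ₁ := ((σ.assign d (σ.arr 2 b)).assign (d + 1) 0).assign (d + 2) 0
    -- Register `d` holds the bound, `d + 1` the summation index, `d + 2` the partial sum; the
    -- summand is computed in `d + 3`.
    let I : ℕ → State → Prop := fun i τ => τ.arr = A ∧ τ.var d = A 2 b ∧ τ.var (d + 1) = i ∧
      τ.var (d + 2) = ∑ j ∈ Finset.range i, f.eval (Function.update η k j) A ∧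
      ∀ x < d, τ.var x = σ.var x
    have h0 : I 0 σ₁ := by
      refine ⟨hA, by simp [σ₁, State.assign, hA],
        by simp [σ₁, State.assign, hA],
        by simp [σ₁, State.assign, hA], fun x hx => ?_⟩
      simp only [σ₁, State.assign]
      rw [Function.update_of_ne (by omega), Function.update_of_ne (by omega),
        Function.update_of_ne (by omega)]
    obtain ⟨σ₂, t₂, r₂, ⟨a₂, b₂, i₂, s₂, p₂⟩, c₂⟩ := runs_counting_loop
      (p := .seq (f.compile (Function.update ρ k (d + 1)) (d + 3))
              (.seq (.assign (d + 2) (.add (.var (d + 2)) (.var (d + 3))))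
                (.assign (d + 1) (.add (.var (d + 1)) (.const 1)))))
      (d := d) (c := d + 1) (N := A 2 b) (C := f.cost B + 8) I
      (fun i τ h => ⟨h.2.1, h.2.2.1⟩) (by
        rintro i hi τ ⟨ha, hb, hc, hs, hx⟩
        obtain ⟨τ₁, u₁, q₁, a₁, v₁, x₁, k₁⟩ := ihf (Function.update η k i)
          (Function.update ρ k (d + 1)) (d + 3) τ ha
          (fun k' => by
            by_cases hk : k' = k
            · subst hk
              simp
            · rw [Function.update_of_ne hk]
              have := hρ k'
              omega)
          (fun k' => by
            by_cases hk : k' = k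
            · subst hk
              simp [hc]
            · rw [Function.update_of_ne hk, Function.update_of_ne hk, hx _ (hρ k'), hη])
        refine ⟨_, _, .seq q₁ (.seq (.assign _ _ _) (.assign _ _ _)), ⟨a₁, ?_, ?_, ?_, ?_⟩, ?_⟩
        · simp [State.assign, x₁ d (by omega), hb]
        · simp [State.assign, Expr.eval, x₁ (d + 1) (by omega), hc]
        · simp [State.assign, Expr.eval, x₁ (d + 2) (by omega), hs, v₁,
            Finset.sum_range_succ]
        · intro x hxd
          simp only [State.assign]
          rw [Function.update_of_ne (by omega), Function.update_of_ne (by omega),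
            x₁ x (by omega), hx x hxd]
        · simp only [Expr.cost]
          omega) σ₁ h0
    refine ⟨_, _, .seq (.assign _ _ _) (.seq (.assign _ _ _) (.seq (.assign _ _ _)
      (.seq r₂ (.assign _ _ _)))), a₂, ?_, ?_, ?_⟩
    · simp [State.assign, Expr.eval, Tm.eval, s₂]
    · intro x hx
      simp only [State.assign, Function.update_of_ne hx.ne]
      rw [p₂ x hx]
    · simp only [Expr.cost, Tm.cost]
      have := Nat.mul_le_mul_right (f.cost B + 12) (hB b)
      rw [show f.cost B + 8 + 4 = f.cost B + 12 from rfl] at c₂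
      omega

theorem Cmd.den_forr_induction {k b : ℕ} {p : Cmd} {η : Env} {A : Mem} (I : ℕ → Mem → Prop)
    (h0 : I 0 A)
    (hs : ∀ i < A 2 b, ∀ A', I i A' → I (i + 1) (p.den (Function.update η k i) A')) :
    I (A 2 b) ((Cmd.forr k b p).den η A) := by
  have key : ∀ i ≤ A 2 b,
      I i (Nat.rec A (fun i A' => p.den (Function.update η k i) A') i : Mem) := by
    intro i
    induction i with
    | zero => exact fun _ => h0
    | succ i ih => exact fun hi => hs i hi _ (ih (by omega))
  exact key _ le_rfl

/-- Frame rule: a syntactic check carries everything known about an array across a command. -/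
theorem Cmd.den_of_not_writes {a : ℕ} (p : Cmd) (h : p.writes a = false) :
    ∀ η A, p.den η A a = A a := by
  induction p with
  | store a' i e =>
    intro η A
    have : a ≠ a' := by simpa [Cmd.writes] using h
    simp [Cmd.den, Function.update_of_ne this]
  | seq p r ihp ihr =>
    intro η A
    simp only [Cmd.writes, Bool.or_eq_false_iff] at h
    rw [Cmd.den, ihr h.2, ihp h.1]
  | forr k b p ih =>
    intro η A
    refine Cmd.den_forr_induction (fun _ A' => A' a = A a) rfl ?_
    intro i _ A' hA'
    rw [ih (by simpa [Cmd.writes] using h), hA']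

/-- Loop bounds live in the array `2`. As the command never stores there, all bounds remain at most
`B` throughout the run. -/
theorem Cmd.runs_compile {B : ℕ} (p : Cmd) (hp : p.writes 2 = false) :
    ∀ (A : Mem) (η : Env) (ρ : ℕ → ℕ) (d : ℕ) (σ : State), (∀ b, A 2 b ≤ B) → σ.arr = A →
      (∀ k, ρ k < d) → (∀ k, σ.var (ρ k) = η k) →
      ∃ σ' t, Runs (p.compile ρ d) σ σ' t ∧ σ'.arr = p.den η A ∧
        (∀ x < d, σ'.var x = σ.var x) ∧ t ≤ p.cost B := by
  induction p with
  | store a i e =>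
    intro A η ρ d σ hB hA hρ hη
    obtain ⟨σ₁, t₁, r₁, a₁, v₁, p₁, c₁⟩ := i.runs_compile hB η ρ d σ hA hρ hη
    obtain ⟨σ₂, t₂, r₂, a₂, v₂, p₂, c₂⟩ := e.runs_compile hB η ρ (d + 1) σ₁ a₁
      (fun k => (hρ k).trans (Nat.lt_succ_self d)) (fun k => by rw [p₁ _ (hρ k), hη])
    refine ⟨_, _, .seq r₁ (.seq r₂ (.store _ _ _ _)), ?_, ?_, ?_⟩
    · simp [State.store, Expr.eval, Cmd.den, v₂, p₂ d (Nat.lt_succ_self d), v₁, a₂]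
    · intro x hx
      simp only [State.store]
      rw [p₂ x (by omega), p₁ x hx]
    · simp only [Expr.cost, Cmd.cost]
      omega
  | seq p r ihp ihr =>
    intro A η ρ d σ hB hA hρ hη
    simp only [Cmd.writes, Bool.or_eq_false_iff] at hp
    obtain ⟨σ₁, t₁, r₁, a₁, p₁, c₁⟩ := ihp hp.1 A η ρ d σ hB hA hρ hη
    obtain ⟨σ₂, t₂, r₂, a₂, p₂, c₂⟩ := ihr hp.2 _ η ρ d σ₁
      (fun b => by rw [p.den_of_not_writes hp.1]; exact hB b) a₁ hρ
      (fun k => by rw [p₁ _ (hρ k), hη])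
    refine ⟨_, _, .seq r₁ r₂, a₂, fun x hx => by rw [p₂ x hx, p₁ x hx], ?_⟩
    simp only [Cmd.cost]
    omega
  | forr k b p ih =>
    intro A η ρ d σ hB hA hρ hη
    have hp' : p.writes 2 = false := by simpa [Cmd.writes] using hp
    let σ₁ := (σ.assign d (σ.arr 2 b)).assign (d + 1) 0
    -- The clause on the array `2` makes `B` available for the loop body in every round.
    let I : ℕ → State → Prop := fun i τ =>
      τ.arr = (Nat.rec A (fun i A' => p.den (Function.update η k i) A') i : Mem) ∧
      τ.var d = A 2 b ∧ τ.var (d + 1) = i ∧ τ.arr 2 = A 2 ∧ ∀ x < d, τ.var x = σ.var x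
    have h0 : I 0 σ₁ := by
      refine ⟨hA, by simp [σ₁, State.assign, hA],
        by simp [σ₁, State.assign, hA], by simp [σ₁, State.assign, hA],
        fun x hx => ?_⟩
      simp only [σ₁, State.assign]
      rw [Function.update_of_ne (by omega), Function.update_of_ne (by omega)]
    obtain ⟨σ₂, t₂, r₂, ⟨a₂, b₂, i₂, s₂, p₂⟩, c₂⟩ := runs_counting_loop
      (p := .seq (p.compile (Function.update ρ k (d + 1)) (d + 2))
            (.assign (d + 1) (.add (.var (d + 1)) (.const 1))))
      (d := d) (c := d + 1) (N := A 2 b) (C := p.cost B + 4) I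
      (fun i τ h => ⟨h.2.1, h.2.2.1⟩) (by
        rintro i hi τ ⟨ha, hb, hc, hs, hx⟩
        obtain ⟨τ₁, u₁, q₁, a₁, x₁, k₁⟩ := ih hp' τ.arr (Function.update η k i)
          (Function.update ρ k (d + 1)) (d + 2) τ (fun b => by rw [hs]; exact hB b) rfl
          (fun k' => by
            by_cases hk : k' = k
            · subst hk
              simp
            · rw [Function.update_of_ne hk]
              have := hρ k'
              omega)
          (fun k' => by
            by_cases hk : k' = k
            · subst hk
              simp [hc]
            · rw [Function.update_of_ne hk, Function.update_of_ne hk, hx _ (hρ k'), hη])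
        refine ⟨_, _, .seq q₁ (.assign _ _ _), ⟨?_, ?_, ?_, ?_, ?_⟩, ?_⟩
        · simp [State.assign, a₁, ha]
        · simp [State.assign, x₁ d (by omega), hb]
        · simp [State.assign, Expr.eval, x₁ (d + 1) (by omega), hc]
        · simp [State.assign, a₁, p.den_of_not_writes hp', hs]
        · intro x hxd
          simp only [State.assign]
          rw [Function.update_of_ne (by omega), x₁ x (by omega), hx x hxd]
        · simp only [Expr.cost]
          omega) σ₁ h0
    refine ⟨_, _, .seq (.assign _ _ _) (.seq (.assign _ _ _) r₂), a₂, p₂, ?_⟩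
    · simp only [Expr.cost, Cmd.cost]
      have := Nat.mul_le_mul_right (p.cost B + 8) (hB b)
      rw [show p.cost B + 4 + 4 = p.cost B + 8 from rfl] at c₂
      omega

/-! ### Running times as polynomials in the common loop bound -/

theorem polyBound_add {f g : ℕ → ℕ} (hf : ∃ K D, ∀ B, 1 ≤ B → f B ≤ K * B ^ D)
    (hg : ∃ K D, ∀ B, 1 ≤ B → g B ≤ K * B ^ D) :
    ∃ K D, ∀ B, 1 ≤ B → f B + g B ≤ K * B ^ D := by
  obtain ⟨K, D, h⟩ := hf
  obtain ⟨K', D', h'⟩ := hg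
  refine ⟨K + K', max D D', fun B hB => ?_⟩
  rw [add_mul]
  exact add_le_add
    ((h B hB).trans (Nat.mul_le_mul_left _ (Nat.pow_le_pow_right hB (le_max_left _ _))))
    ((h' B hB).trans (Nat.mul_le_mul_left _ (Nat.pow_le_pow_right hB (le_max_right _ _))))

theorem polyBound_const (c : ℕ) : ∃ K D, ∀ B : ℕ, 1 ≤ B → c ≤ K * B ^ D :=
  ⟨c, 0, fun B _ => by simp⟩

theorem polyBound_mul {f : ℕ → ℕ} (hf : ∃ K D, ∀ B, 1 ≤ B → f B ≤ K * B ^ D) :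
    ∃ K D, ∀ B : ℕ, 1 ≤ B → B * f B ≤ K * B ^ D := by
  obtain ⟨K, D, h⟩ := hf
  refine ⟨K, D + 1, fun B hB => ?_⟩
  calc B * f B ≤ B * (K * B ^ D) := Nat.mul_le_mul_left _ (h B hB)
    _ = K * B ^ (D + 1) := by ring

/-- The nesting of sums is fixed by the term, so the degree does not depend on the input. -/
theorem Tm.polyBound_cost (e : Tm) : ∃ K D, ∀ B, 1 ≤ B → e.cost B ≤ K * B ^ D := by
  induction e with
  | const c => exact polyBound_const 2
  | bv k => exact polyBound_const 2
  | add e f he hf => exact polyBound_add (polyBound_add he hf) (polyBound_const 4)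
  | sub e f he hf => exact polyBound_add (polyBound_add he hf) (polyBound_const 4)
  | read a e he => exact polyBound_add he (polyBound_const 3)
  | ite e f g he hf hg =>
    exact polyBound_add (polyBound_add (polyBound_add he hf) hg) (polyBound_const 2)
  | sum k b f hf =>
    exact polyBound_add (polyBound_mul (polyBound_add hf (polyBound_const 12)))
      (polyBound_const 13)

theorem Cmd.polyBound_cost (p : Cmd) : ∃ K D, ∀ B, 1 ≤ B → p.cost B ≤ K * B ^ D := by
  induction p with
  | store a i e =>
    exact polyBound_add (polyBound_add i.polyBound_cost e.polyBound_cost) (polyBound_const 3)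
  | seq p r hp hr => exact polyBound_add hp hr
  | forr k b p hp =>
    exact polyBound_add (polyBound_mul (polyBound_add hp (polyBound_const 8)))
      (polyBound_const 9)

/-! ### Echelon bases over the field with two elements -/

theorem zmod_two_eq_one {x : ZMod 2} (h : x ≠ 0) : x = 1 := by
  revert h
  revert x
  decide

/-- The rows of `R` form an echelon basis, possibly with zero rows: row `j` is zero or has its
first nonzero entry at `j`. -/
def IsEchelon {M : ℕ} (R : Fin M → Fin M → ZMod 2) : Prop :=
  ∀ j, (∀ k < j, R j k = 0) ∧ (R j j = 0 → R j = 0)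

/-- The new row `j` after one reduction step of the vector `v` against `R`. -/
def reduceRow {M : ℕ} (R : Fin M → Fin M → ZMod 2) (v : Fin M → ZMod 2) (j : Fin M) :
    Fin M → ZMod 2 :=
  if v j = 1 ∧ R j j = 0 then v else R j

/-- The remainder after one reduction step of the vector `v` against `R`. -/
def reduceVec {M : ℕ} (R : Fin M → Fin M → ZMod 2) (v : Fin M → ZMod 2) (j : Fin M) :
    Fin M → ZMod 2 :=
  if v j = 1 then v + reduceRow R v j else v

theorem IsEchelon.reduce {M : ℕ} {R : Fin M → Fin M → ZMod 2} (hR : IsEchelon R)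
    {v : Fin M → ZMod 2} {j : Fin M} (hv : ∀ k < j, v k = 0) :
    IsEchelon (Function.update R j (reduceRow R v j)) := by
  intro i
  by_cases hi : i = j
  · subst hi
    rw [Function.update_self, reduceRow]
    split_ifs with h
    · exact ⟨hv, fun h0 => by rw [h.1] at h0; exact absurd h0 one_ne_zero⟩
    · exact hR i
  · rw [Function.update_of_ne hi]
    exact hR i

/-- When `v` has entry one at `j`, the row added to it has entry one at `j` and zeros before. So
every pivot clears one more coordinate of the remainder. -/
theorem IsEchelon.reduceVec_apply {M : ℕ} {R : Fin M → Fin M → ZMod 2} (hR : IsEchelon R)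
    {v : Fin M → ZMod 2} {j : Fin M} (hv : ∀ k < j, v k = 0) {k : Fin M} (hk : k ≤ j) :
    reduceVec R v j k = 0 := by
  rw [reduceVec]
  rcases hk.lt_or_eq with hk | rfl
  · have hr : reduceRow R v j k = 0 := by
      rw [reduceRow]
      split_ifs
      · exact hv k hk
      · exact (hR j).1 k hk
    split_ifs
    · rw [Pi.add_apply, hv k hk, hr, add_zero]
    · exact hv k hk
  · split_ifs with h
    · rw [Pi.add_apply, h, reduceRow]
      split_ifs with h'
      · rw [h]
        decide
      · rw [zmod_two_eq_one fun h0 => h' ⟨h, h0⟩]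
        decide
    · by_contra h0
      exact h (zmod_two_eq_one h0)

/-- Either `v` moves into an empty row and the remainder `v + v` vanishes, or row `j` is added to
`v`, which can be undone, or nothing happens. -/
theorem IsEchelon.span_reduce {M : ℕ} {R : Fin M → Fin M → ZMod 2} (hR : IsEchelon R)
    (v : Fin M → ZMod 2) (j : Fin M) :
    Submodule.span (ZMod 2) (insert (reduceVec R v j)
        (Set.range (Function.update R j (reduceRow R v j)))) =
      Submodule.span (ZMod 2) (insert v (Set.range R)) := by
  have hvv : v + v = 0 := by
    ext k
    exact CharTwo.add_self_eq_zero _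
  by_cases h : v j = 1
  · by_cases h' : R j j = 0
    · have hr : reduceRow R v j = v := if_pos ⟨h, h'⟩
      rw [reduceVec, if_pos h, hr, hvv, Submodule.span_insert_zero]
      refine le_antisymm (Submodule.span_mono ?_) (Submodule.span_le.2 ?_)
      · rintro _ ⟨i, rfl⟩
        by_cases hi : i = j
        · subst hi
          simp
        · rw [Function.update_of_ne hi]
          exact Set.mem_insert_of_mem _ ⟨i, rfl⟩
      · rintro w (rfl | ⟨i, rfl⟩)
        · exact Submodule.subset_span ⟨j, by simp⟩
        · by_cases hi : i = j
          · subst hi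
            -- A row without pivot is zero in an echelon basis, so overwriting it loses nothing.
            rw [(hR i).2 h']
            exact Submodule.zero_mem _
          · exact Submodule.subset_span ⟨i, by rw [Function.update_of_ne hi]⟩
    · have hr : reduceRow R v j = R j := if_neg fun hh => h' hh.2
      rw [reduceVec, if_pos h, hr, Function.update_eq_self]
      have hj : ∀ w, R j ∈ Submodule.span (ZMod 2) (insert w (Set.range R)) := fun w =>
        Submodule.subset_span (Set.mem_insert_of_mem _ ⟨j, rfl⟩)
      have hw : ∀ w, w ∈ Submodule.span (ZMod 2) (insert w (Set.range R)) := fun w =>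
        Submodule.subset_span (Set.mem_insert _ _)
      refine le_antisymm (Submodule.span_le.2 ?_) (Submodule.span_le.2 ?_)
      · rintro w (rfl | hmem)
        · exact Submodule.add_mem _ (hw v) (hj v)
        · exact Submodule.subset_span (Set.mem_insert_of_mem _ hmem)
      · rintro w (rfl | hmem)
        · have := Submodule.sub_mem _ (hw (w + R j)) (hj (w + R j))
          rwa [add_sub_cancel_right] at this
        · exact Submodule.subset_span (Set.mem_insert_of_mem _ hmem)
  · have hr : reduceRow R v j = R j := if_neg fun hh => h hh.1
    rw [reduceVec, if_neg h, hr, Function.update_eq_self]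

/-- Multiplication by a fixed vector carries spans to spans. -/
theorem span_mul_image {M : ℕ} (m : Fin M → ZMod 2) (s : Set (Fin M → ZMod 2)) :
    Submodule.span (ZMod 2) ((fun v => m * v) '' s) =
      (Submodule.span (ZMod 2) s).map (LinearMap.mulLeft (ZMod 2) m) := by
  rw [Submodule.map_span]
  rfl

/-- A linear form vanishes on a span iff it vanishes on the generators. -/
theorem exists_ne_zero_of_span_eq {M : ℕ} {s t : Set (Fin M → ZMod 2)}
    (h : Submodule.span (ZMod 2) s = Submodule.span (ZMod 2) t)
    (hs : ∃ v ∈ s, ∑ k, v k ≠ 0) : ∃ v ∈ t, ∑ k, v k ≠ 0 := by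
  by_contra hc
  push Not at hc
  obtain ⟨v, hv, hne⟩ := hs
  let φ : (Fin M → ZMod 2) →ₗ[ZMod 2] ZMod 2 := ∑ k, LinearMap.proj k
  have hφ : ∀ v, φ v = ∑ k, v k := fun v => by simp [φ]
  have : Submodule.span (ZMod 2) t ≤ LinearMap.ker φ := by
    rw [Submodule.span_le]
    intro w hw
    rw [SetLike.mem_coe, LinearMap.mem_ker, hφ, hc w hw]
  have hv' := this (h ▸ Submodule.subset_span hv)
  rw [LinearMap.mem_ker, hφ] at hv'
  exact hne hv'

/-! ### Trees and cuts -/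

section Cuts

open Classical in
/-- The number of ordered pairs of adjacent vertices, the first one in `S`, the second in `T`. -/
noncomputable def adjPairs {V : Type*} (G : SimpleGraph V) (S T : Finset V) : ℕ :=
  ∑ u ∈ S, ∑ v ∈ T, if G.Adj u v then 1 else 0

theorem adjPairs_comm {V : Type*} (G : SimpleGraph V) (S T : Finset V) :
    adjPairs G S T = adjPairs G T S := by
  classical
  rw [adjPairs, adjPairs, Finset.sum_comm]
  exact Finset.sum_congr rfl fun u _ => Finset.sum_congr rfl fun v _ =>
    if_congr (G.adj_comm _ _) rfl rfl

/-- Connectivity in terms of closed sets containing `r`: applied to the side of `r` it shows that a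
cut is trivial, and its negation supplies the set whose complement is switched. -/
theorem connected_induce_iff {V : Type*} {G : SimpleGraph V} {S : Set V} {r : V} (hr : r ∈ S) :
    (G.induce S).Connected ↔
      ∀ R : Set V, r ∈ R → (∀ u ∈ S, ∀ v ∈ S, G.Adj u v → u ∈ R → v ∈ R) → S ⊆ R := by
  constructor
  · intro h R hrR hR v hv
    obtain ⟨w⟩ := h.preconnected ⟨r, hr⟩ ⟨v, hv⟩
    have key : ∀ (a b : S), (G.induce S).Walk a b → (a : V) ∈ R → (b : V) ∈ R := by
      intro a b w
      induction w with
      | nil => exact id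
      | @cons a b c hab _ ih => exact fun ha => ih (hR a a.2 b b.2 hab ha)
    exact key _ _ w hrR
  · intro h
    have hS : ∀ v (hv : v ∈ S), (G.induce S).Reachable ⟨r, hr⟩ ⟨v, hv⟩ := by
      intro v hv
      obtain ⟨_, h'⟩ := h {v | ∃ hv : v ∈ S, (G.induce S).Reachable ⟨r, hr⟩ ⟨v, hv⟩}
        ⟨hr, .refl _⟩ (by
          rintro u hu v hv huv ⟨_, hru⟩
          exact ⟨hv, hru.trans (SimpleGraph.Adj.reachable (by exact huv))⟩) hv
      exact h'
    have : Nonempty S := ⟨⟨r, hr⟩⟩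
    exact ⟨fun a b => (hS a a.2).symm.trans (hS b b.2)⟩

/-- `adjPairs` counts every edge twice, so the relation between edges and vertices is stated
doubled, and with `+ 2` to avoid truncated subtraction. -/
theorem isTree_induce_iff {V : Type*} {G : SimpleGraph V} (S : Finset V) :
    (G.induce (S : Set V)).IsTree ↔
      (G.induce (S : Set V)).Connected ∧ adjPairs G S S + 2 = 2 * S.card := by
  classical
  rw [SimpleGraph.isTree_iff_connected_and_card]
  refine and_congr_right fun _ => ?_
  have h1 := (G.induce (S : Set V)).sum_degrees_eq_twice_card_edges
  have h2 : ∑ v, (G.induce (S : Set V)).degree v = adjPairs G S S := by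
    rw [adjPairs, ← Finset.sum_coe_sort S]
    refine Finset.sum_congr rfl fun u _ => ?_
    rw [← SimpleGraph.card_neighborFinset_eq_degree, SimpleGraph.neighborFinset_eq_filter,
      Finset.card_filter, ← Finset.sum_coe_sort S]
    rfl
  rw [Nat.card_eq_fintype_card, Nat.card_eq_fintype_card, ← SimpleGraph.edgeFinset_card]
  have h3 : Fintype.card (S : Set V) = S.card := by simp
  omega

variable {V ι : Type*} [DecidableEq V] [Fintype ι]

open Classical in
/-- The parity of the number of ways to extend the cut `A` of `X` to the clique `Z`, all of whose
vertices lie on the same side. -/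
noncomputable def cutFactor (G : SimpleGraph V) (X Z A : Finset V) : ZMod 2 :=
  (if ∀ u ∈ Z, ∀ x ∈ X, G.Adj u x → x ∉ A then 1 else 0) +
    (if Z.Nonempty ∧ ∀ u ∈ Z, ∀ x ∈ X, G.Adj u x → x ∈ A then 1 else 0)

/-- `A` is one side of a cut of `X` that is crossed by no edge and has `r` on the other side. -/
def IsCut (G : SimpleGraph V) (X : Finset V) (r : V) (A : Finset V) : Prop :=
  A ⊆ X ∧ r ∉ A ∧ ∀ u ∈ X, ∀ v ∈ X, G.Adj u v → (u ∈ A ↔ v ∈ A)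

open Classical in
/-- The indicator function of `IsCut`. -/
noncomputable def cutIndicator (G : SimpleGraph V) (X : Finset V) (r : V) (A : Finset V) :
    ZMod 2 :=
  if IsCut G X r A then 1 else 0

/-- `A` and `b` describe a cut of `X` and the cliques `Z c` that is crossed by no edge. -/
def IsUncrossed (G : SimpleGraph V) (X : Finset V) (Z : ι → Finset V) (r : V)
    (p : Finset V × (ι → Bool)) : Prop :=
  IsCut G X r p.1 ∧
    ∀ c, (p.2 c = true → (Z c).Nonempty) ∧
      ∀ u ∈ Z c, ∀ x ∈ X, G.Adj u x → (x ∈ p.1 ↔ p.2 c = true)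

-- Distributivity: each factor has one term per side of its clique, and expanding the product turns
-- the choices of terms into the assignment `b` of sides.
open Classical in
theorem sum_prod_cutFactor [Fintype V] [DecidableEq ι] (G : SimpleGraph V) (X : Finset V) (Z : ι → Finset V) (r : V) :
    ∑ A : Finset V, cutIndicator G X r A * ∏ c, cutFactor G X (Z c) A =
      ∑ p : Finset V × (ι → Bool), if IsUncrossed G X Z r p then (1 : ZMod 2) else 0 := by
  have hf : ∀ A c, cutFactor G X (Z c) A = ∑ b : Bool, if (b = true → (Z c).Nonempty) ∧
      ∀ u ∈ Z c, ∀ x ∈ X, G.Adj u x → (x ∈ A ↔ b = true) then 1 else 0 := by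
    intro A c
    -- The requirement that a clique on the far side be nonempty makes an empty clique contribute
    -- one term, not two.
    rw [cutFactor, Fintype.sum_bool, add_comm]
    simp
    congr
  simp_rw [hf, Finset.prod_univ_sum, Fintype.piFinset_univ]
  rw [← Finset.univ_product_univ, Finset.sum_product]
  refine Finset.sum_congr rfl fun A _ => ?_
  rw [Finset.mul_sum]
  refine Finset.sum_congr rfl fun b _ => ?_
  rw [cutIndicator, Finset.prod_ite_zero]
  simp only [Finset.prod_const_one, ite_mul, one_mul, zero_mul, Finset.mem_univ, true_imp_iff]
  rw [← ite_and]
  by_cases h : IsUncrossed G X Z r (A, b)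
  · rw [if_pos h]
    exact if_pos h
  · rw [if_neg h]
    exact if_neg h

/-- A set of the form `X ∪ ⋃ Z c`, where the `Z c` are cliques without edges between them. -/
structure IsCliqueSplit (G : SimpleGraph V) (X : Finset V) (Z : ι → Finset V) (S : Finset V) :
    Prop where
  mem_iff : ∀ v, v ∈ S ↔ v ∈ X ∨ ∃ c, v ∈ Z c
  notMem : ∀ c, ∀ v ∈ Z c, v ∉ X
  eq_of_mem : ∀ c c', ∀ v, v ∈ Z c → v ∈ Z c' → c = c'
  adj : ∀ c, ∀ u ∈ Z c, ∀ v ∈ Z c, u ≠ v → G.Adj u v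
  eq_of_adj : ∀ c c', ∀ u ∈ Z c, ∀ v ∈ Z c', G.Adj u v → c = c'

-- If the graph is connected, only the trivial cut survives. Otherwise a closed set `R` that
-- contains `r` but not all of `S` gives a pairing of the uncrossed cuts, whose number is then even.
open Classical in
theorem IsCliqueSplit.sum_isUncrossed [Fintype V] [DecidableEq ι] {G : SimpleGraph V} {X S : Finset V} {Z : ι → Finset V}
    (h : IsCliqueSplit G X Z S) {r : V} (hr : r ∈ X) :
    (∑ p : Finset V × (ι → Bool), if IsUncrossed G X Z r p then (1 : ZMod 2) else 0) =
      if (G.induce (S : Set V)).Connected then 1 else 0 := by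
  have hrS : r ∈ (S : Set V) := Finset.mem_coe.2 ((h.mem_iff r).2 (.inl hr))
  split_ifs with hc
  · rw [Finset.sum_eq_single (∅, fun _ => false), if_pos]
    · simp [IsUncrossed, IsCut]
    · rintro ⟨A, b⟩ - hne
      rw [if_neg]
      rintro ⟨⟨hAX, hrA, hX⟩, hZ⟩
      -- The vertices on the side of `r` are closed under adjacency, hence are all of `S`.
      have hsub := (connected_induce_iff hrS).1 hc {v | v ∉ A ∧ ∀ c, v ∈ Z c → b c = false}
        ⟨hrA, fun c hrc => absurd hr (h.notMem c r hrc)⟩ (by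
          rintro u hu v hv huv ⟨huA, hub⟩
          have huA' : u ∉ A := huA
          rcases (h.mem_iff u).1 hu with hu | ⟨c, hu⟩ <;>
            rcases (h.mem_iff v).1 hv with hv | ⟨c', hv⟩
          · exact ⟨fun hvA => huA ((hX u hu v hv huv).2 hvA),
              fun c hvc => absurd hv (h.notMem c v hvc)⟩
          · refine ⟨fun hvA => h.notMem c' v hv (hAX hvA), fun c hvc => ?_⟩
            have := (hZ c).2 v hvc u hu huv.symm
            simpa [huA'] using this
          · have hbc := hub c hu
            have := (hZ c).2 u hu v hv huv
            refine ⟨fun hvA => by simp_all, fun c hvc => absurd hv (h.notMem c v hvc)⟩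
          · refine ⟨fun hvA => h.notMem c' v hv (hAX hvA), fun c'' hvc => ?_⟩
            obtain rfl := h.eq_of_mem _ _ _ hv hvc
            obtain rfl := h.eq_of_adj _ _ u hu v hv huv
            exact hub c hu)
      apply hne
      have hA : A = ∅ := Finset.eq_empty_of_forall_notMem fun v hv =>
        (hsub (Finset.mem_coe.2 ((h.mem_iff v).2 (.inl (hAX hv))))).1 hv
      have hb : b = fun _ => false := by
        funext c
        by_contra hbc
        have hbc' : b c = true := by simpa using hbc
        obtain ⟨u, hu⟩ := (hZ c).1 hbc'
        exact hbc ((hsub (Finset.mem_coe.2 ((h.mem_iff u).2 (.inr ⟨c, hu⟩)))).2 c hu)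
      rw [hA, hb]
    · simp
  · rw [connected_induce_iff hrS] at hc
    push Not at hc
    obtain ⟨R, hrR, hR, hSR⟩ := hc
    obtain ⟨w, hwS, hwR⟩ := Set.not_subset.1 hSR
    have hR' : ∀ u ∈ S, ∀ v ∈ S, G.Adj u v → (u ∈ R ↔ v ∈ R) := fun u hu v hv huv =>
      ⟨hR u hu v hv huv, hR v hv u hu huv.symm⟩
    have hZR : ∀ c, ∀ u ∈ Z c, ∀ v ∈ Z c, (u ∈ R ↔ v ∈ R) := by
      intro c u hu v hv
      by_cases huv : u = v
      · rw [huv]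
      · exact hR' u ((h.mem_iff u).2 (.inr ⟨c, hu⟩)) v ((h.mem_iff v).2 (.inr ⟨c, hv⟩))
          (h.adj c u hu v hv huv)
    -- Switch the sides of all vertices outside `R`. By `hZR` a clique lies inside or outside `R` as
    -- a whole, so its single bit is well defined; `r ∈ R` keeps its side.
    let τ : Finset V × (ι → Bool) → Finset V × (ι → Bool) := fun p =>
      (X.filter fun v => (v ∈ p.1 ↔ v ∈ R), fun c => (p.2 c) ^^ decide (∃ u ∈ Z c, u ∉ R))
    have hτ : ∀ p, IsUncrossed G X Z r p → IsUncrossed G X Z r (τ p) := by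
      rintro ⟨A, b⟩ ⟨⟨hAX, hrA, hX⟩, hZ⟩
      refine ⟨⟨Finset.filter_subset _ _, by simp_all [τ], ?_⟩, fun c => ⟨?_, ?_⟩⟩
      · intro u hu v hv huv
        have h1 := hX u hu v hv huv
        have h2 := hR' u ((h.mem_iff u).2 (.inl hu)) v ((h.mem_iff v).2 (.inl hv)) huv
        simp only [τ, Finset.mem_filter, hu, hv, true_and]
        simp only at h1
        rw [h1, h2]
      · intro hb
        by_contra hne
        have hZe : Z c = ∅ := Finset.not_nonempty_iff_eq_empty.1 hne
        have : b c = true := by simpa [τ, hZe] using hb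
        exact hne ((hZ c).1 this)
      · intro u hu x hx hux
        have h1 := (hZ c).2 u hu x hx hux
        have h2 := hR' u ((h.mem_iff u).2 (.inr ⟨c, hu⟩)) x ((h.mem_iff x).2 (.inl hx)) hux
        have h3 : (∃ u ∈ Z c, u ∉ R) ↔ u ∉ R :=
          ⟨fun ⟨u', hu', hn⟩ => by rwa [hZR c u hu u' hu'], fun hn => ⟨u, hu, hn⟩⟩
        simp only [τ, Finset.mem_filter, hx, true_and]
        simp only at h1
        simp only [h1, h3, ← h2]
        by_cases huR : u ∈ R <;> cases hb : b c <;> simp [huR]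
    have hττ : ∀ p, IsUncrossed G X Z r p → τ (τ p) = p := by
      rintro ⟨A, b⟩ ⟨⟨hAX, hrA, hX⟩, hZ⟩
      refine Prod.ext ?_ ?_
      · ext v
        simp only [τ, Finset.mem_filter]
        by_cases hvX : v ∈ X
        · by_cases hvR : v ∈ R <;> by_cases hvA : v ∈ A <;> simp [hvX, hvR, hvA]
        · simp only [hvX, false_and, false_iff]
          exact fun hvA => hvX (hAX hvA)
      · funext c
        simp [τ]
    -- The vertex `w ∉ R` changes its side, so no cut is fixed.
    have hfix : ∀ p, IsUncrossed G X Z r p → τ p ≠ p := by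
      rintro ⟨A, b⟩ ⟨⟨hAX, hrA, hX⟩, hZ⟩ heq
      rw [Prod.ext_iff] at heq
      rcases (h.mem_iff w).1 hwS with hw | ⟨c, hw⟩
      · have := Finset.ext_iff.1 heq.1 w
        simp [τ, hw, hwR] at this
      · have := congrFun heq.2 c
        have h3 : ∃ u ∈ Z c, u ∉ R := ⟨w, hw, hwR⟩
        simp [τ, h3] at this
    rw [← Finset.sum_filter]
    refine Finset.sum_involution (fun p _ => τ p) ?_ ?_ ?_ ?_
    · intro p hp
      exact CharTwo.add_self_eq_zero _
    · intro p hp _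
      exact hfix p (by simpa using hp)
    · intro p hp
      simpa using hτ p (by simpa using hp)
    · intro p hp
      exact hττ p (by simpa using hp)

theorem IsCliqueSplit.eq_union {G : SimpleGraph V} {X S : Finset V} {Z : ι → Finset V}
    (h : IsCliqueSplit G X Z S) : S = X ∪ Finset.univ.biUnion Z := by
  ext v
  simp [h.mem_iff]

theorem IsCliqueSplit.sum_eq {G : SimpleGraph V} {X S : Finset V} {Z : ι → Finset V}
    (h : IsCliqueSplit G X Z S) (f : V → ℕ) :
    ∑ v ∈ S, f v = ∑ v ∈ X, f v + ∑ c, ∑ v ∈ Z c, f v := by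
  rw [h.eq_union, Finset.sum_union, Finset.sum_biUnion]
  · intro c _ c' _ hcc'
    exact Finset.disjoint_left.2 fun v hv hv' => hcc' (h.eq_of_mem _ _ v hv hv')
  · rw [Finset.disjoint_left]
    intro v hv hv'
    obtain ⟨c, _, hc⟩ := Finset.mem_biUnion.1 hv'
    exact h.notMem c v hc hv

theorem IsCliqueSplit.card_eq {G : SimpleGraph V} {X S : Finset V} {Z : ι → Finset V}
    (h : IsCliqueSplit G X Z S) : S.card = X.card + ∑ c, (Z c).card := by
  have := h.sum_eq fun _ => 1
  simpa using this

/-- Pairs in two different cliques contribute nothing, and pairs between `X` and a clique occur in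
both orders. -/
theorem IsCliqueSplit.adjPairs_eq {G : SimpleGraph V} {X S : Finset V} {Z : ι → Finset V}
    (h : IsCliqueSplit G X Z S) :
    adjPairs G S S =
      adjPairs G X X + ∑ c, (2 * adjPairs G (Z c) X + adjPairs G (Z c) (Z c)) := by
  have h1 : ∀ T, adjPairs G S T = adjPairs G X T + ∑ c, adjPairs G (Z c) T := fun T =>
    h.sum_eq _
  have h2 : ∀ c, adjPairs G S (Z c) = adjPairs G (Z c) X + adjPairs G (Z c) (Z c) := by
    intro c
    rw [h1, adjPairs_comm G X, Finset.sum_eq_single c]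
    · intro c' _ hne
      refine Finset.sum_eq_zero fun u hu => Finset.sum_eq_zero fun v hv => if_neg fun huv => ?_
      exact hne (h.eq_of_adj _ _ u hu v hv huv)
    · simp
  rw [h1, adjPairs_comm G X S, h1, Finset.sum_congr rfl fun c _ => adjPairs_comm G (Z c) S,
    Finset.sum_congr rfl fun c _ => h2 c, add_assoc, ← Finset.sum_add_distrib]
  congr 1
  refine Finset.sum_congr rfl fun c _ => ?_
  ring

end Cuts

/-! ### Splitting a solution into its trace on a modulator and choices in cliques -/

section Split

variable {n : ℕ} (G : SimpleGraph (Fin n))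

/-- No three vertices outside `W` induce a path. -/
def IsPathFreeOutside (W : Finset (Fin n)) : Prop :=
  ∀ a b c, a ∉ W → b ∉ W → c ∉ W → G.Adj a b → G.Adj b c → a ≠ c → G.Adj a c

open Classical in
/-- The clique of `G \ W` with smallest vertex `c`; empty if there is none. -/
noncomputable def cliqueAt (W : Finset (Fin n)) (c : Fin n) : Finset (Fin n) :=
  Finset.univ.filter fun u => (c ∉ W ∧ ∀ v, v ∉ W → G.Adj v c → c < v) ∧
    u ∉ W ∧ (u = c ∨ G.Adj c u)

/-- The elements of `C` that are components of the pair `o`. -/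
def pick (C : Finset (Fin n)) (o : Fin n × Fin n) : Finset (Fin n) :=
  C.filter fun u => u = o.1 ∨ u = o.2

theorem card_pick_le (C : Finset (Fin n)) (o : Fin n × Fin n) : (pick C o).card ≤ 2 := by
  refine (Finset.card_le_card (t := {o.1, o.2}) fun u hu => ?_).trans Finset.card_le_two
  simpa using (Finset.mem_filter.1 hu).2

variable {G}

theorem mem_cliqueAt {W : Finset (Fin n)} {c u : Fin n} :
    u ∈ cliqueAt G W c ↔ (c ∉ W ∧ ∀ v, v ∉ W → G.Adj v c → c < v) ∧
      u ∉ W ∧ (u = c ∨ G.Adj c u) := by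
  simp [cliqueAt]

/-- Outside `W`, being equal or adjacent is transitive, so the least vertex of the closed
neighbourhood of `u` is the least vertex of its whole clique. -/
theorem IsPathFreeOutside.exists_mem_cliqueAt {W : Finset (Fin n)} (h : IsPathFreeOutside G W)
    {u : Fin n} (hu : u ∉ W) : ∃ c, u ∈ cliqueAt G W c := by
  classical
  let s : Finset (Fin n) := Finset.univ.filter fun v => v ∉ W ∧ (v = u ∨ G.Adj v u)
  have hs : s.Nonempty := ⟨u, by simp [s, hu]⟩
  obtain ⟨c, hm, hmin⟩ : ∃ c ∈ s, ∀ v ∈ s, c ≤ v := ⟨_, s.min'_mem hs, s.min'_le⟩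
  obtain ⟨hcW, hcu⟩ : c ∉ W ∧ (c = u ∨ G.Adj c u) := by simpa [s] using hm
  refine ⟨c, mem_cliqueAt.2 ⟨⟨hcW, fun v hvW hvc => ?_⟩, hu, hcu.imp Eq.symm id⟩⟩
  refine lt_of_le_of_ne (hmin v ?_) hvc.ne'
  simp only [s, Finset.mem_filter, Finset.mem_univ, true_and]
  refine ⟨hvW, ?_⟩
  by_cases hvu : v = u
  · exact .inl hvu
  · rcases hcu with rfl | hcu
    · exact .inr hvc
    · exact .inr (h v c u hvW hcW hu hvc hcu hvu)

theorem IsPathFreeOutside.adj_of_mem_cliqueAt {W : Finset (Fin n)} (h : IsPathFreeOutside G W)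
    {c u v : Fin n} (hu : u ∈ cliqueAt G W c) (hv : v ∈ cliqueAt G W c) (huv : u ≠ v) :
    G.Adj u v := by
  obtain ⟨⟨hc, _⟩, huW, hcu⟩ := mem_cliqueAt.1 hu
  obtain ⟨_, hvW, hcv⟩ := mem_cliqueAt.1 hv
  rcases hcu with rfl | hcu
  · exact hcv.resolve_left fun h => huv h.symm
  · rcases hcv with rfl | hcv
    · exact hcu.symm
    · exact h u c v huW hc hvW hcu.symm hcv huv

/-- By transitivity the representatives `c` and `c'` are equal or adjacent; if adjacent, minimality
would make each smaller than the other. -/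
theorem IsPathFreeOutside.eq_of_adj_cliqueAt {W : Finset (Fin n)} (h : IsPathFreeOutside G W)
    {c c' u v : Fin n} (hu : u ∈ cliqueAt G W c) (hv : v ∈ cliqueAt G W c')
    (huv : u = v ∨ G.Adj u v) : c = c' := by
  obtain ⟨⟨hc, hcm⟩, huW, hcu⟩ := mem_cliqueAt.1 hu
  obtain ⟨⟨hc', hcm'⟩, hvW, hcv⟩ := mem_cliqueAt.1 hv
  have trans : ∀ a b d, a ∉ W → b ∉ W → d ∉ W → (a = b ∨ G.Adj a b) → (b = d ∨ G.Adj b d) →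
      (a = d ∨ G.Adj a d) := by
    rintro a b d ha hb hd (rfl | hab) (rfl | hbd)
    · exact .inl rfl
    · exact .inr hbd
    · exact .inr hab
    · by_cases had : a = d
      · exact .inl had
      · exact .inr (h a b d ha hb hd hab hbd had)
  have h1 := trans c u v hc huW hvW (hcu.imp Eq.symm id) huv
  have h2 := trans c v c' hc hvW hc' h1 (hcv.imp id fun h => h.symm)
  rcases h2 with h2 | h2
  · exact h2
  · exact absurd (hcm' c hc h2) (lt_asymm (hcm c' hc' h2.symm))

theorem IsPathFreeOutside.isCliqueSplit {W X S : Finset (Fin n)} (h : IsPathFreeOutside G W)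
    (hX : X ⊆ W) {Z : Fin n → Finset (Fin n)} (hZ : ∀ c, Z c ⊆ cliqueAt G W c)
    (hS : ∀ v, v ∈ S ↔ v ∈ X ∨ ∃ c, v ∈ Z c) : IsCliqueSplit G X Z S where
  mem_iff := hS
  notMem _ _ hv hvX := (mem_cliqueAt.1 (hZ _ hv)).2.1 (hX hvX)
  eq_of_mem _ _ _ hv hv' := h.eq_of_adj_cliqueAt (hZ _ hv) (hZ _ hv') (.inl rfl)
  adj _ _ hu _ hv := h.adj_of_mem_cliqueAt (hZ _ hu) (hZ _ hv)
  eq_of_adj _ _ _ hu _ hv huv := h.eq_of_adj_cliqueAt (hZ _ hu) (hZ _ hv) (.inr huv)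

/-- The contribution of the clique `Z` to the weight of a solution that meets `W` in `X`. -/
noncomputable def cliqueWeight (G : SimpleGraph (Fin n)) (X Z : Finset (Fin n)) : ℕ :=
  2 * adjPairs G Z X + adjPairs G Z Z + (4 - 2 * Z.card)

/-- Since `|Z c| ≤ 2`, the term `4 - 2 * |Z c|` is an honest difference. Adding 4 for every index,
including those with empty clique, makes all weights nonnegative and explains the `4 * n`. -/
theorem IsCliqueSplit.isTree_iff {X S : Finset (Fin n)} {Z : Fin n → Finset (Fin n)}
    (h : IsCliqueSplit G X Z S) (hZ : ∀ c, (Z c).card ≤ 2) :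
    (G.induce (S : Set (Fin n))).IsTree ↔ (G.induce (S : Set (Fin n))).Connected ∧
      adjPairs G X X + ∑ c, cliqueWeight G X (Z c) + 2 = 2 * X.card + 4 * n := by
  rw [isTree_induce_iff]
  refine and_congr_right fun _ => ?_
  have h1 : ∑ c, cliqueWeight G X (Z c) + 2 * ∑ c, (Z c).card =
      ∑ c, (2 * adjPairs G (Z c) X + adjPairs G (Z c) (Z c)) + 4 * n := by
    rw [Finset.mul_sum, ← Finset.sum_add_distrib]
    have : 4 * n = ∑ _c : Fin n, 4 := by simp [mul_comm]
    rw [this, ← Finset.sum_add_distrib]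
    refine Finset.sum_congr rfl fun c _ => ?_
    have := hZ c
    rw [cliqueWeight]
    omega
  rw [h.adjPairs_eq, h.card_eq]
  omega

/-- Pairs encode the sets of at most two vertices: a repeated entry gives a singleton, and a vertex
`r` outside the clique gives the empty set. -/
theorem exists_pick_eq {C T : Finset (Fin n)} (hT : T ⊆ C) (hc : T.card ≤ 2) {r : Fin n}
    (hr : r ∉ C) : ∃ o, pick C o = T := by
  rcases Finset.eq_empty_or_nonempty T with rfl | ⟨a, ha⟩
  · exact ⟨(r, r), by
      simp only [pick, or_self, Finset.filter_eq_empty_iff]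
      rintro u hu rfl
      exact hr hu⟩
  · have hcard : (T.erase a).card ≤ 1 := by
      rw [Finset.card_erase_of_mem ha]
      omega
    rcases Finset.eq_empty_or_nonempty (T.erase a) with he | ⟨b, hb⟩
    · refine ⟨(a, a), ?_⟩
      ext u
      simp only [pick, or_self, Finset.mem_filter]
      refine ⟨fun hu => hu.2 ▸ ha, fun hu => ⟨hT hu, ?_⟩⟩
      by_contra hne
      exact Finset.notMem_empty u (he ▸ Finset.mem_erase.2 ⟨hne, hu⟩)
    · refine ⟨(a, b), ?_⟩
      ext u
      simp only [pick, Finset.mem_filter]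
      constructor
      · rintro ⟨_, rfl | rfl⟩
        · exact ha
        · exact (Finset.mem_erase.1 hb).2
      · intro hu
        refine ⟨hT hu, ?_⟩
        by_cases hne : u = a
        · exact .inl hne
        · exact .inr (Finset.card_le_one.1 hcard u (Finset.mem_erase.2 ⟨hne, hu⟩) b hb)

/-- The existence of a solution in terms of choices for the modulator `W r` and the cliques
outside it. -/
theorem hasInducedTree_iff_exists_pick {K : Finset (Fin n)} {W : Fin n → Finset (Fin n)}
    (hrW : ∀ r, r ∈ W r) (hW : ∀ r, IsPathFreeOutside G (W r)) :
    HasInducedTree G K ↔ ∃ r, ∃ X ⊆ W r, r ∈ X ∧ K ∩ W r ⊆ X ∧ ∃ o : Fin n → Fin n × Fin n,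
      (∀ c, K ∩ cliqueAt G (W r) c ⊆ pick (cliqueAt G (W r) c) (o c)) ∧
      (∑ A : Finset (Fin n),
        cutIndicator G X r A * ∏ c, cutFactor G X (pick (cliqueAt G (W r) c) (o c)) A) ≠ 0 ∧
      adjPairs G X X + ∑ c, cliqueWeight G X (pick (cliqueAt G (W r) c) (o c)) + 2 =
        2 * X.card + 4 * n := by
  constructor
  · rintro ⟨S₀, hKS, hT⟩
    obtain ⟨S, rfl⟩ : ∃ S : Finset (Fin n), (S : Set (Fin n)) = S₀ :=
      ⟨S₀.toFinite.toFinset, by simp⟩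
    -- Any vertex of the tree can serve as root; membership in `W r` makes it part of the trace `X`,
    -- where the parity count fixes its side.
    obtain ⟨⟨r, hr⟩⟩ := hT.connected.nonempty
    have hrX : r ∈ S ∩ W r := Finset.mem_inter.2 ⟨hr, hrW r⟩
    have hcard : ∀ c, (S ∩ cliqueAt G (W r) c).card ≤ 2 := by
      intro c
      by_contra! hlt
      obtain ⟨a, ha, b, hb, d, hd, hab, had, hbd⟩ := Finset.two_lt_card.1 hlt
      simp only [Finset.mem_inter] at ha hb hd
      -- Three chosen vertices of one clique would form a triangle.
      refine hT.isAcyclic.cliqueFree le_rfl {⟨a, ha.1⟩, ⟨b, hb.1⟩, ⟨d, hd.1⟩} ?_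
      rw [SimpleGraph.is3Clique_triple_iff]
      exact ⟨(hW r).adj_of_mem_cliqueAt ha.2 hb.2 hab, (hW r).adj_of_mem_cliqueAt ha.2 hd.2 had,
        (hW r).adj_of_mem_cliqueAt hb.2 hd.2 hbd⟩
    choose o ho using fun c => exists_pick_eq Finset.inter_subset_right (hcard c)
      (r := r) fun h => (mem_cliqueAt.1 h).2.1 (hrW r)
    have hsplit : IsCliqueSplit G (S ∩ W r) (fun c => pick (cliqueAt G (W r) c) (o c)) S := by
      refine (hW r).isCliqueSplit Finset.inter_subset_right
        (fun c => Finset.filter_subset _ _) fun v => ?_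
      simp only [ho, Finset.mem_inter]
      by_cases hv : v ∈ W r
      · constructor
        · exact fun h => .inl ⟨h, hv⟩
        · rintro (h | ⟨c, h⟩) <;> exact h.1
      · obtain ⟨c, hc⟩ := (hW r).exists_mem_cliqueAt hv
        constructor
        · exact fun h => .inr ⟨c, h, hc⟩
        · rintro (h | ⟨c, h⟩) <;> exact h.1
    have hiff := hsplit.isTree_iff (fun c => card_pick_le _ _)
    have hT' := hiff.1 hT
    refine ⟨r, S ∩ W r, Finset.inter_subset_right, hrX, ?_, o, ?_, ?_, hT'.2⟩
    · exact Finset.inter_subset_inter_right (by exact_mod_cast hKS)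
    · intro c
      rw [ho]
      exact Finset.inter_subset_inter_right (by exact_mod_cast hKS)
    · rw [sum_prod_cutFactor, hsplit.sum_isUncrossed hrX, if_pos hT'.1]
      exact one_ne_zero
  · rintro ⟨r, X, hXW, hrX, hKX, o, hKo, hodd, hwt⟩
    have hsplit : IsCliqueSplit G X (fun c => pick (cliqueAt G (W r) c) (o c))
        (X ∪ Finset.univ.biUnion fun c => pick (cliqueAt G (W r) c) (o c)) :=
      (hW r).isCliqueSplit hXW (fun c => Finset.filter_subset _ _) fun v => by simp
    refine ⟨_, ?_, (hsplit.isTree_iff (fun c => card_pick_le _ _)).2 ⟨?_, hwt⟩⟩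
    · intro v hv
      rw [Finset.mem_coe, hsplit.mem_iff]
      by_cases hvW : v ∈ W r
      · exact .inl (hKX (Finset.mem_inter.2 ⟨hv, hvW⟩))
      · obtain ⟨c, hc⟩ := (hW r).exists_mem_cliqueAt hvW
        exact .inr ⟨c, hKo c (Finset.mem_inter.2 ⟨hv, hc⟩)⟩
    · rw [sum_prod_cutFactor, hsplit.sum_isUncrossed hrX] at hodd
      by_contra hc
      exact hodd (if_neg hc)

end Split

/-! ### Derived terms -/

namespace Tm

/-- Negation of a truth value. -/
def notT (e : Tm) : Tm := .sub (.const 1) e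

/-- Conjunction. -/
def andT (e f : Tm) : Tm := .ite e f (.const 0)

/-- Implication. -/
def impT (e f : Tm) : Tm := .ite e f (.const 1)

/-- Comparison. -/
def ltT (e f : Tm) : Tm := notT (notT (.sub f e))

/-- Equality. -/
def eqT (e f : Tm) : Tm := notT (.add (.sub e f) (.sub f e))

/-- Bounded universal quantification. -/
def allT (k b : ℕ) (f : Tm) : Tm := notT (.sum k b (notT f))

/-- The product of `e` and `f`, if `e` is at most the entry `b` of the array `2`. -/
def mulT (b : ℕ) (e f : Tm) : Tm := .sum 99 b (.ite (ltT (.bv 99) e) f (.const 0))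

/-- Half of `e`, rounded down, if this is at most the entry `1` of the array `2`. -/
def halfT (e : Tm) : Tm :=
  .sum 99 1 (ltT (.add (.add (.bv 99) (.bv 99)) (.const 1)) e)

/-- The parity of `e`. -/
def modT (e : Tm) : Tm := .sub e (.add (halfT e) (halfT e))

variable {η : Env} {A : Mem} {e f g : Tm} {k b : ℕ}

@[simp] theorem eval_const {c : ℕ} : (const c).eval η A = c := by rw [eval]

@[simp] theorem eval_bv : (bv k).eval η A = η k := by rw [eval]

@[simp] theorem eval_add : (add e f).eval η A = e.eval η A + f.eval η A := by rw [eval]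

@[simp] theorem eval_sub : (sub e f).eval η A = e.eval η A - f.eval η A := by rw [eval]

@[simp] theorem eval_read {a : ℕ} : (read a e).eval η A = A a (e.eval η A) := by rw [eval]

@[simp] theorem eval_ite :
    (ite e f g).eval η A = if e.eval η A = 0 then g.eval η A else f.eval η A := by
  simp [eval, ite_not]

theorem eval_sum :
    (sum k b f).eval η A = ∑ i ∈ Finset.range (A 2 b), f.eval (Function.update η k i) A := rfl

@[simp] theorem eval_notT : (notT e).eval η A = if e.eval η A = 0 then 1 else 0 := by
  simp only [notT, eval_sub, eval_const]
  split_ifs <;> omega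

@[simp] theorem eval_andT :
    (andT e f).eval η A = if e.eval η A = 0 then 0 else f.eval η A := by
  simp [andT]

@[simp] theorem eval_impT :
    (impT e f).eval η A = if e.eval η A = 0 then 1 else f.eval η A := by
  simp [impT]

@[simp] theorem eval_ltT :
    (ltT e f).eval η A = if e.eval η A < f.eval η A then 1 else 0 := by
  by_cases h : e.eval η A < f.eval η A
  · simp [ltT, h, Nat.sub_eq_zero_iff_le]
  · simp [ltT, h, not_lt.1 h]

@[simp] theorem eval_eqT :
    (eqT e f).eval η A = if e.eval η A = f.eval η A then 1 else 0 := by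
  simp only [eqT, eval_sub, eval_add, eval_notT]
  refine if_congr ?_ rfl rfl
  omega

theorem eval_allT :
    (allT k b f).eval η A =
      if ∀ i < A 2 b, f.eval (Function.update η k i) A ≠ 0 then 1 else 0 := by
  simp [allT, eval_sum]

/-- Repeated addition: `y` is added once for each index below `x`, so the summation range must reach
`x`. Variable 99 is reserved for this sum, hence the values of `e` and `f` must not depend on it. -/
theorem eval_mulT {x y : ℕ} (he : ∀ i, e.eval (Function.update η 99 i) A = x)
    (hf : ∀ i, f.eval (Function.update η 99 i) A = y) (hx : x ≤ A 2 b) :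
    (mulT b e f).eval η A = x * y := by
  have h : ∀ N, ∑ i ∈ Finset.range N, (if i < x then y else 0) = min x N * y := by
    intro N
    induction N with
    | zero => simp
    | succ N ih =>
      rw [Finset.sum_range_succ, ih]
      split_ifs with h
      · rw [min_eq_right h.le, min_eq_right h, Nat.succ_mul]
      · rw [min_eq_left (by omega), min_eq_left (by omega), add_zero]
  simp only [mulT, eval_sum, eval_ite, eval_ltT, he, hf, eval_bv, Function.update_self,
    eval_const]
  rw [← min_eq_left hx, ← h]
  refine Finset.sum_congr rfl fun i _ => ?_
  rw [min_eq_left hx]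
  by_cases hi : i < x <;> simp [hi]

/-- Exactly `x / 2` indices `i` satisfy `2 * i + 2 ≤ x`. -/
theorem eval_halfT {x : ℕ} (he : ∀ i, e.eval (Function.update η 99 i) A = x)
    (hx : x ≤ 2 * A 2 1) : (halfT e).eval η A = x / 2 := by
  have h : ∀ N, ∑ i ∈ Finset.range N, (if i + i + 1 < x then 1 else 0) = min (x / 2) N := by
    intro N
    induction N with
    | zero => simp
    | succ N ih =>
      rw [Finset.sum_range_succ, ih]
      split_ifs with h <;> omega
  simp only [halfT, eval_sum, eval_ltT, he, eval_bv, Function.update_self, eval_const, eval_add]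
  rw [h]
  omega

theorem eval_modT {x : ℕ} (he : ∀ i, e.eval (Function.update η 99 i) A = x)
    (he' : e.eval η A = x) (hx : x ≤ 2 * A 2 1) : (modT e).eval η A = x % 2 := by
  simp only [modT, eval_sub, eval_add, eval_halfT he hx, he']
  omega

end Tm

/-! ### Loops that fill arrays -/

theorem Cmd.den_seq {p r : Cmd} {η : Env} {A : Mem} :
    (Cmd.seq p r).den η A = r.den η (p.den η A) := rfl

theorem Cmd.den_store {a : ℕ} {i e : Tm} {η : Env} {A : Mem} (m : ℕ) :
    (Cmd.store a i e).den η A a m = if m = i.eval η A then e.eval η A else A a m := by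
  simp [Cmd.den, Function.update_apply]

theorem Cmd.den_store_of_ne {a a' : ℕ} (h : a' ≠ a) {i e : Tm} {η : Env} {A : Mem} :
    (Cmd.store a i e).den η A a' = A a' := by
  simp [Cmd.den, Function.update_of_ne h]

/-- Distinct rounds write distinct addresses, so a cell still has its original content when its turn
comes. This is what permits updates in place, where `e` reads the cell it overwrites. -/
theorem Cmd.den_store_loop {a k b : ℕ} {i e : Tm} {η : Env} {A : Mem} {N : ℕ}
    (hN : A 2 b = N) (p F : ℕ → ℕ) (hp : ∀ x < N, ∀ y < N, p x = p y → x = y)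
    (hi : ∀ x < N, ∀ A' : Mem, (∀ a' ≠ a, A' a' = A a') →
      i.eval (Function.update η k x) A' = p x)
    (he : ∀ x < N, ∀ A' : Mem, (∀ a' ≠ a, A' a' = A a') → A' a (p x) = A a (p x) →
      e.eval (Function.update η k x) A' = F x) :
    (∀ x < N, (Cmd.forr k b (.store a i e)).den η A a (p x) = F x) ∧
      ∀ m, (∀ x < N, m ≠ p x) → (Cmd.forr k b (.store a i e)).den η A a m = A a m := by
  subst hN
  have := Cmd.den_forr_induction (k := k) (b := b) (p := .store a i e) (η := η) (A := A)
    (fun y A' => (∀ a' ≠ a, A' a' = A a') ∧ (∀ x < A 2 b, x < y → A' a (p x) = F x) ∧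
      ∀ m, (∀ x < A 2 b, x < y → m ≠ p x) → A' a m = A a m)
    ⟨fun _ _ => rfl, fun x _ hx => absurd hx (Nat.not_lt_zero x), fun _ _ => rfl⟩ (by
      rintro y hy A' ⟨h1, h2, h3⟩
      have hpy : A' a (p y) = A a (p y) :=
        h3 _ fun x hx hxy h => (hp y hy x hx h ▸ hxy).false
      refine ⟨fun a' ha' => by rw [Cmd.den_store_of_ne ha', h1 a' ha'], ?_, ?_⟩
      · intro x hx hxy
        rw [Cmd.den_store, hi y hy A' h1]
        by_cases hxy' : x = y
        · subst hxy'
          rw [if_pos rfl, he x hx A' h1 hpy]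
        · rw [if_neg fun h => hxy' (hp x hx y hy h), h2 x hx (by omega)]
      · intro m hm
        rw [Cmd.den_store, hi y hy A' h1, if_neg (hm y hy (Nat.lt_succ_self y)),
          h3 m fun x hx hxy => hm x hx (by omega)])
  exact ⟨fun x hx => this.2.1 x hx hx, fun m hm => this.2.2 m fun x hx _ => hm x hx⟩

/-- Filling an array by a loop, with the new contents given as a function of the address. -/
theorem Cmd.den_forr_write {a k b : ℕ} {q : Cmd} {η : Env} {A : Mem} {P : ℕ → ℕ → Prop}
    {F : ℕ → ℕ} {N : ℕ} (hN : A 2 b = N) (hw : ∀ a' ≠ a, q.writes a' = false)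
    (hq : ∀ i < N, ∀ A' : Mem, (∀ a' ≠ a, A' a' = A a') → ∀ m,
      (P i m → q.den (Function.update η k i) A' a m = F m) ∧
      (¬ P i m → q.den (Function.update η k i) A' a m = A' a m)) (m : ℕ) :
    ((∃ i < N, P i m) → (Cmd.forr k b q).den η A a m = F m) ∧
      ((¬ ∃ i < N, P i m) → (Cmd.forr k b q).den η A a m = A a m) := by
  subst hN
  have := Cmd.den_forr_induction (k := k) (b := b) (p := q) (η := η) (A := A)
    (fun y A' => (∀ a' ≠ a, A' a' = A a') ∧ ((∃ i < y, P i m) → A' a m = F m) ∧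
      ((¬ ∃ i < y, P i m) → A' a m = A a m))
    ⟨fun _ _ => rfl, fun ⟨x, hx, _⟩ => absurd hx (Nat.not_lt_zero x), fun _ => rfl⟩ (by
      rintro y hy A' ⟨h1, h2, h3⟩
      refine ⟨fun a' ha' => by rw [q.den_of_not_writes (hw a' ha'), h1 a' ha'], ?_, ?_⟩
      · rintro ⟨i, hi, hPi⟩
        by_cases hPy : P y m
        · exact (hq y hy A' h1 m).1 hPy
        · rw [(hq y hy A' h1 m).2 hPy]
          refine h2 ⟨i, ?_, hPi⟩
          rcases Nat.lt_succ_iff_lt_or_eq.1 hi with h | rfl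
          · exact h
          · exact absurd hPi hPy
      · intro hn
        rw [(hq y hy A' h1 m).2 fun h => hn ⟨y, Nat.lt_succ_self y, h⟩]
        exact h3 fun ⟨i, hi, hPi⟩ => hn ⟨i, by omega, hPi⟩)
  exact this.2

theorem mul_add_inj {M a a' b b' : ℕ} (hb : b < M) (hb' : b' < M)
    (h : a * M + b = a' * M + b') : a = a' ∧ b = b' := by
  have h1 := congrArg (· / M) h
  have h2 := congrArg (· % M) h
  have hM : 0 < M := by omega
  simp only [Nat.mul_add_mod', Nat.mod_eq_of_lt hb, Nat.mod_eq_of_lt hb'] at h2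
  simp only [mul_comm _ M, Nat.mul_add_div hM, Nat.div_eq_of_lt hb, Nat.div_eq_of_lt hb',
    add_zero] at h1
  exact ⟨h1, h2⟩

/-- The address of entry `k` of row `j` of table number `t`. -/
def cellIndex (M t j k : ℕ) : ℕ := t * (M * M) + (j * M + k)

theorem cellIndex_inj {M t t' j j' k k' : ℕ} (hj : j < M) (hj' : j' < M) (hk : k < M)
    (hk' : k' < M) (h : cellIndex M t j k = cellIndex M t' j' k') : t = t' ∧ j = j' ∧ k = k' := by
  have hlt : ∀ {j k}, j < M → k < M → j * M + k < M * M := by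
    intro j k hj hk
    calc j * M + k < (j + 1) * M := by rw [Nat.succ_mul]; omega
      _ ≤ M * M := Nat.mul_le_mul_right _ hj
  obtain ⟨h1, h2⟩ := mul_add_inj (hlt hj hk) (hlt hj' hk') h
  exact ⟨h1, mul_add_inj hk hk' h2⟩

/-- The entries `0`, `1`, `2` of the array `2` hold the loop bounds. -/
structure HasBounds (A : Mem) (n M : ℕ) : Prop where
  zero : A 2 0 = n
  one : A 2 1 = M
  two : A 2 2 = 6 * n + 1

theorem HasBounds.congr {A A' : Mem} {n M : ℕ} (h : HasBounds A n M) (h' : A' 2 = A 2) :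
    HasBounds A' n M :=
  ⟨by rw [h', h.zero], by rw [h', h.one], by rw [h', h.two]⟩

namespace Tm

/-- The address of the entry `bv k` of the row `bv j` of the table with number `e`. -/
def cellT (e : Tm) (j k : ℕ) : Tm :=
  .add (mulT 2 e (.sum 99 1 (.read 2 (.const 1))))
    (.add (mulT 1 (.bv j) (.read 2 (.const 1))) (.bv k))

theorem eval_cellT {A : Mem} {n M : ℕ} (h : HasBounds A n M) {η : Env} {e : Tm} {j k t : ℕ}
    (he : ∀ i, e.eval (Function.update η 99 i) A = t) (ht : t ≤ 6 * n + 1) (hj : η j ≤ M)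
    (hj' : j ≠ 99) : (cellT e j k).eval η A = cellIndex M t (η j) (η k) := by
  -- The factor `M * M` is itself computed as a sum of `M` copies of `M`.
  rw [cellT, eval_add, eval_mulT (x := t) (y := M * M) he, eval_add,
    eval_mulT (x := η j) (y := M), eval_bv, cellIndex]
  · intro i
    simp [Function.update_of_ne hj']
  · intro i
    simp [h.one]
  · rw [h.one]
    exact hj
  · intro i
    simp [eval_sum, h.one]
  · rw [h.two]
    exact ht

/-- The sum of two truth values modulo two. -/
def xorT (e f : Tm) : Tm := .ite e (notT f) f

theorem eval_xorT {e f : Tm} {η : Env} {A : Mem} {x y : ZMod 2} (he : e.eval η A = x.val)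
    (hf : f.eval η A = y.val) : (xorT e f).eval η A = (x + y).val := by
  simp only [xorT, eval_ite, eval_notT, he, hf]
  clear he hf
  revert x y
  decide

end Tm

/-! ### Insertion into an echelon basis -/

/-- The array `a` holds the tables `R t` for `t ≤ 6 * n`. -/
def HoldsTables (a : ℕ) (A : Mem) (n : ℕ) {M : ℕ} (R : ℕ → Fin M → Fin M → ZMod 2) : Prop :=
  ∀ t ≤ 6 * n, ∀ j k : Fin M, A a (cellIndex M t j k) = (R t j k).val

/-- The array `a` holds the vector `v`. -/
def HoldsVec (a : ℕ) (A : Mem) {M : ℕ} (v : Fin M → ZMod 2) : Prop :=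
  ∀ k : Fin M, A a k = (v k).val

namespace Cmd

/-- One step of the insertion of a vector, for the pivot `bv 10`. -/
def reduceStep (a : ℕ) : Cmd :=
  .seq (.store 14 (.const 0) (.read 9 (.bv 10)))
  (.seq (.store 14 (.const 1)
    (.ite (.read a (Tm.cellT (.read 12 (.const 1)) 10 10)) (.const 0) (.read 14 (.const 0))))
  (.seq (.forr 7 1 (.store a (Tm.cellT (.read 12 (.const 1)) 10 7)
    (.ite (.read 14 (.const 1)) (.read 9 (.bv 7))
      (.read a (Tm.cellT (.read 12 (.const 1)) 10 7)))))
  (.forr 7 1 (.store 9 (.bv 7) (.ite (.read 14 (.const 0))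
    (Tm.xorT (.read 9 (.bv 7)) (.read a (Tm.cellT (.read 12 (.const 1)) 10 7)))
    (.read 9 (.bv 7)))))))

/-- Insert the vector in the array `9` into the table of the array `a` whose number is in
the cell `1` of the array `12`. -/
def insert (a : ℕ) : Cmd := .forr 10 1 (reduceStep a)

/-- The entry of `v` at the pivot and the decision whether to replace the row are saved in the array
`14` beforehand, so both loops use the old values although they change the row and the vector. -/
theorem den_reduceStep {a : ℕ} (ha : a ≠ 2 ∧ a ≠ 9 ∧ a ≠ 12 ∧ a ≠ 14) {A : Mem} {n M t : ℕ}
    (hb : HasBounds A n M) (ht : t ≤ 6 * n) (hA : A 12 1 = t) {R : ℕ → Fin M → Fin M → ZMod 2}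
    (hR : HoldsTables a A n R) {v : Fin M → ZMod 2} (hv : HoldsVec 9 A v) {η : Env} {j : Fin M}
    (hη : η 10 = j) :
    HoldsTables a ((reduceStep a).den η A) n
        (Function.update R t (Function.update (R t) j (reduceRow (R t) v j))) ∧
      HoldsVec 9 ((reduceStep a).den η A) (reduceVec (R t) v j) := by
  obtain ⟨ha2, ha9, ha12, ha14⟩ := ha
  have hidx : ∀ (k : ℕ) (A' : Mem), A' 2 = A 2 → A' 12 = A 12 → ∀ η' : Env, η' 10 = j →
      (Tm.cellT (.read 12 (.const 1)) 10 k).eval η' A' = cellIndex M t j (η' k) := by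
    intro k A' h2 h12 η' hη'
    rw [Tm.eval_cellT (hb.congr h2) (t := t) (by simp [h12, hA]) (by omega)
      (by rw [hη']; exact j.2.le) (by omega), hη']
  rw [reduceStep, den_seq, den_seq, den_seq]
  set A₁ := (store 14 (.const 0) (.read 9 (.bv 10))).den η A with hA₁
  have f₁ : ∀ a' ≠ 14, A₁ a' = A a' := fun a' h => den_store_of_ne h
  have v₁ : A₁ 14 0 = (v j).val := by simp [hA₁, den_store, hη, hv j]
  set A₂ := (store 14 (.const 1) (.ite (.read a (Tm.cellT (.read 12 (.const 1)) 10 10))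
    (.const 0) (.read 14 (.const 0)))).den η A₁ with hA₂
  have f₂ : ∀ a' ≠ 14, A₂ a' = A a' := fun a' h => by rw [hA₂, den_store_of_ne h, f₁ a' h]
  have v₂ : A₂ 14 0 = (v j).val := by simp [hA₂, den_store, v₁]
  have w₂ : A₂ 14 1 = if R t j j = 0 then (v j).val else 0 := by
    simp only [hA₂, den_store, Tm.eval_const, if_true, Tm.eval_ite, Tm.eval_read]
    rw [hidx 10 A₁ (f₁ 2 (by omega)) (f₁ 12 (by omega)) η hη, hη, f₁ a ha14, hR t ht j j, v₁]
    simp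
  set A₃ := (forr 7 1 (.store a (Tm.cellT (.read 12 (.const 1)) 10 7)
    (.ite (.read 14 (.const 1)) (.read 9 (.bv 7))
      (.read a (Tm.cellT (.read 12 (.const 1)) 10 7))))).den η A₂ with hA₃
  have hη7 : ∀ x : ℕ, Function.update η 7 x 10 = j := fun x => by simpa using hη
  obtain ⟨g₃, h₃⟩ := den_store_loop (a := a) (k := 7) (b := 1)
    (i := Tm.cellT (.read 12 (.const 1)) 10 7)
    (e := .ite (.read 14 (.const 1)) (.read 9 (.bv 7))
      (.read a (Tm.cellT (.read 12 (.const 1)) 10 7))) (η := η) (A := A₂) (N := M)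
    (by rw [f₂ 2 (by omega), hb.one]) (fun k => cellIndex M t j k)
    (fun k => if hk : k < M then (reduceRow (R t) v j ⟨k, hk⟩).val else 0)
    (fun x hx y hy h => (cellIndex_inj j.2 j.2 hx hy h).2.2)
    (fun x hx A' h => by
      rw [hidx 7 A' (by rw [h 2 ha2.symm, f₂ 2 (by omega)])
        (by rw [h 12 ha12.symm, f₂ 12 (by omega)]) _ (hη7 x)]
      simp)
    (fun x hx A' h hx' => by
      simp only [Tm.eval_ite, Tm.eval_read, Tm.eval_const, Tm.eval_bv]
      rw [hidx 7 A' (by rw [h 2 ha2.symm, f₂ 2 (by omega)])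
        (by rw [h 12 ha12.symm, f₂ 12 (by omega)]) _ (hη7 x), Function.update_self, hx',
        h 14 ha14.symm, h 9 ha9.symm, f₂ 9 (by omega), f₂ a ha14, w₂, hR t ht j ⟨x, hx⟩,
        hv ⟨x, hx⟩, dif_pos hx, reduceRow]
      by_cases h0 : R t j j = 0 <;> by_cases h1 : v j = 0
      · simp [h0, h1]
      · simp [h0, zmod_two_eq_one h1, ZMod.val_one]
      · simp [h0]
      · simp [h0])
  rw [← hA₃] at g₃ h₃
  have f₃ : ∀ a' ≠ 14, a' ≠ a → A₃ a' = A a' := by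
    intro a' h h'
    rw [hA₃, den_of_not_writes _ (by simpa [writes] using h'), f₂ a' h]
  have v₃ : A₃ 14 = A₂ 14 := den_of_not_writes _ (by simpa [writes] using ha14.symm) _ _
  have t₃ : HoldsTables a A₃ n
      (Function.update R t (Function.update (R t) j (reduceRow (R t) v j))) := by
    intro t' ht' j' k'
    by_cases htj : t' = t ∧ j' = j
    · obtain ⟨rfl, rfl⟩ := htj
      have := g₃ k' k'.2
      simpa using this
    · rw [h₃ _ fun x hx h => htj ?_, f₂ a ha14, hR t' ht']
      · congr 1
        by_cases htt : t' = t
        · subst htt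
          have hjj : j' ≠ j := fun h => htj ⟨rfl, h⟩
          simp [Function.update_of_ne hjj]
        · simp [Function.update_of_ne htt]
      · obtain ⟨h1, h2, _⟩ := cellIndex_inj j'.2 j.2 k'.2 hx h
        exact ⟨h1, Fin.ext h2⟩
  refine ⟨?_, ?_⟩
  · intro t' ht' j' k'
    rw [den_of_not_writes _ (by simpa [writes] using ha9)]
    exact t₃ t' ht' j' k'
  · obtain ⟨g₄, -⟩ := den_store_loop (a := 9) (k := 7) (b := 1) (i := .bv 7)
      (e := .ite (.read 14 (.const 0))
        (Tm.xorT (.read 9 (.bv 7)) (.read a (Tm.cellT (.read 12 (.const 1)) 10 7)))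
        (.read 9 (.bv 7))) (η := η) (A := A₃) (N := M)
      (by rw [f₃ 2 (by omega) ha2.symm, hb.one]) (fun k => k)
      (fun k => if hk : k < M then (reduceVec (R t) v j ⟨k, hk⟩).val else 0)
      (fun x hx y hy h => h)
      (fun x hx A' h => by simp)
      (fun x hx A' h hx' => by
        have e1 : (Tm.read 9 (.bv 7)).eval (Function.update η 7 x) A' = (v ⟨x, hx⟩).val := by
          rw [Tm.eval_read, Tm.eval_bv, Function.update_self, hx', f₃ 9 (by omega) ha9.symm,
            hv ⟨x, hx⟩]
        have e2 : (Tm.read a (Tm.cellT (.read 12 (.const 1)) 10 7)).eval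
            (Function.update η 7 x) A' = (reduceRow (R t) v j ⟨x, hx⟩).val := by
          rw [Tm.eval_read, hidx 7 A' (by rw [h 2 (by omega), f₃ 2 (by omega) ha2.symm])
            (by rw [h 12 (by omega), f₃ 12 (by omega) ha12.symm]) _ (hη7 x),
            Function.update_self, h a ha9, t₃ t ht j ⟨x, hx⟩]
          simp
        rw [Tm.eval_ite, Tm.eval_xorT e1 e2, e1, Tm.eval_read, Tm.eval_const, h 14 (by omega),
          v₃, v₂, dif_pos hx, reduceVec]
        by_cases h1 : v j = 0
        · simp [h1]
        · simp [zmod_two_eq_one h1, ZMod.val_one])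
    intro k
    rw [g₄ k k.2, dif_pos k.2]

/-- After `i` pivots the remainder vanishes below `i`, while its span together with the rows is
unchanged. After `M` pivots the remainder is zero and the rows alone span. -/
theorem den_insert {a : ℕ} (ha : a ≠ 2 ∧ a ≠ 9 ∧ a ≠ 12 ∧ a ≠ 14) {A : Mem} {n M t : ℕ}
    (hb : HasBounds A n M) (ht : t ≤ 6 * n) (hA : A 12 1 = t) {R : ℕ → Fin M → Fin M → ZMod 2}
    (hR : HoldsTables a A n R) (hE : IsEchelon (R t)) {v : Fin M → ZMod 2} (hv : HoldsVec 9 A v)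
    {η : Env} :
    ∃ R' : Fin M → Fin M → ZMod 2, HoldsTables a ((insert a).den η A) n (Function.update R t R') ∧
      IsEchelon R' ∧ Submodule.span (ZMod 2) (Set.range R') =
        Submodule.span (ZMod 2) (Insert.insert v (Set.range (R t))) := by
  have hw : ∀ a', a' ≠ a → a' ≠ 9 → a' ≠ 14 → (reduceStep a).writes a' = false := by
    intro a' h1 h2 h3
    simp [reduceStep, writes, h1, h2, h3]
  have := den_forr_induction (k := 10) (b := 1) (p := reduceStep a) (η := η) (A := A)
    (fun i A' => A' 2 = A 2 ∧ A' 12 = A 12 ∧ ∃ (R' : Fin M → Fin M → ZMod 2)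
      (v' : Fin M → ZMod 2), HoldsTables a A' n (Function.update R t R') ∧ HoldsVec 9 A' v' ∧
      IsEchelon R' ∧ (∀ k : Fin M, k < i → v' k = 0) ∧
      Submodule.span (ZMod 2) (Insert.insert v' (Set.range R')) =
        Submodule.span (ZMod 2) (Insert.insert v (Set.range (R t))))
    ⟨rfl, rfl, R t, v, by rwa [Function.update_eq_self], hv, hE,
      fun k hk => absurd hk (Nat.not_lt_zero _), rfl⟩ (by
      rintro i hi A' ⟨h2, h12, R', v', hR', hv', hE', hz, hs⟩
      rw [hb.one] at hi
      obtain ⟨k1, k2⟩ := den_reduceStep ha (hb.congr h2) ht (by rw [h12, hA]) hR' hv'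
        (η := Function.update η 10 i) (j := ⟨i, hi⟩) (by simp)
      rw [Function.update_self] at k1 k2
      rw [Function.update_idem] at k1
      refine ⟨?_, ?_, _, _, k1, k2, hE'.reduce fun k hk => hz k hk, fun k hk => ?_, ?_⟩
      · rw [den_of_not_writes _ (hw 2 (by omega) (by omega) (by omega)), h2]
      · rw [den_of_not_writes _ (hw 12 (by omega) (by omega) (by omega)), h12]
      · exact hE'.reduceVec_apply (fun k hk => hz k hk) (Nat.lt_succ_iff.1 hk)
      · rw [hE'.span_reduce, hs])
  obtain ⟨-, -, R', v', hR', -, hE', hz, hs⟩ := this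
  refine ⟨R', hR', hE', ?_⟩
  have : v' = 0 := funext fun k => hz k (by rw [hb.one]; exact k.2)
  rw [← hs, this, Submodule.span_insert_zero]

end Cmd

/-! ### The terms of the algorithm -/

open Classical in
/-- The truth value of a proposition as a number. -/
noncomputable def ind (p : Prop) : ℕ := if p then 1 else 0

theorem ind_pos {p : Prop} (h : p) : ind p = 1 := if_pos h

theorem ind_neg {p : Prop} (h : ¬ p) : ind p = 0 := if_neg h

@[simp] theorem ind_true : ind True = 1 := ind_pos trivial

@[simp] theorem ind_false : ind False = 0 := ind_neg not_false

theorem ind_eq_zero {p : Prop} : ind p = 0 ↔ ¬ p := by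
  by_cases h : p
  · simp [h]
  · simp [h]

theorem ind_eq_val (p : Prop) [Decidable p] :
    ind p = (if p then (1 : ZMod 2) else 0).val := by
  by_cases h : p
  · simp [h, ZMod.val_one]
  · simp [h]

theorem ind_congr {p q : Prop} (h : p ↔ q) : ind p = ind q := by rw [propext h]

theorem adjPairs_eq_sum_ind {n : ℕ} (G : SimpleGraph (Fin n)) (S T : Finset (Fin n)) :
    adjPairs G S T = ∑ u, ∑ v, ind (u ∈ S ∧ v ∈ T ∧ G.Adj u v) := by
  classical
  rw [adjPairs, ← Finset.sum_subset (Finset.subset_univ S)]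
  · refine Finset.sum_congr rfl fun u hu => ?_
    rw [← Finset.sum_subset (Finset.subset_univ T)]
    · refine Finset.sum_congr rfl fun v hv => ?_
      by_cases h : G.Adj u v
      · rw [if_pos h, ind_pos ⟨hu, hv, h⟩]
      · rw [if_neg h, ind_neg fun h' => h h'.2.2]
    · exact fun v _ hv => ind_neg fun h => hv h.2.1
  · exact fun u _ hu => Finset.sum_eq_zero fun v _ => ind_neg fun h => hu h.1

theorem card_eq_sum_ind {n : ℕ} (S : Finset (Fin n)) : S.card = ∑ u, ind (u ∈ S) := by
  classical
  rw [Finset.card_eq_sum_ones, ← Finset.sum_subset (Finset.subset_univ S)]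
  · exact Finset.sum_congr rfl fun u hu => (ind_pos hu).symm
  · exact fun u _ hu => ind_neg hu

/-- The memory holds the instance, the loop bounds, a set `W`, a list `𝒜` of sets, those with
index in `valid` being marked, and the cliques of `G \ W`. -/
structure Holds {n : ℕ} (A : Mem) (G : SimpleGraph (Fin n)) (K W : Finset (Fin n)) (M : ℕ)
    (𝒜 : ℕ → Finset (Fin n)) (valid : ℕ → Prop) : Prop where
  bounds : HasBounds A n M
  adj : ∀ u v : Fin n, A 0 (u * n + v) = ind (G.Adj u v)
  terminal : ∀ u : Fin n, A 1 u = ind (u ∈ K)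
  modulator : ∀ u : Fin n, A 4 u = ind (u ∈ W)
  mark : ∀ j : Fin M, A 5 j = 0 ↔ valid j
  subset : ∀ (u : Fin n) (j : Fin M), A 6 (u * M + j) = ind (u ∈ 𝒜 j)
  clique : ∀ c u : Fin n, A 7 (c * n + u) = ind (u ∈ cliqueAt G W c)

/-- Only arrays below `8` are involved, so the working arrays of the dynamic program may change
freely. -/
theorem Holds.congr {n : ℕ} {A A' : Mem} {G : SimpleGraph (Fin n)} {K W : Finset (Fin n)} {M : ℕ}
    {𝒜 : ℕ → Finset (Fin n)} {valid : ℕ → Prop} (h : Holds A G K W M 𝒜 valid)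
    (h' : ∀ a < 8, A' a = A a) : Holds A' G K W M 𝒜 valid where
  bounds := h.bounds.congr (h' 2 (by omega))
  adj u v := by rw [h' 0 (by omega), h.adj]
  terminal u := by rw [h' 1 (by omega), h.terminal]
  modulator u := by rw [h' 4 (by omega), h.modulator]
  mark j := by rw [h' 5 (by omega), h.mark]
  subset u j := by rw [h' 6 (by omega), h.subset]
  clique c u := by rw [h' 7 (by omega), h.clique]

namespace Tm

/-- Adjacency of `bv i` and `bv j`. -/
def adjT (i j : ℕ) : Tm := .read 0 (.add (mulT 0 (.bv i) (.read 2 (.const 0))) (.bv j))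

/-- Membership of `bv v` in the set with index `bv j`. -/
def memT (v j : ℕ) : Tm := .read 6 (.add (mulT 0 (.bv v) (.read 2 (.const 1))) (.bv j))

/-- Membership of `bv u` in the clique with smallest vertex `bv c`. -/
def cliqueT (c u : ℕ) : Tm := .read 7 (.add (mulT 0 (.bv c) (.read 2 (.const 0))) (.bv u))

/-- The number of adjacent pairs of a vertex `bv 8` with `P` and a vertex `bv 9` with `Q`. -/
def pairsT (P Q : Tm) : Tm := .sum 8 0 (.sum 9 0 (andT P (andT Q (adjT 8 9))))

/-- The minimum of `e` and `6 * n`. -/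
def capT (e : Tm) : Tm :=
  .ite (ltT e (.sub (.read 2 (.const 2)) (.const 1))) e (.sub (.read 2 (.const 2)) (.const 1))

/-- The entry `bv 7` of the vector for the empty choice of cliques. -/
def startT : Tm :=
  andT (andT (notT (.read 5 (.bv 1))) (andT (memT 0 1)
      (allT 8 0 (impT (andT (.read 1 (.bv 8)) (.read 4 (.bv 8))) (memT 8 1)))))
    (andT (notT (.read 5 (.bv 7))) (andT (allT 8 0 (impT (memT 8 7) (memT 8 1)))
      (andT (notT (memT 0 7)) (allT 8 0 (impT (memT 8 1) (allT 9 0 (impT (memT 9 1)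
        (impT (adjT 8 9) (eqT (memT 8 7) (memT 9 7))))))))))

/-- Membership of `bv 8` in the chosen part of the clique `bv 2`. -/
def pickT : Tm := andT (cliqueT 2 8) (.ite (eqT (.bv 8) (.bv 3)) (.const 1) (eqT (.bv 8) (.bv 4)))

/-- The weight of the chosen part of a clique. -/
def weightT : Tm :=
  .add (.add (pairsT (.read 16 (.bv 8)) (memT 9 1)) (pairsT (.read 16 (.bv 8)) (memT 9 1)))
    (.add (pairsT (.read 16 (.bv 8)) (.read 16 (.bv 9)))
      (.sub (.const 4) (.add (.sum 8 0 (.read 16 (.bv 8))) (.sum 8 0 (.read 16 (.bv 8))))))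

/-- The entry `bv 7` of the vector for the chosen part of a clique. -/
def factorT : Tm :=
  andT (allT 8 0 (impT (andT (.read 1 (.bv 8)) (cliqueT 2 8)) (.read 16 (.bv 8))))
    (xorT
      (allT 8 0 (impT (.read 16 (.bv 8)) (allT 9 0 (impT (memT 9 1) (impT (adjT 8 9)
        (notT (memT 9 7)))))))
      (andT (notT (allT 8 0 (notT (.read 16 (.bv 8)))))
        (allT 8 0 (impT (.read 16 (.bv 8)) (allT 9 0 (impT (memT 9 1) (impT (adjT 8 9)
          (memT 9 7))))))))

/-- The weight of a solution. -/
def targetT : Tm :=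
  .sub (.add (.add (.sum 8 0 (memT 8 1)) (.sum 8 0 (memT 8 1)))
    (.add (.add (.read 2 (.const 0)) (.read 2 (.const 0)))
      (.add (.read 2 (.const 0)) (.read 2 (.const 0))))) (.const 2)

variable {η : Env} {A : Mem} {e f : Tm} {p q : Prop}

/-- This and the next rules translate terms into propositions connective by connective, so each test
of the algorithm is verified by following its syntax. -/
theorem eval_notT_ind (he : e.eval η A = ind p) : (notT e).eval η A = ind (¬ p) := by
  by_cases h : p
  · simp [he, ind_pos h, ind_neg (not_not.2 h)]
  · simp [he, ind_neg h, ind_pos h]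

theorem eval_andT_ind (he : e.eval η A = ind p) (hf : f.eval η A = ind q) :
    (andT e f).eval η A = ind (p ∧ q) := by
  by_cases h : p
  · simp [he, hf, h]
  · simp [he, ind_neg h, ind_neg fun h' : p ∧ q => h h'.1]

theorem eval_impT_ind (he : e.eval η A = ind p) (hf : f.eval η A = ind q) :
    (impT e f).eval η A = ind (p → q) := by
  by_cases h : p
  · simp [he, hf, h]
  · simp [he, ind_neg h, ind_pos fun h' : p => absurd h' h]

theorem eval_eqT_ind (he : e.eval η A = ind p) (hf : f.eval η A = ind q) :
    (eqT e f).eval η A = ind (p ↔ q) := by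
  by_cases h : p <;> by_cases h' : q
  · simp [he, hf, ind, h, h']
  · simp [he, hf, ind, h, h']
  · simp [he, hf, ind, h, h']
  · simp [he, hf, ind, h, h']

variable {n M : ℕ}

theorem eval_sum_fin (hb : HasBounds A n M) {k : ℕ} {F : Fin n → ℕ}
    (hf : ∀ u : Fin n, f.eval (Function.update η k u) A = F u) :
    (Tm.sum k 0 f).eval η A = ∑ u, F u := by
  rw [eval_sum, hb.zero, Finset.sum_range]
  exact Finset.sum_congr rfl fun u _ => hf u

theorem eval_allT_ind (hb : HasBounds A n M) {k : ℕ} {P : Fin n → Prop}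
    (hf : ∀ u : Fin n, f.eval (Function.update η k u) A = ind (P u)) :
    (allT k 0 f).eval η A = ind (∀ u, P u) := by
  rw [eval_allT, hb.zero]
  by_cases h : ∀ u, P u
  · rw [ind_pos h, if_pos]
    intro i hi
    rw [hf ⟨i, hi⟩, ind_pos (h _)]
    exact one_ne_zero
  · rw [ind_neg h, if_neg]
    intro h'
    refine h fun u => ?_
    have := h' u u.2
    rw [hf u] at this
    by_contra hu
    exact this (ind_neg hu)

/-- All weights from `6 * n` on share one overflow table. Weights only grow and the target is below
`6 * n`, so the contents of that table never matter. -/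
theorem eval_capT (hb : HasBounds A n M) : (capT e).eval η A = min (e.eval η A) (6 * n) := by
  simp only [capT, eval_ite, eval_ltT, eval_sub, eval_read, eval_const, hb.two,
    Nat.add_sub_cancel]
  by_cases h : e.eval η A < 6 * n
  · simp [h, h.le]
  · simp [h, not_lt.1 h]

variable {G : SimpleGraph (Fin n)} {K W : Finset (Fin n)} {𝒜 : ℕ → Finset (Fin n)}
  {valid : ℕ → Prop}

theorem eval_adjT (hb : HasBounds A n M) (hA : ∀ u v : Fin n, A 0 (u * n + v) = ind (G.Adj u v))
    {i j : ℕ} {u v : Fin n} (hi : η i = u) (hj : η j = v) (hi' : i ≠ 99) :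
    (adjT i j).eval η A = ind (G.Adj u v) := by
  rw [adjT, eval_read, eval_add, eval_mulT (x := u) (y := n), eval_bv, hj, hA]
  · intro x
    simp [Function.update_of_ne hi', hi]
  · intro x
    simp [hb.zero]
  · rw [hb.zero]
    exact u.2.le

theorem eval_memT (h : Holds A G K W M 𝒜 valid) {v j : ℕ} {u : Fin n} {i : Fin M} (hv : η v = u)
    (hj : η j = i) (hv' : v ≠ 99) : (memT v j).eval η A = ind (u ∈ 𝒜 i) := by
  rw [memT, eval_read, eval_add, eval_mulT (x := u) (y := M), eval_bv, hj, h.subset]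
  · intro x
    simp [Function.update_of_ne hv', hv]
  · intro x
    simp [h.bounds.one]
  · rw [h.bounds.zero]
    exact u.2.le

theorem eval_cliqueT (h : Holds A G K W M 𝒜 valid) {i j : ℕ} {c u : Fin n} (hi : η i = c)
    (hj : η j = u) (hi' : i ≠ 99) : (cliqueT i j).eval η A = ind (u ∈ cliqueAt G W c) := by
  rw [cliqueT, eval_read, eval_add, eval_mulT (x := c) (y := n), eval_bv, hj, h.clique]
  · intro x
    simp [Function.update_of_ne hi', hi]
  · intro x
    simp [h.bounds.zero]
  · rw [h.bounds.zero]
    exact c.2.le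

theorem eval_pairsT (h : Holds A G K W M 𝒜 valid) {P Q : Tm} {S T : Finset (Fin n)}
    (hP : ∀ u v : Fin n,
      P.eval (Function.update (Function.update η 8 u) 9 v) A = ind (u ∈ S))
    (hQ : ∀ u v : Fin n,
      Q.eval (Function.update (Function.update η 8 u) 9 v) A = ind (v ∈ T)) :
    (pairsT P Q).eval η A = adjPairs G S T := by
  rw [pairsT, adjPairs_eq_sum_ind]
  exact eval_sum_fin h.bounds fun u => eval_sum_fin h.bounds fun v =>
    eval_andT_ind (hP u v) (eval_andT_ind (hQ u v)
      (eval_adjT h.bounds h.adj (by simp) (by simp) (by omega)))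

/-- The condition for the entry `j` of the vector for the empty choice of cliques to be one. -/
def StartCond (G : SimpleGraph (Fin n)) (K W : Finset (Fin n)) (𝒜 : ℕ → Finset (Fin n))
    (valid : ℕ → Prop) (r : Fin n) (x j : ℕ) : Prop :=
  (valid x ∧ r ∈ 𝒜 x ∧ K ∩ W ⊆ 𝒜 x) ∧ valid j ∧ IsCut G (𝒜 x) r (𝒜 j)

theorem eval_startT (h : Holds A G K W M 𝒜 valid) {r : Fin n} {x j : Fin M} (h0 : η 0 = r)
    (h1 : η 1 = x) (h7 : η 7 = j) :
    startT.eval η A = ind (StartCond G K W 𝒜 valid r x j) := by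
  have hmark : ∀ (k : ℕ) (i : Fin M), η k = i →
      (notT (.read 5 (.bv k))).eval η A = ind (valid i) := by
    intro k i hk
    rw [eval_notT, eval_read, eval_bv, hk]
    by_cases hv : valid i
    · rw [ind_pos hv, if_pos ((h.mark i).2 hv)]
    · rw [ind_neg hv, if_neg fun h' => hv ((h.mark i).1 h')]
  have key : startT.eval η A = ind ((valid x ∧ r ∈ 𝒜 x ∧ ∀ u, u ∈ K ∧ u ∈ W → u ∈ 𝒜 x) ∧
      valid j ∧ (∀ u, u ∈ 𝒜 j → u ∈ 𝒜 x) ∧ (¬ r ∈ 𝒜 j) ∧ ∀ u, u ∈ 𝒜 x → ∀ v, v ∈ 𝒜 x →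
        G.Adj u v → (u ∈ 𝒜 j ↔ v ∈ 𝒜 j)) := by
    refine eval_andT_ind (eval_andT_ind (hmark 1 x h1) (eval_andT_ind
      (eval_memT h h0 h1 (by omega)) (eval_allT_ind h.bounds fun u => eval_impT_ind
        (eval_andT_ind ?_ ?_) (eval_memT h (by simp) (by simp [h1]) (by omega)))))
      (eval_andT_ind (hmark 7 j h7) (eval_andT_ind (eval_allT_ind h.bounds fun u =>
        eval_impT_ind (eval_memT h (by simp) (by simp [h7]) (by omega))
          (eval_memT h (by simp) (by simp [h1]) (by omega)))
        (eval_andT_ind (eval_notT_ind (eval_memT h h0 h7 (by omega)))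
          (eval_allT_ind h.bounds fun u => eval_impT_ind
            (eval_memT h (by simp) (by simp [h1]) (by omega))
            (eval_allT_ind h.bounds fun v => eval_impT_ind
              (eval_memT h (by simp) (by simp [h1]) (by omega))
              (eval_impT_ind (eval_adjT h.bounds h.adj (by simp) (by simp) (by omega))
                (eval_eqT_ind (eval_memT h (by simp) (by simp [h7]) (by omega))
                  (eval_memT h (by simp) (by simp [h7]) (by omega)))))))))
    · simp [h.terminal]
    · simp [h.modulator]
  rw [key]
  refine ind_congr (and_congr (and_congr Iff.rfl (and_congr Iff.rfl ?_))
    (and_congr Iff.rfl (and_congr Iff.rfl (and_congr Iff.rfl ?_))))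
  · simp [Finset.subset_iff]
  · rfl

theorem eval_pickT (h : Holds A G K W M 𝒜 valid) {c u v w : Fin n} (h2 : η 2 = c) (h3 : η 3 = v)
    (h4 : η 4 = w) (h8 : η 8 = u) :
    pickT.eval η A = ind (u ∈ pick (cliqueAt G W c) (v, w)) := by
  have key : pickT.eval η A = ind (u ∈ cliqueAt G W c ∧ (u = v ∨ u = w)) := by
    refine eval_andT_ind (eval_cliqueT h h2 h8 (by omega)) ?_
    simp only [eval_ite, eval_eqT, eval_bv, eval_const, h3, h4, h8, Fin.val_inj]
    by_cases huv : u = v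
    · simp [huv, ind_pos]
    · by_cases huw : u = w <;> simp [huv, huw, ind]
  rw [key]
  refine ind_congr ?_
  simp [pick]

theorem eval_weightT (h : Holds A G K W M 𝒜 valid) {Z : Finset (Fin n)}
    (hZ : ∀ u : Fin n, A 16 u = ind (u ∈ Z)) {x : Fin M} (h1 : η 1 = x) :
    weightT.eval η A = cliqueWeight G (𝒜 x) Z := by
  have e1 : (pairsT (.read 16 (.bv 8)) (memT 9 1)).eval η A = adjPairs G Z (𝒜 x) :=
    eval_pairsT h (fun u v => by simp [hZ])
      (fun u v => eval_memT h (by simp) (by simp [h1]) (by omega))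
  have e2 : (pairsT (.read 16 (.bv 8)) (.read 16 (.bv 9))).eval η A = adjPairs G Z Z :=
    eval_pairsT h (fun u v => by simp [hZ]) (fun u v => by simp [hZ])
  have e3 : (Tm.sum 8 0 (.read 16 (.bv 8))).eval η A = Z.card := by
    rw [card_eq_sum_ind]
    exact eval_sum_fin h.bounds fun u => by simp [hZ]
  simp only [weightT, eval_add, eval_sub, eval_const, e1, e2, e3, cliqueWeight]
  omega

open Classical in
/-- The vector for the part `Z` of the clique `C`. -/
noncomputable def factorVec (G : SimpleGraph (Fin n)) (K C X : Finset (Fin n))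
    (𝒜 : ℕ → Finset (Fin n)) (Z : Finset (Fin n)) {M : ℕ} (j : Fin M) : ZMod 2 :=
  if K ∩ C ⊆ Z then cutFactor G X Z (𝒜 j) else 0

/-- A choice that misses a terminal of its clique gets the zero vector and thereby drops out;
terminals need no further bookkeeping. -/
theorem eval_factorT (h : Holds A G K W M 𝒜 valid) {Z : Finset (Fin n)}
    (hZ : ∀ u : Fin n, A 16 u = ind (u ∈ Z)) {c : Fin n} {x j : Fin M} (h1 : η 1 = x)
    (h2 : η 2 = c) (h7 : η 7 = j) :
    factorT.eval η A = (factorVec G K (cliqueAt G W c) (𝒜 x) 𝒜 Z j).val := by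
  classical
  have e1 : (allT 8 0 (impT (andT (.read 1 (.bv 8)) (cliqueT 2 8)) (.read 16 (.bv 8)))).eval η A =
      ind (∀ u, u ∈ K ∧ u ∈ cliqueAt G W c → u ∈ Z) :=
    eval_allT_ind h.bounds fun u => eval_impT_ind (eval_andT_ind (by simp [h.terminal])
      (eval_cliqueT h (by simp [h2]) (by simp) (by omega))) (by simp [hZ])
  have e2 : (allT 8 0 (impT (.read 16 (.bv 8)) (allT 9 0 (impT (memT 9 1) (impT (adjT 8 9)
      (notT (memT 9 7))))))).eval η A =
      ind (∀ u, u ∈ Z → ∀ y, y ∈ 𝒜 x → G.Adj u y → ¬ y ∈ 𝒜 j) :=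
    eval_allT_ind h.bounds fun u => eval_impT_ind (by simp [hZ])
      (eval_allT_ind h.bounds fun v => eval_impT_ind
        (eval_memT h (by simp) (by simp [h1]) (by omega)) (eval_impT_ind
          (eval_adjT h.bounds h.adj (by simp) (by simp) (by omega))
          (eval_notT_ind (eval_memT h (by simp) (by simp [h7]) (by omega)))))
  have e3 : (andT (notT (allT 8 0 (notT (.read 16 (.bv 8)))))
      (allT 8 0 (impT (.read 16 (.bv 8)) (allT 9 0 (impT (memT 9 1) (impT (adjT 8 9)
        (memT 9 7))))))).eval η A =
      ind ((¬ ∀ u, ¬ u ∈ Z) ∧ ∀ u, u ∈ Z → ∀ y, y ∈ 𝒜 x → G.Adj u y → y ∈ 𝒜 j) :=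
    eval_andT_ind (eval_notT_ind (eval_allT_ind h.bounds fun u => eval_notT_ind (by simp [hZ])))
      (eval_allT_ind h.bounds fun u => eval_impT_ind (by simp [hZ])
        (eval_allT_ind h.bounds fun v => eval_impT_ind
          (eval_memT h (by simp) (by simp [h1]) (by omega)) (eval_impT_ind
            (eval_adjT h.bounds h.adj (by simp) (by simp) (by omega))
            (eval_memT h (by simp) (by simp [h7]) (by omega)))))
  have h4 : (¬ ∀ u, ¬ u ∈ Z) ↔ Z.Nonempty := by
    rw [not_forall_not]
    rfl
  have h5 : (∀ u, u ∈ K ∧ u ∈ cliqueAt G W c → u ∈ Z) ↔ K ∩ cliqueAt G W c ⊆ Z := by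
    simp [Finset.subset_iff]
  rw [ind_eq_val] at e2 e3
  rw [factorT, eval_andT, eval_xorT e2 e3, e1, ind_congr h5, factorVec]
  by_cases h6 : K ∩ cliqueAt G W c ⊆ Z
  · rw [ind_pos h6, if_neg one_ne_zero, if_pos h6, cutFactor]
    simp only [h4]
    congr
  · rw [ind_neg h6, if_pos rfl, if_neg h6]
    rfl

theorem eval_targetT (h : Holds A G K W M 𝒜 valid) {x : Fin M} (h1 : η 1 = x) :
    targetT.eval η A = 2 * (𝒜 x).card + 4 * n - 2 := by
  have e : (Tm.sum 8 0 (memT 8 1)).eval η A = (𝒜 x).card := by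
    rw [card_eq_sum_ind]
    exact eval_sum_fin h.bounds fun u => eval_memT h (by simp) (by simp [h1]) (by omega)
  simp only [targetT, eval_add, eval_sub, eval_const, eval_read, e, h.bounds.zero]
  omega

end Tm

/-! ### The dynamic program -/

section Reach

variable {n M : ℕ}

/-- The products of the start vector with a choice of factors of the first `i` indices that have
total weight `t`. -/
def reach (s : Fin M → ZMod 2) (E : ℕ) (m : Fin n → Fin n × Fin n → Fin M → ZMod 2)
    (wt : Fin n → Fin n × Fin n → ℕ) (i t : ℕ) : Set (Fin M → ZMod 2) :=
  {y | ∃ o : Fin n → Fin n × Fin n,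
    t = E + ∑ c ∈ Finset.univ.filter (fun c : Fin n => c.val < i), wt c (o c) ∧
    y = (∏ c ∈ Finset.univ.filter (fun c : Fin n => c.val < i), m c (o c)) * s}

variable {s : Fin M → ZMod 2} {E : ℕ} {m : Fin n → Fin n × Fin n → Fin M → ZMod 2}
  {wt : Fin n → Fin n × Fin n → ℕ}

theorem filter_val_lt_succ {i : ℕ} (hi : i < n) :
    Finset.univ.filter (fun c : Fin n => c.val < i + 1) =
      insert ⟨i, hi⟩ (Finset.univ.filter fun c : Fin n => c.val < i) := by
  ext c
  simp only [Finset.mem_filter, Finset.mem_univ, true_and, Finset.mem_insert, Fin.ext_iff]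
  omega

theorem mem_reach_succ {i t : ℕ} (hi : i < n) {y : Fin M → ZMod 2} :
    y ∈ reach s E m wt (i + 1) t ↔ ∃ o t' y', y' ∈ reach s E m wt i t' ∧
      t = t' + wt ⟨i, hi⟩ o ∧ y = m ⟨i, hi⟩ o * y' := by
  have hn : (⟨i, hi⟩ : Fin n) ∉ Finset.univ.filter fun c : Fin n => c.val < i := by simp
  constructor
  · rintro ⟨o, rfl, rfl⟩
    refine ⟨o ⟨i, hi⟩, _, _, ⟨o, rfl, rfl⟩, ?_, ?_⟩
    · rw [filter_val_lt_succ hi, Finset.sum_insert hn]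
      ring
    · rw [filter_val_lt_succ hi, Finset.prod_insert hn, mul_assoc]
  · rintro ⟨p, _, _, ⟨o, rfl, rfl⟩, rfl, rfl⟩
    have ho : ∀ c ∈ Finset.univ.filter (fun c : Fin n => c.val < i),
        Function.update o ⟨i, hi⟩ p c = o c := by
      intro c hc
      refine Function.update_of_ne ?_ _ _
      rintro rfl
      exact hn hc
    refine ⟨Function.update o ⟨i, hi⟩ p, ?_, ?_⟩
    · rw [filter_val_lt_succ hi, Finset.sum_insert hn, Function.update_self,
        Finset.sum_congr rfl fun c hc => congrArg (wt c) (ho c hc)]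
      ring
    · rw [filter_val_lt_succ hi, Finset.prod_insert hn, Function.update_self,
        Finset.prod_congr rfl fun c hc => congrArg (m c) (ho c hc), mul_assoc]

/-- Multiplication by the vector of an option is linear, so the span of the new products depends
only on the spans of the old ones. Restricting to `t < T` is consistent because `t' ≤ t`: an
overflow table never feeds a table below `T`. -/
theorem span_reach_succ {i T T' : ℕ} (hi : i < n) (hT : T ≤ T')
    {R : ℕ → Fin M → Fin M → ZMod 2}
    (hR : ∀ t < T, Submodule.span (ZMod 2) (Set.range (R t)) =
      Submodule.span (ZMod 2) (reach s E m wt i t)) :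
    ∀ t < T, Submodule.span (ZMod 2) {y | ∃ o, ∃ t' : Fin T', ∃ j,
        t = t' + wt ⟨i, hi⟩ o ∧ y = m ⟨i, hi⟩ o * R t' j} =
      Submodule.span (ZMod 2) (reach s E m wt (i + 1) t) := by
  intro t ht
  have key : ∀ (o : Fin n × Fin n) {A B : Set (Fin M → ZMod 2)},
      Submodule.span (ZMod 2) A = Submodule.span (ZMod 2) B → ∀ y ∈ A,
      m ⟨i, hi⟩ o * y ∈ Submodule.span (ZMod 2) ((fun v => m ⟨i, hi⟩ o * v) '' B) := by
    intro o A B hAB y hy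
    rw [span_mul_image, ← hAB]
    exact Submodule.mem_map_of_mem (Submodule.subset_span hy)
  refine le_antisymm (Submodule.span_le.2 ?_) (Submodule.span_le.2 ?_)
  · rintro _ ⟨o, t', j, htt, rfl⟩
    refine Submodule.span_mono ?_ (key o (hR t' (by omega)) _ ⟨j, rfl⟩)
    rintro _ ⟨y, hy, rfl⟩
    exact (mem_reach_succ hi).2 ⟨o, t', y, hy, htt, rfl⟩
  · intro y hy
    obtain ⟨o, t', y', hy', htt, rfl⟩ := (mem_reach_succ hi).1 hy
    refine Submodule.span_mono ?_ (key o (hR t' (by omega)).symm _ hy')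
    rintro _ ⟨_, ⟨j, rfl⟩, rfl⟩
    exact ⟨o, ⟨t', by omega⟩, j, htt, rfl⟩

end Reach

/-! ### The transition of the dynamic program for one clique -/

namespace Cmd

/-- Fill all tables of the array `a`. -/
def fillCells (a : ℕ) (e : Tm) : Cmd :=
  .forr 5 2 (.forr 6 1 (.forr 7 1 (.store a (Tm.cellT (.bv 5) 6 7) e)))

/-- The new content is a function `F` of the address alone, so no disjointness of the writes is
needed. -/
theorem den_fillCells {a : ℕ} (ha : a ≠ 2) {e : Tm} {η : Env} {A : Mem} {n M : ℕ}
    (hb : HasBounds A n M) (F : ℕ → ℕ)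
    (he : ∀ (η' : Env) (A' : Mem), (∀ a' ≠ a, A' a' = A a') → η' 5 ≤ 6 * n → η' 6 < M →
      η' 7 < M → e.eval η' A' = F (cellIndex M (η' 5) (η' 6) (η' 7)))
    {t j k : ℕ} (ht : t ≤ 6 * n) (hj : j < M) (hk : k < M) :
    (fillCells a e).den η A a (cellIndex M t j k) = F (cellIndex M t j k) := by
  refine (den_forr_write (P := fun t m => ∃ j < M, ∃ k < M, m = cellIndex M t j k) (F := F)
    hb.two (fun a' h => by simpa [writes] using h) ?_ _).1
    ⟨t, by omega, j, hj, k, hk, rfl⟩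
  intro t ht A₁ h₁ m
  refine den_forr_write (P := fun j m => ∃ k < M, m = cellIndex M t j k) (F := F)
    (hb.congr (h₁ 2 ha.symm)).one (fun a' h => by simpa [writes] using h) ?_ _
  intro j hj A₂ h₂ m
  refine den_forr_write (P := fun k m => m = cellIndex M t j k) (F := F)
    (hb.congr ((h₂ 2 ha.symm).trans (h₁ 2 ha.symm))).one
    (fun a' h => by simpa [writes] using h) ?_ _
  intro k hk A₃ h₃ m
  have h3 : ∀ a' ≠ a, A₃ a' = A a' := fun a' h => by rw [h₃ a' h, h₂ a' h, h₁ a' h]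
  rw [den_store, Tm.eval_cellT (t := t) (hb.congr (h3 2 ha.symm)) (by simp) (by omega)
    (by simpa using hj.le) (by omega), he _ _ h3 (by simp; omega) (by simpa using hj)
    (by simpa using hk)]
  simp only [ne_eq, Nat.reduceEqDiff, not_false_eq_true, Function.update_of_ne,
    Function.update_self]
  constructor
  · rintro rfl
    rw [if_pos rfl]
  · intro h
    rw [if_neg h]

/-- Insert the product of the vector in the array `13` with a row of the array `10`. -/
def rowStep : Cmd :=
  .seq (.forr 7 1 (.store 9 (.bv 7)
    (.ite (.read 13 (.bv 7)) (.read 10 (Tm.cellT (.bv 5) 6 7)) (.const 0))))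
  (.seq (.store 12 (.const 1) (Tm.capT (.add (.bv 5) (.read 17 (.const 0))))) (insert 11))

/-- Process all rows for one choice in a clique. -/
def choiceStep : Cmd :=
  .seq (.forr 8 0 (.store 16 (.bv 8) Tm.pickT))
  (.seq (.store 17 (.const 0) Tm.weightT)
  (.seq (.forr 7 1 (.store 13 (.bv 7) Tm.factorT))
  (.forr 5 2 (.forr 6 1 rowStep))))

/-- Process one clique. -/
def cliqueStep : Cmd :=
  .seq (fillCells 11 (.const 0)) (.seq (.forr 3 0 (.forr 4 0 choiceStep))
    (fillCells 10 (.read 11 (Tm.cellT (.bv 5) 6 7))))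

/-- The array `a` holds echelon bases of the spans of the sets `I t` for `t < 6 * n`. -/
def HoldsSpans (a : ℕ) (A : Mem) (n : ℕ) {M : ℕ} (I : ℕ → Set (Fin M → ZMod 2)) : Prop :=
  ∃ R : ℕ → Fin M → Fin M → ZMod 2, HoldsTables a A n R ∧ (∀ t ≤ 6 * n, IsEchelon (R t)) ∧
    ∀ t < 6 * n, Submodule.span (ZMod 2) (Set.range (R t)) = Submodule.span (ZMod 2) (I t)

theorem HoldsSpans.congr_set {a : ℕ} {A : Mem} {n M : ℕ} {I I' : ℕ → Set (Fin M → ZMod 2)}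
    (h : HoldsSpans a A n I) (h' : ∀ t, I t = I' t) : HoldsSpans a A n I' := by
  rwa [← funext h']

theorem HoldsSpans.congr_mem {a : ℕ} {A A' : Mem} {n M : ℕ} {I : ℕ → Set (Fin M → ZMod 2)}
    (h : HoldsSpans a A n I) (h' : A' a = A a) : HoldsSpans a A' n I := by
  obtain ⟨R, h1, h2, h3⟩ := h
  exact ⟨R, fun t ht j k => by rw [h', h1 t ht j k], h2, h3⟩

/-- For `t₀ ≥ 6 * n` the vector lands in the overflow table, about which no span is claimed; that
table stays echelon, so later insertions into it are still covered. -/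
theorem HoldsSpans.insert {a : ℕ} (ha : a ≠ 2 ∧ a ≠ 9 ∧ a ≠ 12 ∧ a ≠ 14) {A : Mem} {n M t₀ : ℕ}
    (hb : HasBounds A n M) (hA : A 12 1 = min t₀ (6 * n)) {I : ℕ → Set (Fin M → ZMod 2)}
    (hI : HoldsSpans a A n I) {v : Fin M → ZMod 2} (hv : HoldsVec 9 A v) {η : Env} :
    HoldsSpans a ((insert a).den η A) n (fun t => I t ∪ {y | t = t₀ ∧ y = v}) := by
  obtain ⟨R, h1, h2, h3⟩ := hI
  obtain ⟨R', k1, k2, k3⟩ := den_insert ha hb (min_le_right _ _) hA h1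
    (h2 _ (min_le_right _ _)) hv (η := η)
  refine ⟨_, k1, fun t ht => ?_, fun t ht => ?_⟩
  · by_cases h : t = min t₀ (6 * n)
    · subst h
      rwa [Function.update_self]
    · rw [Function.update_of_ne h]
      exact h2 t ht
  · by_cases h : t = t₀
    · subst h
      rw [min_eq_left ht.le, Function.update_self]
      rw [min_eq_left ht.le] at k3
      rw [k3, Submodule.span_insert, h3 t ht, ← Submodule.span_union, Set.union_comm]
      simp
    · rw [Function.update_of_ne (by omega), h3 t ht]
      simp [h]

/-- Loop rule for accumulation: each round adds its own generators `J i`, and `P` lists arrays that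
the body leaves alone. -/
theorem HoldsSpans.forr {a k b : ℕ} {q : Cmd} {η : Env} {A : Mem} {n M N : ℕ}
    {I : ℕ → Set (Fin M → ZMod 2)} (P : ℕ → Prop) (hP : ∀ a, P a → q.writes a = false)
    (hN : A 2 b = N) (J : Fin N → ℕ → Set (Fin M → ZMod 2))
    (hq : ∀ (i : Fin N) (A' : Mem) (I' : ℕ → Set (Fin M → ZMod 2)),
      (∀ a, P a → A' a = A a) → HoldsSpans a A' n I' →
      HoldsSpans a (q.den (Function.update η k i) A') n (fun t => I' t ∪ J i t))
    (hI : HoldsSpans a A n I) :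
    HoldsSpans a ((Cmd.forr k b q).den η A) n (fun t => I t ∪ {y | ∃ i, y ∈ J i t}) := by
  subst hN
  have := den_forr_induction (k := k) (b := b) (p := q) (η := η) (A := A)
    (fun i A' => (∀ a, P a → A' a = A a) ∧
      HoldsSpans a A' n (fun t => I t ∪ {y | ∃ i' : Fin (A 2 b), i'.val < i ∧ y ∈ J i' t}))
    ⟨fun _ _ => rfl, hI.congr_set fun t => by simp⟩ (by
      rintro i hi A' ⟨h1, h2⟩
      refine ⟨fun a' ha' => by rw [q.den_of_not_writes (hP a' ha'), h1 a' ha'],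
        (hq ⟨i, hi⟩ A' _ h1 h2).congr_set fun t => ?_⟩
      rw [Set.union_assoc]
      congr 1
      ext y
      simp only [Set.mem_union, Set.mem_ofPred_eq]
      constructor
      · rintro (⟨i', hi', hy⟩ | hy)
        · exact ⟨i', hi'.trans (Nat.lt_succ_self i), hy⟩
        · exact ⟨⟨i, hi⟩, Nat.lt_succ_self i, hy⟩
      · rintro ⟨i', hi', hy⟩
        rcases Nat.lt_succ_iff_lt_or_eq.1 hi' with h | h
        · exact .inl ⟨i', h, hy⟩
        · obtain rfl : i' = ⟨i, hi⟩ := Fin.ext h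
          exact .inr hy)
  refine this.2.congr_set fun t => ?_
  congr 1
  ext y
  simp

theorem holdsSpans_rowStep {A : Mem} {n M t w : ℕ} {η : Env} (hb : HasBounds A n M)
    {R : ℕ → Fin M → Fin M → ZMod 2} (hR : HoldsTables 10 A n R) {m : Fin M → ZMod 2}
    (hm : HoldsVec 13 A m) (hw : A 17 0 = w) {j : Fin M} (h5 : η 5 = t) (ht : t ≤ 6 * n)
    (h6 : η 6 = j) {I : ℕ → Set (Fin M → ZMod 2)} (hI : HoldsSpans 11 A n I) :
    HoldsSpans 11 (rowStep.den η A) n (fun t' => I t' ∪ {y | t' = t + w ∧ y = m * R t j}) := by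
  rw [rowStep, den_seq, den_seq]
  set A₁ := (Cmd.forr 7 1 (.store 9 (.bv 7)
    (.ite (.read 13 (.bv 7)) (.read 10 (Tm.cellT (.bv 5) 6 7)) (.const 0)))).den η A with hA₁
  have f₁ : ∀ a ≠ 9, A₁ a = A a := fun a h => den_of_not_writes _ (by simpa [writes] using h) _ _
  have v₁ : HoldsVec 9 A₁ (m * R t j) := by
    obtain ⟨g, -⟩ := den_store_loop (a := 9) (k := 7) (b := 1) (i := .bv 7)
      (e := .ite (.read 13 (.bv 7)) (.read 10 (Tm.cellT (.bv 5) 6 7)) (.const 0)) (η := η)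
      (A := A) hb.one (fun k => k)
      (fun k => if hk : k < M then ((m * R t j) ⟨k, hk⟩).val else 0)
      (fun x hx y hy h => h) (fun x hx A' h => by simp)
      (fun x hx A' h hx' => by
        rw [Tm.eval_ite, Tm.eval_read, Tm.eval_read, Tm.eval_bv, Function.update_self,
          Tm.eval_cellT (hb.congr (h 2 (by omega))) (t := t) (by simp [h5]) (by omega)
            (by simp [h6]) (by omega), h 13 (by omega), h 10 (by omega),
          hm ⟨x, hx⟩, dif_pos hx]
        have := hR t ht j ⟨x, hx⟩
        simp only at this
        simp only [ne_eq, Nat.reduceEqDiff, not_false_eq_true, Function.update_of_ne,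
          Function.update_self, h6, this, Tm.eval_const, Pi.mul_apply]
        by_cases h0 : m ⟨x, hx⟩ = 0
        · simp [h0]
        · simp [zmod_two_eq_one h0, ZMod.val_one])
    intro k
    rw [hA₁, g k k.2, dif_pos k.2]
  set A₂ := (Cmd.store 12 (.const 1) (Tm.capT (.add (.bv 5) (.read 17 (.const 0))))).den η A₁
    with hA₂
  have f₂ : ∀ a, a ≠ 9 → a ≠ 12 → A₂ a = A a := fun a h h' => by
    rw [hA₂, den_store_of_ne h', f₁ a h]
  refine HoldsSpans.insert (by omega) (hb.congr (f₂ 2 (by omega) (by omega))) ?_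
    (hI.congr_mem (f₂ 11 (by omega) (by omega))) ?_
  · rw [hA₂, den_store, Tm.eval_const, if_pos rfl, Tm.eval_capT (hb.congr (f₁ 2 (by omega)))]
    simp [h5, f₁ 17, hw]
  · intro k
    rw [hA₂, den_store_of_ne (by omega)]
    exact v₁ k

variable {n M : ℕ} {G : SimpleGraph (Fin n)} {K W : Finset (Fin n)} {𝒜 : ℕ → Finset (Fin n)}
  {valid : ℕ → Prop}

theorem holdsSpans_choiceStep {A : Mem} {η : Env} (h : Holds A G K W M 𝒜 valid)
    {R : ℕ → Fin M → Fin M → ZMod 2} (hR : HoldsTables 10 A n R) {x : Fin M} {c v w : Fin n}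
    (h1 : η 1 = x) (h2 : η 2 = c) (h3 : η 3 = v) (h4 : η 4 = w)
    {I : ℕ → Set (Fin M → ZMod 2)} (hI : HoldsSpans 11 A n I) :
    HoldsSpans 11 (choiceStep.den η A) n (fun t => I t ∪ {y | ∃ t' : Fin (6 * n + 1), ∃ j,
      t = t' + cliqueWeight G (𝒜 x) (pick (cliqueAt G W c) (v, w)) ∧
      y = Tm.factorVec G K (cliqueAt G W c) (𝒜 x) 𝒜 (pick (cliqueAt G W c) (v, w)) *
        R t' j}) := by
  rw [choiceStep, den_seq, den_seq, den_seq]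
  set Z := pick (cliqueAt G W c) (v, w)
  set A₁ := (Cmd.forr 8 0 (.store 16 (.bv 8) Tm.pickT)).den η A with hA₁
  have f₁ : ∀ a ≠ 16, A₁ a = A a := fun a h => den_of_not_writes _ (by simpa [writes] using h) _ _
  have z₁ : ∀ u : Fin n, A₁ 16 u = ind (u ∈ Z) := by
    obtain ⟨g, -⟩ := den_store_loop (a := 16) (k := 8) (b := 0) (i := .bv 8)
      (e := Tm.pickT) (η := η) (A := A) h.bounds.zero (fun k => k)
      (fun k => if hk : k < n then ind (⟨k, hk⟩ ∈ Z) else 0)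
      (fun x hx y hy h => h) (fun x hx A' h => by simp)
      (fun u hu A' h' _ => by
        rw [Tm.eval_pickT (h.congr fun a ha => h' a (by omega)) (c := c) (u := ⟨u, hu⟩) (v := v)
          (w := w) (by simp [h2]) (by simp [h3]) (by simp [h4]) (by simp), dif_pos hu])
    intro u
    rw [hA₁, g u u.2, dif_pos u.2]
  set A₂ := (Cmd.store 17 (.const 0) Tm.weightT).den η A₁ with hA₂
  have f₂ : ∀ a, a ≠ 16 → a ≠ 17 → A₂ a = A a := fun a h h' => by
    rw [hA₂, den_store_of_ne h', f₁ a h]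
  have z₂ : ∀ u : Fin n, A₂ 16 u = ind (u ∈ Z) := fun u => by
    rw [hA₂, den_store_of_ne (by omega), z₁]
  have w₂ : A₂ 17 0 = cliqueWeight G (𝒜 x) Z := by
    rw [hA₂, den_store, Tm.eval_const, if_pos rfl,
      Tm.eval_weightT (h.congr fun a ha => f₁ a (by omega)) z₁ h1]
  set A₃ := (Cmd.forr 7 1 (.store 13 (.bv 7) Tm.factorT)).den η A₂ with hA₃
  have g₃ : ∀ a ≠ 13, A₃ a = A₂ a := fun a h => den_of_not_writes _ (by simpa [writes] using h) _ _
  have f₃ : ∀ a, a ≠ 13 → a ≠ 16 → a ≠ 17 → A₃ a = A a := fun a h h' h'' => by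
    rw [g₃ a h, f₂ a h' h'']
  have v₃ : HoldsVec (M := M) 13 A₃ (Tm.factorVec G K (cliqueAt G W c) (𝒜 x) 𝒜 Z) := by
    obtain ⟨g, -⟩ := den_store_loop (a := 13) (k := 7) (b := 1) (i := .bv 7)
      (e := Tm.factorT) (η := η) (A := A₂) (by rw [f₂ 2 (by omega) (by omega), h.bounds.one])
      (fun k => k)
      (fun k => if hk : k < M then
        (Tm.factorVec G K (cliqueAt G W c) (𝒜 x) 𝒜 Z (⟨k, hk⟩ : Fin M)).val else 0)
      (fun x hx y hy h => h) (fun x hx A' h => by simp)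
      (fun k hk A' h' _ => by
        rw [Tm.eval_factorT (h.congr fun a ha => by
            rw [h' a (by omega), f₂ a (by omega) (by omega)]) (Z := Z) (c := c) (x := x)
          (j := ⟨k, hk⟩) (fun u => by rw [h' 16 (by omega), z₂]) (by simp [h1]) (by simp [h2])
          (by simp), dif_pos hk])
    intro k
    rw [hA₃, g k k.2, dif_pos k.2]
  have hb₃ : HasBounds A₃ n M := h.bounds.congr (f₃ 2 (by omega) (by omega) (by omega))
  refine HoldsSpans.forr (fun a => a < 9 ∨ a = 10 ∨ a = 13 ∨ a = 17)
    (fun a ha => by simp [writes, rowStep, insert, reduceStep]; omega) hb₃.two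
    (fun t' t => {y | ∃ j, t = t' + cliqueWeight G (𝒜 x) Z ∧
      y = Tm.factorVec G K (cliqueAt G W c) (𝒜 x) 𝒜 Z * R t' j}) ?_
    (hI.congr_mem (f₃ 11 (by omega) (by omega) (by omega)))
  intro t' A' I' hA' hI'
  refine HoldsSpans.forr (fun a => a < 9 ∨ a = 10 ∨ a = 13 ∨ a = 17)
    (fun a ha => by simp [writes, rowStep, insert, reduceStep]; omega)
    (hb₃.congr (hA' 2 (by omega))).one
    (fun j t => {y | t = t' + cliqueWeight G (𝒜 x) Z ∧
      y = Tm.factorVec G K (cliqueAt G W c) (𝒜 x) 𝒜 Z * R t' j}) ?_ hI'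
  intro j A'' I'' hA'' hI''
  have f : ∀ a, a < 9 ∨ a = 10 ∨ a = 13 ∨ a = 17 → A'' a = A₃ a := fun a ha => by
    rw [hA'' a ha, hA' a ha]
  refine holdsSpans_rowStep (hb₃.congr (f 2 (by omega))) ?_ ?_ ?_ (by simp) (by omega) (by simp)
    hI''
  · intro t ht j k
    rw [f 10 (by omega), f₃ 10 (by omega) (by omega) (by omega), hR t ht j k]
  · intro k
    rw [f 13 (by omega), v₃ k]
  · rw [f 17 (by omega), g₃ 17 (by omega), w₂]

/-- The old tables in the array `10` stay fixed while all options are inserted into the array `11`,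
so exactly one option of this clique enters each product; the result is copied back at the end. -/
theorem holdsSpans_cliqueStep {A : Mem} {η : Env} (h : Holds A G K W M 𝒜 valid)
    {R : ℕ → Fin M → Fin M → ZMod 2} (hR : HoldsTables 10 A n R) {x : Fin M} {c : Fin n}
    (h1 : η 1 = x) (h2 : η 2 = c) :
    HoldsSpans 10 (cliqueStep.den η A) n (fun t => {y | ∃ o, ∃ t' : Fin (6 * n + 1), ∃ j,
      t = t' + cliqueWeight G (𝒜 x) (pick (cliqueAt G W c) o) ∧
      y = Tm.factorVec G K (cliqueAt G W c) (𝒜 x) 𝒜 (pick (cliqueAt G W c) o) * R t' j}) := by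
  rw [cliqueStep, den_seq, den_seq]
  set A₁ := (fillCells 11 (.const 0)).den η A with hA₁
  have f₁ : ∀ a ≠ 11, A₁ a = A a := fun a h => den_of_not_writes _ (by
    simpa [fillCells, writes] using h) _ _
  have z₁ : HoldsSpans (M := M) 11 A₁ n (fun _ => ∅) := by
    refine ⟨fun _ _ _ => 0, fun t ht j k => ?_, fun _ _ j => ?_, fun t ht => ?_⟩
    · rw [hA₁, den_fillCells (by omega) h.bounds (fun _ => 0) (fun _ _ _ _ _ _ => by simp) ht
        j.2 k.2]
      rfl
    · exact ⟨fun _ _ => rfl, fun _ => rfl⟩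
    · rw [Submodule.span_empty, Submodule.span_eq_bot]
      rintro _ ⟨j, rfl⟩
      rfl
  set A₂ := (Cmd.forr 3 0 (.forr 4 0 choiceStep)).den η A₁ with hA₂
  have f₂ : ∀ a, a < 9 → A₂ a = A a := fun a ha => by
    rw [hA₂, den_of_not_writes _ (by
      simp [writes, choiceStep, rowStep, insert, reduceStep]; omega), f₁ a (by omega)]
  have z₂ : HoldsSpans 11 A₂ n (fun t => ∅ ∪ {y | ∃ v : Fin n, y ∈
      ({y | ∃ w : Fin n, y ∈ ({y | ∃ t' : Fin (6 * n + 1), ∃ j,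
      t = t' + cliqueWeight G (𝒜 x) (pick (cliqueAt G W c) (v, w)) ∧
      y = Tm.factorVec G K (cliqueAt G W c) (𝒜 x) 𝒜 (pick (cliqueAt G W c) (v, w)) *
        R t' j} : Set (Fin M → ZMod 2))} : Set (Fin M → ZMod 2))}) := by
    refine HoldsSpans.forr (fun a => a < 9 ∨ a = 10) (fun a ha => by
      simp [writes, choiceStep, rowStep, insert, reduceStep]; omega)
      (by rw [f₁ 2 (by omega), h.bounds.zero]) _ ?_ z₁
    intro v A' I' hA' hI'
    refine HoldsSpans.forr (fun a => a < 9 ∨ a = 10) (fun a ha => by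
      simp [writes, choiceStep, rowStep, insert, reduceStep]; omega)
      (by rw [hA' 2 (by omega), f₁ 2 (by omega), h.bounds.zero]) _ ?_ hI'
    intro w A'' I'' hA'' hI''
    have f : ∀ a, a < 9 ∨ a = 10 → A'' a = A a := fun a ha => by
      rw [hA'' a ha, hA' a ha, f₁ a (by omega)]
    exact holdsSpans_choiceStep (h.congr fun a ha => f a (by omega))
      (fun t ht j k => by rw [f 10 (by omega), hR t ht j k]) (by simp [h1]) (by simp [h2])
      (by simp) (by simp) hI''
  obtain ⟨R', k1, k2, k3⟩ := z₂.congr_set (I' := fun t => {y | ∃ o, ∃ t' : Fin (6 * n + 1), ∃ j,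
      t = t' + cliqueWeight G (𝒜 x) (pick (cliqueAt G W c) o) ∧
      y = Tm.factorVec G K (cliqueAt G W c) (𝒜 x) 𝒜 (pick (cliqueAt G W c) o) * R t' j})
    (fun t => by
      ext y
      simp [Prod.exists])
  refine ⟨R', fun t ht j k => ?_, k2, k3⟩
  have hb₂ : HasBounds A₂ n M := h.bounds.congr (f₂ 2 (by omega))
  rw [den_fillCells (by omega) hb₂ (A₂ 11) _ ht j.2 k.2, k1 t ht j k]
  intro η' A' h' h5 h6 h7
  rw [Tm.eval_read, h' 11 (by omega), Tm.eval_cellT (t := η' 5) (hb₂.congr (h' 2 (by omega)))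
    (by simp) (by omega) h6.le (by omega)]

end Cmd

/-- Among the sets `𝒜 j` with `j < M` and `valid j`, each subset of `W` occurs exactly once. -/
structure IsSubsetList {n : ℕ} (W : Finset (Fin n)) (M : ℕ) (𝒜 : ℕ → Finset (Fin n))
    (valid : ℕ → Prop) : Prop where
  subset : ∀ j : Fin M, valid j → 𝒜 j ⊆ W
  inj : ∀ i j : Fin M, valid i → valid j → 𝒜 i = 𝒜 j → i = j
  surj : ∀ S ⊆ W, ∃ j : Fin M, valid j ∧ 𝒜 j = S

-- The indices may outnumber the subsets of `W`; those that are not valid are masked out.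
open Classical in
theorem IsSubsetList.sum_eq {n M : ℕ} {W : Finset (Fin n)} {𝒜 : ℕ → Finset (Fin n)}
    {valid : ℕ → Prop} (h : IsSubsetList W M 𝒜 valid) (F : Finset (Fin n) → ZMod 2) :
    ∑ j : Fin M, (if valid j then F (𝒜 j) else 0) = ∑ S ∈ W.powerset, F S := by
  rw [← Finset.sum_filter]
  refine Finset.sum_nbij (fun j => 𝒜 j) ?_ ?_ ?_ ?_
  · intro j hj
    exact Finset.mem_powerset.2 (h.subset j (by simpa using hj))
  · intro i hi j hj hij
    exact h.inj i j (by simpa using hi) (by simpa using hj) hij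
  · intro S hS
    obtain ⟨j, hj, rfl⟩ := h.surj S (by simpa using hS)
    exact ⟨j, by simpa using hj, rfl⟩
  · intro j _
    rfl

/-! ### Solutions with a prescribed trace on the modulator -/

section Subset

variable {n M : ℕ} {G : SimpleGraph (Fin n)} {K W : Finset (Fin n)} {𝒜 : ℕ → Finset (Fin n)}
  {valid : ℕ → Prop}

/-- There is a solution that contains `r` and meets `W` in `X`. -/
def HasSolution (G : SimpleGraph (Fin n)) (K W : Finset (Fin n)) (r : Fin n)
    (X : Finset (Fin n)) : Prop :=
  r ∈ X ∧ K ∩ W ⊆ X ∧ ∃ o : Fin n → Fin n × Fin n,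
    (∀ c, K ∩ cliqueAt G W c ⊆ pick (cliqueAt G W c) (o c)) ∧
    (∑ A : Finset (Fin n),
      cutIndicator G X r A * ∏ c, cutFactor G X (pick (cliqueAt G W c) (o c)) A) ≠ 0 ∧
    adjPairs G X X + ∑ c, cliqueWeight G X (pick (cliqueAt G W c) (o c)) + 2 =
      2 * X.card + 4 * n

open Classical in
/-- The vector for the empty choice of cliques. -/
noncomputable def startVec (G : SimpleGraph (Fin n)) (K W : Finset (Fin n))
    (𝒜 : ℕ → Finset (Fin n)) (valid : ℕ → Prop) (r : Fin n) (x : ℕ) {M : ℕ} (j : Fin M) :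
    ZMod 2 :=
  if Tm.StartCond G K W 𝒜 valid r x j then 1 else 0

/-- The vectors for complete choices of total weight `t`. -/
def reachAt (G : SimpleGraph (Fin n)) (K W : Finset (Fin n)) (𝒜 : ℕ → Finset (Fin n))
    (valid : ℕ → Prop) (r : Fin n) (x M i t : ℕ) : Set (Fin M → ZMod 2) :=
  reach (startVec G K W 𝒜 valid r x) (adjPairs G (𝒜 x) (𝒜 x))
    (fun c o => Tm.factorVec G K (cliqueAt G W c) (𝒜 x) 𝒜 (pick (cliqueAt G W c) o))
    (fun c o => cliqueWeight G (𝒜 x) (pick (cliqueAt G W c) o)) i t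

/-- Coordinate `j` of a complete product is the summand of the parity formula for the cut `𝒜 j`,
provided `X` and the choices respect the terminals. Its coordinate sum is therefore the number of
uncrossed cuts modulo two. -/
theorem exists_mem_reachAt_iff (hl : IsSubsetList W M 𝒜 valid) {r : Fin n} {x : Fin M} :
    (∃ y ∈ reachAt G K W 𝒜 valid r x M n (2 * (𝒜 x).card + 4 * n - 2), ∑ j, y j ≠ 0) ↔
      valid x ∧ HasSolution G K W r (𝒜 x) := by
  classical
  have hfilter : Finset.univ.filter (fun c : Fin n => c.val < n) = Finset.univ :=
    Finset.filter_true_of_mem fun c _ => c.2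
  -- Ensures that the subtraction in `2 * |X| + 4 * n - 2` is not truncated.
  have hn : 0 < n := r.pos
  have hsum : ∀ o : Fin n → Fin n × Fin n, ∑ j, ((∏ c, Tm.factorVec G K (cliqueAt G W c) (𝒜 x) 𝒜
      (pick (cliqueAt G W c) (o c))) * startVec G K W 𝒜 valid r x : Fin M → ZMod 2) j =
      if (valid x ∧ r ∈ 𝒜 x ∧ K ∩ W ⊆ 𝒜 x) ∧
        ∀ c, K ∩ cliqueAt G W c ⊆ pick (cliqueAt G W c) (o c)
      then ∑ A : Finset (Fin n), cutIndicator G (𝒜 x) r A *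
        ∏ c, cutFactor G (𝒜 x) (pick (cliqueAt G W c) (o c)) A
      else 0 := by
    intro o
    have hj : ∀ j : Fin M, ((∏ c, Tm.factorVec G K (cliqueAt G W c) (𝒜 x) 𝒜
        (pick (cliqueAt G W c) (o c))) * startVec G K W 𝒜 valid r x : Fin M → ZMod 2) j =
        if (valid x ∧ r ∈ 𝒜 x ∧ K ∩ W ⊆ 𝒜 x) ∧
          ∀ c, K ∩ cliqueAt G W c ⊆ pick (cliqueAt G W c) (o c)
        then (if valid j then cutIndicator G (𝒜 x) r (𝒜 j) *
          ∏ c, cutFactor G (𝒜 x) (pick (cliqueAt G W c) (o c)) (𝒜 j) else 0)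
        else 0 := by
      intro j
      rw [Pi.mul_apply, Finset.prod_apply, mul_comm]
      simp only [Tm.factorVec, startVec, Tm.StartCond]
      rw [Finset.prod_ite_zero, cutIndicator]
      by_cases h1 : valid x ∧ r ∈ 𝒜 x ∧ K ∩ W ⊆ 𝒜 x
      · by_cases h2 : ∀ c, K ∩ cliqueAt G W c ⊆ pick (cliqueAt G W c) (o c)
        · by_cases h3 : valid j <;> by_cases h4 : IsCut G (𝒜 x) r (𝒜 j) <;> simp [h1, h2, h3, h4]
        · simp [h2]
      · simp [h1]
    rw [Finset.sum_congr rfl fun j _ => hj j]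
    split_ifs with h
    · rw [hl.sum_eq (fun A => cutIndicator G (𝒜 x) r A *
        ∏ c, cutFactor G (𝒜 x) (pick (cliqueAt G W c) (o c)) A)]
      -- A set that is not contained in `W` is no cut of `X ⊆ W`, so summing over the listed sets
      -- loses nothing.
      refine Finset.sum_subset (Finset.subset_univ _) fun A _ hA => ?_
      rw [cutIndicator, if_neg, zero_mul]
      intro hcut
      exact hA (Finset.mem_powerset.2 (hcut.1.trans (hl.subset x h.1.1)))
    · simp
  constructor
  · rintro ⟨_, ⟨o, ht, rfl⟩, hne⟩
    rw [hfilter] at ht hne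
    beta_reduce at ht
    rw [hsum o] at hne
    by_cases h : (valid x ∧ r ∈ 𝒜 x ∧ K ∩ W ⊆ 𝒜 x) ∧
      ∀ c, K ∩ cliqueAt G W c ⊆ pick (cliqueAt G W c) (o c)
    · rw [if_pos h] at hne
      exact ⟨h.1.1, h.1.2.1, h.1.2.2, o, h.2, hne, by omega⟩
    · exact absurd (if_neg h) hne
  · rintro ⟨hx, hr, hK, o, ho, hne, ht⟩
    refine ⟨_, ⟨o, ?_, rfl⟩, ?_⟩
    · rw [hfilter]
      beta_reduce
      omega
    · rw [hfilter, hsum o, if_pos ⟨⟨hx, hr, hK⟩, ho⟩]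
      exact hne

namespace Cmd

/-- Set up the tables for the subset with index `bv 1`. -/
def startStep : Cmd :=
  .seq (fillCells 10 (.const 0)) (.seq (.forr 7 1 (.store 9 (.bv 7) Tm.startT))
    (.seq (.store 12 (.const 1) (Tm.capT (Tm.pairsT (Tm.memT 8 1) (Tm.memT 9 1)))) (insert 10)))

/-- Set the cell `0` of the array `15` to one if some row of the table whose number is in the
cell `1` of the array `12` has odd sum. -/
def checkStep : Cmd :=
  .forr 6 1 (.store 15 (.const 0) (.ite
    (Tm.modT (.sum 7 1 (.read 10 (Tm.cellT (.read 12 (.const 1)) 6 7))))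
    (.const 1) (.read 15 (.const 0))))

/-- Look for solutions that meet the modulator in the subset with index `bv 1`. -/
def subsetStep : Cmd :=
  .seq startStep (.seq (.forr 2 0 cliqueStep) (.seq (.store 12 (.const 1) Tm.targetT) checkStep))

theorem holdsSpans_startStep {A : Mem} {η : Env} (h : Holds A G K W M 𝒜 valid) {r : Fin n}
    {x : Fin M} (h0 : η 0 = r) (h1 : η 1 = x) :
    HoldsSpans 10 (startStep.den η A) n (reachAt G K W 𝒜 valid r x M 0) := by
  classical
  rw [startStep, den_seq, den_seq, den_seq]
  set A₁ := (fillCells 10 (.const 0)).den η A with hA₁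
  have f₁ : ∀ a ≠ 10, A₁ a = A a := fun a h => den_of_not_writes _ (by
    simpa [fillCells, writes] using h) _ _
  have z₁ : HoldsSpans (M := M) 10 A₁ n (fun _ => ∅) := by
    refine ⟨fun _ _ _ => 0, fun t ht j k => ?_, fun _ _ j => ?_, fun t ht => ?_⟩
    · rw [hA₁, den_fillCells (by omega) h.bounds (fun _ => 0) (fun _ _ _ _ _ _ => by simp) ht
        j.2 k.2]
      rfl
    · exact ⟨fun _ _ => rfl, fun _ => rfl⟩
    · rw [Submodule.span_empty, Submodule.span_eq_bot]
      rintro _ ⟨j, rfl⟩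
      rfl
  set A₂ := (Cmd.forr 7 1 (.store 9 (.bv 7) Tm.startT)).den η A₁ with hA₂
  have f₂ : ∀ a, a ≠ 9 → A₂ a = A₁ a := fun a h => den_of_not_writes _ (by
    simpa [writes] using h) _ _
  have v₂ : HoldsVec (M := M) 9 A₂ (startVec G K W 𝒜 valid r x) := by
    obtain ⟨g, -⟩ := den_store_loop (a := 9) (k := 7) (b := 1) (i := .bv 7)
      (e := Tm.startT) (η := η) (A := A₁) (by rw [f₁ 2 (by omega), h.bounds.one])
      (fun k => k)
      (fun k => if hk : k < M then
        (startVec G K W 𝒜 valid r x (⟨k, hk⟩ : Fin M)).val else 0)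
      (fun x hx y hy h => h) (fun x hx A' h => by simp)
      (fun k hk A' h' _ => by
        rw [Tm.eval_startT (h.congr fun a ha => by rw [h' a (by omega), f₁ a (by omega)])
          (r := r) (x := x) (j := ⟨k, hk⟩) (by simp [h0]) (by simp [h1]) (by simp), dif_pos hk,
          ind_eq_val, startVec])
    intro k
    rw [hA₂, g k k.2, dif_pos k.2]
  set A₃ := (Cmd.store 12 (.const 1)
    (Tm.capT (Tm.pairsT (Tm.memT 8 1) (Tm.memT 9 1)))).den η A₂ with hA₃
  have h₂ : Holds A₂ G K W M 𝒜 valid := h.congr fun a ha => by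
    rw [f₂ a (by omega), f₁ a (by omega)]
  have f₃ : ∀ a, a ≠ 12 → A₃ a = A₂ a := fun a h => den_store_of_ne h
  refine (HoldsSpans.insert (by omega) (h₂.bounds.congr (f₃ 2 (by omega)))
    (t₀ := adjPairs G (𝒜 x) (𝒜 x)) ?_ (z₁.congr_mem (A' := A₃) ?_)
    (v := startVec G K W 𝒜 valid r x) ?_).congr_set fun t => ?_
  · rw [hA₃, den_store, Tm.eval_const, if_pos rfl, Tm.eval_capT h₂.bounds,
      Tm.eval_pairsT (S := 𝒜 x) (T := 𝒜 x) h₂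
      (fun u v => Tm.eval_memT h₂ (by simp) (by simp [h1]) (by omega))
      (fun u v => Tm.eval_memT h₂ (by simp) (by simp [h1]) (by omega))]
  · rw [f₃ 10 (by omega), f₂ 10 (by omega)]
  · intro k
    rw [f₃ 9 (by omega), v₂ k]
  · ext y
    simp only [reachAt, reach, Nat.not_lt_zero, Finset.filter_false, Finset.sum_empty,
      Finset.prod_empty, one_mul, add_zero, Set.empty_union, Set.mem_ofPred_eq]
    exact ⟨fun h => ⟨fun _ => (r, r), h⟩, fun ⟨_, h⟩ => h⟩

theorem writes_cliqueStep {a : ℕ} (ha : a < 9 ∨ a = 15) : cliqueStep.writes a = false := by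
  simp [writes, cliqueStep, fillCells, choiceStep, rowStep, insert, reduceStep]
  omega

theorem holdsSpans_cliqueLoop {A : Mem} {η : Env} (h : Holds A G K W M 𝒜 valid) {r : Fin n}
    {x : Fin M} (h1 : η 1 = x)
    (hI : HoldsSpans 10 A n (reachAt G K W 𝒜 valid r x M 0)) :
    HoldsSpans 10 ((Cmd.forr 2 0 cliqueStep).den η A) n (reachAt G K W 𝒜 valid r x M n) := by
  have := den_forr_induction (k := 2) (b := 0) (p := cliqueStep) (η := η) (A := A)
    (fun i A' => (∀ a < 8, A' a = A a) ∧ HoldsSpans 10 A' n (reachAt G K W 𝒜 valid r x M i))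
    ⟨fun _ _ => rfl, hI⟩ (by
      rintro i hi A' ⟨f, R, k1, k2, k3⟩
      rw [h.bounds.zero] at hi
      refine ⟨fun a ha => by rw [den_of_not_writes _ (writes_cliqueStep (by omega)), f a ha], ?_⟩
      obtain ⟨R', l1, l2, l3⟩ := holdsSpans_cliqueStep (h.congr f) k1 (x := x) (c := ⟨i, hi⟩)
        (η := Function.update η 2 i) (by simp [h1]) (by simp)
      refine ⟨R', l1, l2, fun t ht => ?_⟩
      rw [l3 t ht]
      exact span_reach_succ hi (Nat.le_succ _) k3 t ht)
  rw [h.bounds.zero] at this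
  exact this.2

theorem den_checkStep {A : Mem} {η : Env} (hb : HasBounds A n M)
    {R : ℕ → Fin M → Fin M → ZMod 2} (hR : HoldsTables 10 A n R) {t : ℕ} (ht : t ≤ 6 * n)
    (hA : A 12 1 = t) {p : Prop} (hp : A 15 0 = ind p) :
    checkStep.den η A 15 0 = ind (p ∨ ∃ j, ∑ k, R t j k ≠ 0) := by
  have := den_forr_induction (k := 6) (b := 1) (η := η) (A := A)
    (p := .store 15 (.const 0) (.ite
      (Tm.modT (.sum 7 1 (.read 10 (Tm.cellT (.read 12 (.const 1)) 6 7))))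
      (.const 1) (.read 15 (.const 0))))
    (fun i A' => (∀ a ≠ 15, A' a = A a) ∧
      A' 15 0 = ind (p ∨ ∃ j : Fin M, j.val < i ∧ ∑ k, R t j k ≠ 0))
    ⟨fun _ _ => rfl, by simpa using hp⟩ (by
      rintro i hi A' ⟨f, hv⟩
      rw [hb.one] at hi
      have hb' : HasBounds A' n M := hb.congr (f 2 (by omega))
      have hs : ∀ η' : Env, η' 6 = i →
          (Tm.sum 7 1 (.read 10 (Tm.cellT (.read 12 (.const 1)) 6 7))).eval η' A' =
            ∑ k, (R t ⟨i, hi⟩ k).val := by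
        intro η' h6
        rw [Tm.eval_sum, hb'.one, Finset.sum_range]
        refine Finset.sum_congr rfl fun k _ => ?_
        rw [Tm.eval_read, Tm.eval_cellT hb' (t := t) (by simp [f 12, hA]) (by omega)
          (by simpa [h6] using hi.le) (by omega), f 10 (by omega)]
        simpa [h6] using hR t ht ⟨i, hi⟩ k
      have hmod : (Tm.modT (.sum 7 1 (.read 10 (Tm.cellT (.read 12 (.const 1)) 6 7)))).eval
          (Function.update η 6 i) A' = (∑ k, R t ⟨i, hi⟩ k).val := by
        rw [Tm.eval_modT (fun i' => hs _ (by simp)) (hs _ (by simp)), ← ZMod.val_natCast]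
        · simp
        · rw [hb'.one]
          -- The parity term needs its argument to be at most `2 * M`, which holds as all entries
          -- are below 2.
          calc ∑ k, (R t ⟨i, hi⟩ k).val ≤ ∑ _k : Fin M, 2 :=
                Finset.sum_le_sum fun k _ => (ZMod.val_lt _).le
            _ = 2 * M := by simp [mul_comm]
      refine ⟨fun a ha => by rw [den_store_of_ne ha, f a ha], ?_⟩
      rw [den_store, Tm.eval_const, if_pos rfl, Tm.eval_ite, hmod, Tm.eval_const, Tm.eval_read,
        Tm.eval_const, hv]
      by_cases h0 : ∑ k, R t ⟨i, hi⟩ k = 0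
      · rw [h0, ZMod.val_zero, if_pos rfl]
        refine ind_congr (or_congr Iff.rfl ⟨fun ⟨j, hj, hne⟩ => ⟨j, by omega, hne⟩,
          fun ⟨j, hj, hne⟩ => ⟨j, ?_, hne⟩⟩)
        refine lt_of_le_of_ne (Nat.lt_succ_iff.1 hj) fun hji => hne ?_
        obtain rfl : j = ⟨i, hi⟩ := Fin.ext hji
        exact h0
      · rw [if_neg fun h => h0 ((ZMod.val_eq_zero _).1 h),
          ind_pos (.inr ⟨⟨i, hi⟩, Nat.lt_succ_self i, h0⟩)])
  rw [checkStep, this.2, hb.one]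
  exact ind_congr (or_congr Iff.rfl (exists_congr fun j => and_iff_right j.2))

theorem writes_subsetStep {a : ℕ} (ha : a < 9) : subsetStep.writes a = false := by
  simp [writes, subsetStep, startStep, checkStep, cliqueStep, fillCells, choiceStep, rowStep,
    insert, reduceStep]
  omega

/-- A linear form that is nonzero somewhere on the reachable products is nonzero on some basis row,
and conversely, so checking the rows of the target table is exact. -/
theorem den_subsetStep {A : Mem} {η : Env} (h : Holds A G K W M 𝒜 valid)
    (hl : IsSubsetList W M 𝒜 valid) {r : Fin n} {x : Fin M} (h0 : η 0 = r) (h1 : η 1 = x)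
    {p : Prop} (hp : A 15 0 = ind p) :
    subsetStep.den η A 15 0 = ind (p ∨ (valid x ∧ HasSolution G K W r (𝒜 x))) := by
  rw [subsetStep, den_seq, den_seq, den_seq]
  have hI₁ := holdsSpans_startStep h h0 h1
  set A₁ := startStep.den η A with hA₁
  have f₁ : ∀ a, a < 9 ∨ a = 15 → A₁ a = A a := fun a ha => den_of_not_writes _ (by
    simp [startStep, fillCells, writes, insert, reduceStep]; omega) _ _
  have hI₂ := holdsSpans_cliqueLoop (h.congr fun a ha => f₁ a (by omega)) h1 hI₁
  set A₂ := (Cmd.forr 2 0 cliqueStep).den η A₁ with hA₂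
  have f₂ : ∀ a, a < 9 ∨ a = 15 → A₂ a = A a := fun a ha => by
    rw [hA₂, den_of_not_writes _ (by rw [writes, writes_cliqueStep ha]), f₁ a ha]
  have h₂ : Holds A₂ G K W M 𝒜 valid := h.congr fun a ha => f₂ a (by omega)
  set A₃ := (Cmd.store 12 (.const 1) Tm.targetT).den η A₂ with hA₃
  have f₃ : ∀ a ≠ 12, A₃ a = A₂ a := fun a ha => den_store_of_ne ha
  -- The target weight avoids the overflow table.
  have ht : 2 * (𝒜 x).card + 4 * n - 2 < 6 * n := by
    have h1 : (𝒜 x).card ≤ n := by simpa using Finset.card_le_univ (𝒜 x)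
    have h2 : 0 < n := r.pos
    omega
  obtain ⟨R, k1, k2, k3⟩ := hI₂.congr_mem (f₃ 10 (by omega))
  rw [den_checkStep (h₂.bounds.congr (f₃ 2 (by omega))) k1 ht.le
    (by rw [hA₃, den_store, Tm.eval_const, if_pos rfl, Tm.eval_targetT h₂ h1])
    (p := p) (by rw [f₃ 15 (by omega), f₂ 15 (by omega), hp])]
  refine ind_congr (or_congr Iff.rfl ?_)
  rw [← exists_mem_reachAt_iff hl]
  constructor
  · rintro ⟨j, hj⟩
    exact exists_ne_zero_of_span_eq (k3 _ ht) ⟨_, ⟨j, rfl⟩, hj⟩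
  · intro hy
    obtain ⟨_, ⟨j, rfl⟩, hj⟩ := exists_ne_zero_of_span_eq (k3 _ ht).symm hy
    exact ⟨j, hj⟩

end Cmd

end Subset

/-! ### Enumerating subsets -/

open Classical in
/-- What is left of the binary expansion of `j` after one digit has been used up for every
`u < v` with `w u`. -/
noncomputable def residue (w : ℕ → Prop) : ℕ → ℕ → ℕ
  | 0, j => j
  | v + 1, j => if w v then residue w v j / 2 else residue w v j

theorem residue_le (w : ℕ → Prop) (v j : ℕ) : residue w v j ≤ j := by
  induction v with
  | zero => exact le_rfl
  | succ v ih =>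
    rw [residue]
    split_ifs
    · omega
    · exact ih

/-- The digits split off together with the remaining quotient determine the index. -/
theorem residue_inj {w : ℕ → Prop} {i j n : ℕ} (h : residue w n i = residue w n j)
    (hb : ∀ v < n, w v → (residue w v i % 2 = 1 ↔ residue w v j % 2 = 1)) : i = j := by
  induction n with
  | zero => exact h
  | succ n ih =>
    refine ih ?_ fun v hv => hb v (by omega)
    rw [residue, residue] at h
    split_ifs at h with hw
    · have := hb n (by omega) hw
      omega
    · exact h

-- The index is built from the last digit backwards: the leftover `z` is replaced by `2 * z` plus
-- the digit at `n`. This is why `z` must be arbitrary in the induction and the bound gains one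
-- factor 2 per member.
open Classical in
theorem exists_residue (w s : ℕ → Prop) (n : ℕ) : ∀ z, ∃ j, residue w n j = z ∧
    (∀ v < n, w v → (residue w v j % 2 = 1 ↔ s v)) ∧ j < (z + 1) * 2 ^ Nat.count w n := by
  induction n with
  | zero => exact fun z => ⟨z, rfl, fun v hv => absurd hv (Nat.not_lt_zero v), by simp⟩
  | succ n ih =>
    intro z
    by_cases hw : w n
    · obtain ⟨j, h1, h2, h3⟩ := ih (2 * z + if s n then 1 else 0)
      refine ⟨j, ?_, fun v hv hwv => ?_, ?_⟩
      · rw [residue, if_pos hw, h1]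
        split_ifs <;> omega
      · rcases Nat.lt_succ_iff_lt_or_eq.1 hv with hv | rfl
        · exact h2 v hv hwv
        · rw [h1]
          by_cases hs : s v
          · simp [hs]
          · simp [hs]
      · rw [Nat.count_succ, if_pos hw, pow_succ]
        refine h3.trans_le ?_
        have : (2 * z + if s n then 1 else 0) + 1 ≤ (z + 1) * 2 := by split_ifs <;> omega
        calc _ ≤ (z + 1) * 2 * 2 ^ Nat.count w n := Nat.mul_le_mul_right _ this
          _ = _ := by ring
    · obtain ⟨j, h1, h2, h3⟩ := ih z
      refine ⟨j, ?_, fun v hv hwv => ?_, ?_⟩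
      · rw [residue, if_neg hw, h1]
      · rcases Nat.lt_succ_iff_lt_or_eq.1 hv with hv | rfl
        · exact h2 v hv hwv
        · exact absurd hwv hw
      · rwa [Nat.count_succ, if_neg hw, add_zero]

section Root

variable {n : ℕ}

/-- Membership in a set of vertices as a property of numbers. -/
def natMem (W : Finset (Fin n)) (v : ℕ) : Prop := ∃ h : v < n, ⟨v, h⟩ ∈ W

theorem natMem_val {W : Finset (Fin n)} {v : Fin n} : natMem W v ↔ v ∈ W :=
  ⟨fun ⟨_, h⟩ => h, fun h => ⟨v.2, h⟩⟩

open Classical in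
theorem count_natMem (W : Finset (Fin n)) : Nat.count (natMem W) n = W.card := by
  rw [Nat.count_eq_card_filter_range, ← Finset.card_map Fin.valEmbedding]
  refine congrArg Finset.card (Finset.ext fun v => ?_)
  rw [Finset.mem_filter, Finset.mem_range, Finset.mem_map]
  constructor
  · rintro ⟨_, h, hv⟩
    exact ⟨_, hv, rfl⟩
  · rintro ⟨u, hu, rfl⟩
    exact ⟨u.2, u.2, hu⟩

open Classical in
/-- The subset of `W` with index `j`. -/
noncomputable def listSet (W : Finset (Fin n)) (j : ℕ) : Finset (Fin n) :=
  W.filter fun v => residue (natMem W) v j % 2 = 1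

theorem mem_listSet {W : Finset (Fin n)} {j : ℕ} {v : Fin n} :
    v ∈ listSet W j ↔ v ∈ W ∧ residue (natMem W) v j % 2 = 1 := by
  simp [listSet]

/-- Requiring that nothing is left of the index selects one index for each pattern of digits, and
this index is below `2 ^ |W|`. -/
theorem isSubsetList {W : Finset (Fin n)} {M : ℕ} (hM : 2 ^ W.card ≤ M) :
    IsSubsetList W M (listSet W) fun j => residue (natMem W) n j = 0 where
  subset j _ := Finset.filter_subset _ _
  inj i j hi hj h := by
    refine Fin.ext (residue_inj (hi.trans hj.symm) fun v hv hw => ?_)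
    have := Finset.ext_iff.1 h ⟨v, hv⟩
    rw [mem_listSet, mem_listSet] at this
    have hvW : (⟨v, hv⟩ : Fin n) ∈ W := natMem_val.1 hw
    simpa [hvW] using this
  surj S hS := by
    obtain ⟨j, h1, h2, h3⟩ := exists_residue (natMem W) (natMem S) n 0
    rw [zero_add, one_mul, count_natMem] at h3
    refine ⟨⟨j, h3.trans_le hM⟩, h1, ?_⟩
    ext v
    rw [mem_listSet]
    constructor
    · rintro ⟨hv, h⟩
      exact natMem_val.1 ((h2 v v.2 (natMem_val.2 hv)).1 h)
    · intro hv
      exact ⟨hS hv, (h2 v v.2 (natMem_val.2 (hS hv))).2 (natMem_val.2 hv)⟩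

/-! ### The tables for a root -/

/-- Membership of `bv 3` in the clique with smallest vertex `bv 2`. -/
def Tm.cliqueAtT : Tm :=
  andT (andT (notT (.read 4 (.bv 2))) (allT 8 0 (impT (notT (.read 4 (.bv 8)))
      (impT (adjT 8 2) (ltT (.bv 2) (.bv 8))))))
    (andT (notT (.read 4 (.bv 3))) (.ite (eqT (.bv 3) (.bv 2)) (.const 1) (adjT 2 3)))

theorem Tm.eval_cliqueAtT {M : ℕ} {A : Mem} {η : Env} {G : SimpleGraph (Fin n)}
    {W : Finset (Fin n)} (hb : HasBounds A n M)
    (hA : ∀ u v : Fin n, A 0 (u * n + v) = ind (G.Adj u v))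
    (hW : ∀ u : Fin n, A 4 u = ind (u ∈ W)) {c u : Fin n} (h2 : η 2 = c) (h3 : η 3 = u) :
    cliqueAtT.eval η A = ind (u ∈ cliqueAt G W c) := by
  have key : cliqueAtT.eval η A = ind (((¬ c ∈ W) ∧ ∀ v, (¬ v ∈ W) → G.Adj v c → c < v) ∧
      (¬ u ∈ W) ∧ (u = c ∨ G.Adj c u)) := by
    refine eval_andT_ind (eval_andT_ind (eval_notT_ind (by simp [h2, hW]))
      (eval_allT_ind hb fun v => eval_impT_ind (eval_notT_ind (by simp [hW]))
        (eval_impT_ind (eval_adjT hb hA (by simp) (by simp [h2]) (by omega)) ?_)))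
      (eval_andT_ind (eval_notT_ind (by simp [h3, hW])) ?_)
    · simp only [eval_ltT, eval_bv, Function.update_self]
      rw [Function.update_of_ne (by omega), h2]
      by_cases h : c < v
      · simp [h]
      · simp [h]
    · rw [eval_ite, eval_adjT hb hA h2 h3 (by omega)]
      simp only [eval_eqT, eval_bv, eval_const, h2, h3, Fin.val_inj]
      by_cases h : u = c
      · simp [h]
      · simp [h]
  rw [key]
  exact ind_congr mem_cliqueAt.symm

namespace Cmd

/-- Split off one binary digit of the cell `bv 6` of the array `5`. -/
def bitStep : Cmd :=
  .seq (.store 6 (.add (Tm.mulT 0 (.bv 3) (.read 2 (.const 1))) (.bv 6))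
    (.ite (.read 4 (.bv 3)) (Tm.modT (.read 5 (.bv 6))) (.const 0)))
  (.store 5 (.bv 6) (.ite (.read 4 (.bv 3)) (Tm.halfT (.read 5 (.bv 6))) (.read 5 (.bv 6))))

/-- Compute the list of all subsets of the modulator. -/
def listStep : Cmd :=
  .seq (.forr 6 1 (.store 5 (.bv 6) (.bv 6))) (.forr 3 0 (.forr 6 1 bitStep))

/-- Compute the cliques outside the modulator. -/
def cliqueTable : Cmd :=
  .forr 2 0 (.forr 3 0 (.store 7 (.add (Tm.mulT 0 (.bv 2) (.read 2 (.const 0))) (.bv 3))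
    Tm.cliqueAtT))

/-- Look for solutions that contain the vertex `bv 0`. -/
def rootStep : Cmd :=
  .seq (.forr 3 0 (.store 4 (.bv 3) (.ite (.read 3 (.bv 3)) (.const 1) (Tm.eqT (.bv 3) (.bv 0)))))
  (.seq listStep (.seq cliqueTable (.forr 1 1 subsetStep)))

variable {M : ℕ}

theorem den_bitStep {A : Mem} {η : Env} (hb : HasBounds A n M) {W : Finset (Fin n)}
    (hW : ∀ u : Fin n, A 4 u = ind (u ∈ W)) {v : Fin n} {i : ℕ} (hi : i < M) (h3 : η 3 = v)
    (h6 : η 6 = i) (h5 : A 5 i = residue (natMem W) v i) :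
    (∀ m, bitStep.den η A 6 m = if m = v * M + i then ind (v ∈ listSet W i) else A 6 m) ∧
      ∀ m, bitStep.den η A 5 m = if m = i then residue (natMem W) (v + 1) i else A 5 m := by
  -- A residue never exceeds its index, so it stays within the range of `modT` and `halfT`.
  have hle := residue_le (natMem W) v i
  rw [bitStep, den_seq]
  constructor
  · intro m
    rw [den_store_of_ne (by omega), den_store]
    have e1 : (Tm.add (Tm.mulT 0 (.bv 3) (.read 2 (.const 1))) (.bv 6)).eval η A = v * M + i := by
      rw [Tm.eval_add, Tm.eval_mulT (x := v) (y := M), Tm.eval_bv, h6]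
      · intro x
        simp [h3]
      · intro x
        simp [hb.one]
      · rw [hb.zero]
        exact v.2.le
    have e2 : (Tm.modT (.read 5 (.bv 6))).eval η A = residue (natMem W) v i % 2 :=
      Tm.eval_modT (by simp [h6, h5]) (by simp [h6, h5]) (by rw [hb.one]; omega)
    rw [e1, Tm.eval_ite, e2, Tm.eval_read, Tm.eval_bv, h3, hW, Tm.eval_const]
    congr 1
    by_cases h : v ∈ W
    · by_cases h' : residue (natMem W) v i % 2 = 1
      · rw [ind_pos h, if_neg one_ne_zero, h', ind_pos (mem_listSet.2 ⟨h, h'⟩)]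
      · rw [ind_pos h, if_neg one_ne_zero, ind_neg fun hm => h' (mem_listSet.1 hm).2]
        omega
    · rw [ind_neg h, if_pos rfl, ind_neg fun hm => h (mem_listSet.1 hm).1]
  · intro m
    set A₁ := (Cmd.store 6 (.add (Tm.mulT 0 (.bv 3) (.read 2 (.const 1))) (.bv 6))
      (.ite (.read 4 (.bv 3)) (Tm.modT (.read 5 (.bv 6))) (.const 0))).den η A
    have f₁ : ∀ a ≠ 6, A₁ a = A a := fun a ha => den_store_of_ne ha
    have e2 : (Tm.halfT (.read 5 (.bv 6))).eval η A₁ = residue (natMem W) v i / 2 :=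
      Tm.eval_halfT (by simp [h6, h5, f₁ 5]) (by rw [f₁ 2 (by omega), hb.one]; omega)
    rw [den_store, Tm.eval_ite, e2, Tm.eval_read, Tm.eval_bv, Tm.eval_bv, Tm.eval_read, Tm.eval_bv,
      h3, h6, f₁ 4 (by omega), f₁ 5 (by omega), h5, hW, residue]
    congr 1
    by_cases h : v ∈ W
    · rw [ind_pos h, if_neg one_ne_zero, if_pos (natMem_val.2 h)]
    · rw [ind_neg h, if_pos rfl, if_neg fun h' => h (natMem_val.1 h')]

theorem den_listStep {A : Mem} {η : Env} (hb : HasBounds A n M) {W : Finset (Fin n)}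
    (hW : ∀ u : Fin n, A 4 u = ind (u ∈ W)) :
    (∀ j : Fin M, listStep.den η A 5 j = residue (natMem W) n j) ∧
      ∀ (v : Fin n) (j : Fin M), listStep.den η A 6 (v * M + j) = ind (v ∈ listSet W j) := by
  rw [listStep, den_seq]
  set A₁ := (Cmd.forr 6 1 (.store 5 (.bv 6) (.bv 6))).den η A with hA₁
  have f₁ : ∀ a ≠ 5, A₁ a = A a := fun a h => den_of_not_writes _ (by simpa [writes] using h) _ _
  have v₁ : ∀ j < M, A₁ 5 j = j := by
    obtain ⟨g, -⟩ := den_store_loop (a := 5) (k := 6) (b := 1) (i := .bv 6) (e := .bv 6) (η := η)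
      (A := A) hb.one (fun k => k) (fun k => k) (fun x hx y hy h => h)
      (fun x hx A' h => by simp) (fun x hx A' h _ => by simp)
    exact g
  have hw : ∀ a, a ≠ 5 → a ≠ 6 → bitStep.writes a = false := by
    intro a h h'
    simp [bitStep, writes, h, h']
  have := den_forr_induction (k := 3) (b := 0) (p := .forr 6 1 bitStep) (η := η) (A := A₁)
    (fun v A' => (∀ a, a ≠ 5 → a ≠ 6 → A' a = A a) ∧
      (∀ j < M, A' 5 j = residue (natMem W) v j) ∧
      ∀ u : Fin n, u.val < v → ∀ j < M, A' 6 (u * M + j) = ind (u ∈ listSet W j))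
    ⟨fun a h _ => f₁ a h, v₁, fun u hu => absurd hu (Nat.not_lt_zero _)⟩ (by
      rintro v hv A₂ ⟨f₂, g₂, s₂⟩
      rw [f₁ 2 (by omega), hb.zero] at hv
      -- During the round of `v`, the indices below `i` have already been processed for `v`, the
      -- others not yet.
      have := den_forr_induction (k := 6) (b := 1) (p := bitStep)
        (η := Function.update η 3 v) (A := A₂)
        (fun i A' => (∀ a, a ≠ 5 → a ≠ 6 → A' a = A a) ∧
          (∀ j < M, A' 5 j = residue (natMem W) (if j < i then v + 1 else v) j) ∧
          ∀ u : Fin n, ∀ j < M, (u.val < v ∨ u.val = v ∧ j < i) →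
            A' 6 (u * M + j) = ind (u ∈ listSet W j))
        ⟨f₂, fun j hj => by simpa using g₂ j hj, fun u j hj hu => s₂ u (by omega) j hj⟩ (by
          rintro i hi A₃ ⟨f₃, g₃, s₃⟩
          rw [f₂ 2 (by omega) (by omega), hb.one] at hi
          obtain ⟨k6, k5⟩ := den_bitStep (hb.congr (f₃ 2 (by omega) (by omega)))
            (η := Function.update (Function.update η 3 v) 6 i) (W := W)
            (by simpa [f₃ 4] using hW) (v := ⟨v, hv⟩) hi (by simp) (by simp)
            (by simpa using g₃ i hi)
          refine ⟨fun a h h' => by rw [den_of_not_writes _ (hw a h h'), f₃ a h h'],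
            fun j hj => ?_, fun u j hj hu => ?_⟩
          · rw [k5]
            by_cases hji : j = i
            · subst hji
              simp
            · rw [if_neg hji, g₃ j hj]
              congr 1
              by_cases hlt : j < i
              · rw [if_pos hlt, if_pos (by omega)]
              · rw [if_neg hlt, if_neg (by omega)]
          · rw [k6]
            by_cases heq : u.val * M + j = v * M + i
            · obtain ⟨h1, rfl⟩ := mul_add_inj hj hi heq
              obtain rfl : u = ⟨v, hv⟩ := Fin.ext h1
              rw [if_pos rfl]
            · rw [if_neg heq]
              refine s₃ u j hj ?_
              rcases hu with hu | ⟨hu, hj'⟩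
              · exact .inl hu
              · refine .inr ⟨hu, lt_of_le_of_ne (Nat.lt_succ_iff.1 hj') ?_⟩
                rintro rfl
                exact heq (by rw [hu]))
      rw [f₂ 2 (by omega) (by omega), hb.one] at this
      refine ⟨this.1, fun j hj => ?_, fun u hu j hj => this.2.2 u j hj (by omega)⟩
      rw [this.2.1 j hj, if_pos hj])
  rw [f₁ 2 (by omega), hb.zero] at this
  exact ⟨fun j => this.2.1 j j.2, fun v j => this.2.2 v v.2 j j.2⟩

theorem den_cliqueTable {A : Mem} {η : Env} {G : SimpleGraph (Fin n)} (hb : HasBounds A n M)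
    (hA : ∀ u v : Fin n, A 0 (u * n + v) = ind (G.Adj u v)) {W : Finset (Fin n)}
    (hW : ∀ u : Fin n, A 4 u = ind (u ∈ W)) (c u : Fin n) :
    cliqueTable.den η A 7 (c * n + u) = ind (u ∈ cliqueAt G W c) := by
  have := den_forr_induction (k := 2) (b := 0) (η := η) (A := A)
    (p := .forr 3 0 (.store 7 (.add (Tm.mulT 0 (.bv 2) (.read 2 (.const 0))) (.bv 3))
      Tm.cliqueAtT))
    (fun i A' => (∀ a ≠ 7, A' a = A a) ∧
      ∀ c u : Fin n, c.val < i → A' 7 (c * n + u) = ind (u ∈ cliqueAt G W c))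
    ⟨fun _ _ => rfl, fun _ _ h => absurd h (Nat.not_lt_zero _)⟩ (by
      rintro i hi A₁ ⟨f₁, g₁⟩
      rw [hb.zero] at hi
      obtain ⟨k1, k2⟩ := den_store_loop (a := 7) (k := 3) (b := 0)
        (i := .add (Tm.mulT 0 (.bv 2) (.read 2 (.const 0))) (.bv 3)) (e := Tm.cliqueAtT)
        (η := Function.update η 2 i) (A := A₁) (N := n) (by rw [f₁ 2 (by omega), hb.zero])
        (fun u => i * n + u)
        (fun u => if hu : u < n then ind (⟨u, hu⟩ ∈ cliqueAt G W ⟨i, hi⟩) else 0)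
        (fun x hx y hy h => (mul_add_inj hx hy h).2)
        (fun x hx A' h => by
          rw [Tm.eval_add, Tm.eval_mulT (x := i) (y := n)]
          · simp
          · simp
          · simp [h 2, f₁ 2, hb.zero]
          · rw [h 2 (by omega), f₁ 2 (by omega), hb.zero]
            exact hi.le)
        (fun u hu A' h _ => by
          rw [dif_pos hu]
          have f : ∀ a ≠ 7, A' a = A a := fun a ha => by rw [h a ha, f₁ a ha]
          exact Tm.eval_cliqueAtT (hb.congr (f 2 (by omega)))
            (by simpa [f 0] using hA) (by simpa [f 4] using hW) (by simp) (by simp))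
      refine ⟨fun a ha => ?_, fun c u hc => ?_⟩
      · rw [den_of_not_writes _ (by simpa [writes] using ha), f₁ a ha]
      · by_cases hci : c.val = i
        · obtain rfl : c = ⟨i, hi⟩ := Fin.ext hci
          rw [k1 u u.2, dif_pos u.2]
        · rw [k2 _ fun x hx h => hci (mul_add_inj u.2 hx h).1, g₁ c u (by omega)])
  rw [hb.zero] at this
  exact this.2 c u c.2

theorem writes_rootStep {a : ℕ} (ha : a < 4) : rootStep.writes a = false := by
  simp [writes, rootStep, writes_subsetStep (a := a) (by omega), listStep, bitStep, cliqueTable]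
  omega

theorem den_rootStep {A : Mem} {η : Env} {G : SimpleGraph (Fin n)} {K U : Finset (Fin n)}
    (hb : HasBounds A n M) (hA : ∀ u v : Fin n, A 0 (u * n + v) = ind (G.Adj u v))
    (hK : ∀ u : Fin n, A 1 u = ind (u ∈ K)) (hU : ∀ u : Fin n, A 3 u = ind (u ∈ U))
    (hM : 2 ^ (U.card + 1) ≤ M) {r : Fin n} (h0 : η 0 = r) {p : Prop} (hp : A 15 0 = ind p) :
    rootStep.den η A 15 0 =
      ind (p ∨ ∃ X ⊆ Insert.insert r U, HasSolution G K (Insert.insert r U) r X) := by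
  rw [rootStep, den_seq, den_seq, den_seq]
  set W := Insert.insert r U with hW
  set A₁ := (Cmd.forr 3 0 (.store 4 (.bv 3)
    (.ite (.read 3 (.bv 3)) (.const 1) (Tm.eqT (.bv 3) (.bv 0))))).den η A with hA₁
  have f₁ : ∀ a ≠ 4, A₁ a = A a := fun a h => den_of_not_writes _ (by simpa [writes] using h) _ _
  have w₁ : ∀ u : Fin n, A₁ 4 u = ind (u ∈ W) := by
    obtain ⟨g, -⟩ := den_store_loop (a := 4) (k := 3) (b := 0) (i := .bv 3)
      (e := .ite (.read 3 (.bv 3)) (.const 1) (Tm.eqT (.bv 3) (.bv 0))) (η := η)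
      (A := A) hb.zero (fun k => k) (fun k => if hk : k < n then ind (⟨k, hk⟩ ∈ W) else 0)
      (fun x hx y hy h => h)
      (fun x hx A' h => by simp) (fun x hx A' h _ => by
        have := hU ⟨x, hx⟩
        simp only at this
        have h0' : Function.update η 3 x 0 = r := by simpa using h0
        simp only [Tm.eval_ite, Tm.eval_read, Tm.eval_bv, Tm.eval_const, Tm.eval_eqT,
          Function.update_self, h 3 (by omega), this, dif_pos hx, h0', hW, Finset.mem_insert,
          Fin.ext_iff]
        by_cases h1 : (⟨x, hx⟩ : Fin n) ∈ U
        · simp [h1]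
        · by_cases h2 : x = r
          · simp [h2, ind_eq_zero]
          · simp [h1, h2])
    intro u
    rw [hA₁, g u u.2, dif_pos u.2]
  have hb₁ : HasBounds A₁ n M := hb.congr (f₁ 2 (by omega))
  obtain ⟨m₂, s₂⟩ := den_listStep (η := η) hb₁ w₁
  set A₂ := listStep.den η A₁ with hA₂
  have f₂ : ∀ a, a ≠ 5 → a ≠ 6 → A₂ a = A₁ a := fun a h h' => den_of_not_writes _ (by
    simp [listStep, bitStep, writes, h, h']) _ _
  have hb₂ : HasBounds A₂ n M := hb₁.congr (f₂ 2 (by omega) (by omega))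
  have hA' : ∀ u v : Fin n, A₂ 0 (u * n + v) = ind (G.Adj u v) := fun u v => by
    rw [f₂ 0 (by omega) (by omega), f₁ 0 (by omega), hA]
  have w₂ : ∀ u : Fin n, A₂ 4 u = ind (u ∈ W) := fun u => by
    rw [f₂ 4 (by omega) (by omega), w₁]
  have c₃ := den_cliqueTable (η := η) hb₂ hA' w₂
  set A₃ := cliqueTable.den η A₂ with hA₃
  have f₃ : ∀ a ≠ 7, A₃ a = A₂ a := fun a h => den_of_not_writes _ (by
    simp [cliqueTable, writes, h]) _ _
  have h₃ : Holds A₃ G K W M (listSet W) fun j => residue (natMem W) n j = 0 := by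
    refine ⟨hb₂.congr (f₃ 2 (by omega)), fun u v => ?_, fun u => ?_, fun u => ?_, fun j => ?_,
      fun u j => ?_, c₃⟩
    · rw [f₃ 0 (by omega), hA']
    · rw [f₃ 1 (by omega), f₂ 1 (by omega) (by omega), f₁ 1 (by omega), hK]
    · rw [f₃ 4 (by omega), w₂]
    · rw [f₃ 5 (by omega), m₂]
    · rw [f₃ 6 (by omega), s₂]
  have hl : IsSubsetList W M (listSet W) fun j => residue (natMem W) n j = 0 := by
    -- The root adds at most one vertex to `U`, which accounts for the exponent `U.card + 1`.
    refine isSubsetList (le_trans (Nat.pow_le_pow_right (by omega) ?_) hM)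
    rw [hW]
    exact Finset.card_insert_le _ _
  have := den_forr_induction (k := 1) (b := 1) (p := subsetStep) (η := η) (A := A₃)
    (fun i A' => (∀ a < 8, A' a = A₃ a) ∧ A' 15 0 = ind (p ∨ ∃ x : Fin M, x.val < i ∧
      residue (natMem W) n x = 0 ∧ HasSolution G K W r (listSet W x)))
    ⟨fun _ _ => rfl, by
      rw [f₃ 15 (by omega), f₂ 15 (by omega) (by omega), f₁ 15 (by omega), hp]
      simp⟩ (by
      rintro i hi A' ⟨f, hv⟩
      rw [h₃.bounds.one] at hi
      refine ⟨fun a ha => by rw [den_of_not_writes _ (writes_subsetStep (by omega)), f a ha], ?_⟩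
      rw [den_subsetStep (h₃.congr f) hl (x := ⟨i, hi⟩) (by simpa using h0) (by simp) hv]
      refine ind_congr ?_
      rw [or_assoc]
      refine or_congr Iff.rfl ⟨?_, ?_⟩
      · rintro (⟨x, hx, h⟩ | h)
        · exact ⟨x, by omega, h⟩
        · exact ⟨⟨i, hi⟩, by simp, h⟩
      · rintro ⟨x, hx, h⟩
        rcases Nat.lt_succ_iff_lt_or_eq.1 hx with hx | hx
        · exact .inl ⟨x, hx, h⟩
        · obtain rfl : x = ⟨i, hi⟩ := Fin.ext hx
          exact .inr h)
  rw [h₃.bounds.one] at this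
  rw [this.2]
  refine ind_congr (or_congr Iff.rfl ⟨?_, ?_⟩)
  · rintro ⟨x, -, hx, h⟩
    exact ⟨_, hl.subset x hx, h⟩
  · rintro ⟨X, hX, h⟩
    obtain ⟨x, hx, rfl⟩ := hl.surj X hX
    exact ⟨x, x.2, hx, h⟩

end Cmd

end Root

section Greedy

variable {n : ℕ} {G : SimpleGraph (Fin n)}

/-! ### A modulator of approximately minimum size -/

/-- Three vertices outside `U` that induce a path. -/
def IsPathOutside (G : SimpleGraph (Fin n)) (U : Finset (Fin n)) (a b c : Fin n) : Prop :=
  (G.Adj a b ∧ G.Adj b c) ∧ (¬ G.Adj a c ∧ ¬ a = c) ∧ (¬ a ∈ U ∧ ¬ b ∈ U) ∧ ¬ c ∈ U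

/-- The ends of the path lie in one component, which is a clique, so they would be adjacent. -/
theorem IsClusterModulator.not_isPathOutside {Y : Finset (Fin n)} (hY : IsClusterModulator G Y)
    (a b c : Fin n) : ¬ IsPathOutside G Y a b c := by
  rintro ⟨⟨hab, hbc⟩, ⟨hac, hne⟩, ⟨ha, hb⟩, hc⟩
  let H := G.induce ((Y : Set (Fin n))ᶜ)
  let a' : ((Y : Set (Fin n))ᶜ : Set (Fin n)) := ⟨a, ha⟩
  let b' : ((Y : Set (Fin n))ᶜ : Set (Fin n)) := ⟨b, hb⟩
  let c' : ((Y : Set (Fin n))ᶜ : Set (Fin n)) := ⟨c, hc⟩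
  have h1 : H.Adj a' b' := hab
  have h2 : H.Adj b' c' := hbc
  have hm : a' ∈ (H.connectedComponentMk c').supp :=
    SimpleGraph.ConnectedComponent.eq.2 (h1.reachable.trans h2.reachable)
  have hm' : c' ∈ (H.connectedComponentMk c').supp := rfl
  exact hac (hY _ hm hm' fun h => hne (congrArg Subtype.val h))

/-- `U` is at most three times larger than any cluster modulator. -/
def IsApprox (G : SimpleGraph (Fin n)) (U : Finset (Fin n)) : Prop :=
  ∀ Y, IsClusterModulator G Y → U.card ≤ 3 * (U ∩ Y).card

theorem IsApprox.card_le {U : Finset (Fin n)} (h : IsApprox G U) :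
    U.card ≤ 3 * distToCluster G := by
  obtain ⟨Y, hY, hm⟩ := exists_modulator_card_eq_distToCluster G
  rw [← hY]
  exact (h Y hm).trans (Nat.mul_le_mul_left _ (Finset.card_le_card Finset.inter_subset_right))

/-- Each modulator `Y` contains one of the three new vertices, and they are new to `U`: three
vertices are paid for by at least one more element of `U ∩ Y`. -/
theorem IsApprox.union {U : Finset (Fin n)} (h : IsApprox G U) {a b c : Fin n}
    (hp : IsPathOutside G U a b c) : IsApprox G (U ∪ {a, b, c}) := by
  intro Y hY
  obtain ⟨h1, h2, ⟨ha, hb⟩, hc⟩ := hp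
  have h3 : ({a, b, c} : Finset (Fin n)).card ≤ 3 := Finset.card_le_three
  obtain ⟨y, hy, hyY⟩ : ∃ y ∈ ({a, b, c} : Finset (Fin n)), y ∈ Y := by
    by_contra! hcon
    exact hY.not_isPathOutside a b c
      ⟨h1, h2, ⟨hcon a (by simp), hcon b (by simp)⟩, hcon c (by simp)⟩
  have hd : Disjoint (U ∩ Y) (({a, b, c} : Finset (Fin n)) ∩ Y) := by
    refine Finset.disjoint_left.2 fun u hu hu' => ?_
    have hu1 := (Finset.mem_inter.1 hu).1
    have hu2 := (Finset.mem_inter.1 hu').1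
    simp only [Finset.mem_insert, Finset.mem_singleton] at hu2
    rcases hu2 with rfl | rfl | rfl
    · exact ha hu1
    · exact hb hu1
    · exact hc hu1
  have hpos : 0 < (({a, b, c} : Finset (Fin n)) ∩ Y).card :=
    Finset.card_pos.2 ⟨y, Finset.mem_inter.2 ⟨hy, hyY⟩⟩
  rw [Finset.union_inter_distrib_right, Finset.card_union_of_disjoint hd]
  have := Finset.card_union_le U {a, b, c}
  have := h Y hY
  omega

/-- The test whether `bv 3`, `bv 4`, `bv 5` induce a path outside the array `3`. -/
def Tm.pathT : Tm :=
  andT (andT (adjT 3 4) (adjT 4 5)) (andT (andT (notT (adjT 3 5)) (notT (eqT (.bv 3) (.bv 5))))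
    (andT (andT (notT (.read 3 (.bv 3))) (notT (.read 3 (.bv 4)))) (notT (.read 3 (.bv 5)))))

namespace Cmd

/-- Add `bv k` to the set in the array `3` if the flag is set. -/
def addStep (k : ℕ) : Cmd :=
  .store 3 (.bv k) (.ite (.read 14 (.const 0)) (.const 1) (.read 3 (.bv k)))

/-- Add `bv 3`, `bv 4` and `bv 5` to the set in the array `3` if they induce a path outside it. -/
def greedyStep : Cmd :=
  .seq (.store 14 (.const 0) Tm.pathT) (.seq (addStep 3) (.seq (addStep 4) (addStep 5)))

/-- Compute an approximately minimum cluster modulator. -/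
def greedy : Cmd := .forr 3 0 (.forr 4 0 (.forr 5 0 greedyStep))

/-- Compute a modulator and a bound on the number of subsets. -/
def prepare : Cmd :=
  .seq greedy (.seq (.store 8 (.const 0) (.const 2))
    (.forr 3 0 (.store 8 (.const 0) (.ite (.read 3 (.bv 3))
      (.add (.read 8 (.const 0)) (.read 8 (.const 0))) (.read 8 (.const 0))))))

theorem den_addStep_of_ne {k a : ℕ} (ha : a ≠ 3) {A : Mem} {η : Env} :
    (addStep k).den η A a = A a :=
  den_store_of_ne ha

theorem den_addStep {A : Mem} {η : Env} {U : Finset (Fin n)} {p : Prop}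
    (hU : ∀ u : Fin n, A 3 u = ind (u ∈ U)) (hp : A 14 0 = ind p) {k : ℕ} {a : Fin n}
    (hk : η k = a) (u : Fin n) :
    (addStep k).den η A 3 u = ind (u ∈ U ∨ p ∧ u = a) := by
  rw [addStep, den_store]
  simp only [Tm.eval_ite, Tm.eval_read, Tm.eval_bv, Tm.eval_const, hk, hp, hU, Fin.val_inj]
  by_cases h : p <;> by_cases h' : u = a <;> simp [h, h']

variable {M : ℕ}

theorem den_greedyStep_of_ne {a : ℕ} (h : a ≠ 3) (h' : a ≠ 14) {A : Mem} {η : Env} :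
    greedyStep.den η A a = A a :=
  den_of_not_writes _ (by simp [greedyStep, addStep, writes, h, h']) _ _

/-- The path test is stored as a flag first, so all three additions refer to the old set. -/
theorem den_greedyStep {A : Mem} {η : Env} (hb : HasBounds A n M)
    (hA : ∀ u v : Fin n, A 0 (u * n + v) = ind (G.Adj u v)) {U : Finset (Fin n)}
    (hU : ∀ u : Fin n, A 3 u = ind (u ∈ U)) {a b c : Fin n} (h3 : η 3 = a) (h4 : η 4 = b)
    (h5 : η 5 = c) (u : Fin n) :
    greedyStep.den η A 3 u =
      ind (u ∈ U ∨ IsPathOutside G U a b c ∧ u ∈ ({a, b, c} : Finset (Fin n))) := by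
  have key : Tm.pathT.eval η A = ind (IsPathOutside G U a b c) := by
    refine Tm.eval_andT_ind (Tm.eval_andT_ind (Tm.eval_adjT hb hA h3 h4 (by omega))
      (Tm.eval_adjT hb hA h4 h5 (by omega))) (Tm.eval_andT_ind (Tm.eval_andT_ind
      (Tm.eval_notT_ind (Tm.eval_adjT hb hA h3 h5 (by omega)))
      (Tm.eval_notT_ind ?_)) (Tm.eval_andT_ind (Tm.eval_andT_ind
        (Tm.eval_notT_ind (by simp [h3, hU])) (Tm.eval_notT_ind (by simp [h4, hU])))
        (Tm.eval_notT_ind (by simp [h5, hU]))))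
    simp only [Tm.eval_eqT, Tm.eval_bv, h3, h5, Fin.val_inj]
    by_cases h : a = c <;> simp [h]
  rw [greedyStep, den_seq, den_seq, den_seq]
  set A₁ := (Cmd.store 14 (.const 0) Tm.pathT).den η A
  have f₁ : A₁ 14 0 = ind (IsPathOutside G U a b c) := by
    exact (den_store 0).trans (by simp [key])
  have u₁ : ∀ u : Fin n, A₁ 3 u = ind (u ∈ U) := fun u => by
    exact (congrFun (den_store_of_ne (by omega)) _).trans (hU u)
  have u₂ := den_addStep u₁ f₁ h3
  have f₂ : (addStep 3).den η A₁ 14 0 = ind (IsPathOutside G U a b c) := by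
    rw [den_addStep_of_ne (by omega), f₁]
  classical
  have u₃ := den_addStep (U := Finset.univ.filter fun u => u ∈ U ∨ IsPathOutside G U a b c ∧ u = a)
    (by simpa using u₂) f₂ h4
  have f₃ : (addStep 4).den η ((addStep 3).den η A₁) 14 0 = ind (IsPathOutside G U a b c) := by
    rw [den_addStep_of_ne (by omega), f₂]
  have u₄ := den_addStep (U := Finset.univ.filter fun u => (u ∈ U ∨
    IsPathOutside G U a b c ∧ u = a) ∨ IsPathOutside G U a b c ∧ u = b) (by simpa using u₃) f₃ h5
  rw [u₄]
  refine ind_congr ?_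
  simp only [Finset.mem_filter, Finset.mem_univ, true_and, Finset.mem_insert,
    Finset.mem_singleton]
  tauto

/-- The array `3` of `A'` holds an approximately minimum modulator for the triples in `P`; apart
from auxiliary arrays `A'` agrees with `A`. -/
def GreedyInv (G : SimpleGraph (Fin n)) (A : Mem) (P : Fin n → Fin n → Fin n → Prop)
    (A' : Mem) : Prop :=
  (∀ a, a ≠ 3 → a ≠ 14 → A' a = A a) ∧ ∃ U : Finset (Fin n),
    (∀ u : Fin n, A' 3 u = ind (u ∈ U)) ∧ IsApprox G U ∧
      ∀ a b c, P a b c → ¬ IsPathOutside G U a b c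

theorem GreedyInv.mono {A A' : Mem} {P Q : Fin n → Fin n → Fin n → Prop}
    (h : GreedyInv G A P A') (hQ : ∀ a b c, Q a b c → P a b c) : GreedyInv G A Q A' := by
  obtain ⟨h1, U, h2, h3, h4⟩ := h
  exact ⟨h1, U, h2, h3, fun a b c h => h4 a b c (hQ a b c h)⟩

/-- A triple that is not a path outside `U` remains so when `U` grows, hence one pass over all
triples suffices. -/
theorem GreedyInv.step {A A' : Mem} {η : Env} (hb : HasBounds A n M)
    (hA : ∀ u v : Fin n, A 0 (u * n + v) = ind (G.Adj u v))
    {P : Fin n → Fin n → Fin n → Prop} (h : GreedyInv G A P A') {a b c : Fin n} (h3 : η 3 = a)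
    (h4 : η 4 = b) (h5 : η 5 = c) :
    GreedyInv G A (fun x y z => P x y z ∨ x = a ∧ y = b ∧ z = c) (greedyStep.den η A') := by
  obtain ⟨f, U, hU, ha, hP⟩ := h
  have key := den_greedyStep (hb.congr (f 2 (by omega) (by omega)))
    (by simpa [f 0] using hA) hU h3 h4 h5
  refine ⟨fun i hi hi' => by rw [den_greedyStep_of_ne hi hi', f i hi hi'], ?_⟩
  by_cases hp : IsPathOutside G U a b c
  · refine ⟨U ∪ {a, b, c}, fun u => by rw [key, Finset.mem_union]; simp only [hp, true_and], ha.union hp, ?_⟩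
    rintro x y z hxyz ⟨hx1, hx2, ⟨hx3, hx4⟩, hx5⟩
    rw [Finset.mem_union, not_or] at hx3 hx4 hx5
    rcases hxyz with h | ⟨rfl, rfl, rfl⟩
    · exact hP x y z h ⟨hx1, hx2, ⟨hx3.1, hx4.1⟩, hx5.1⟩
    · exact hx3.2 (by simp)
  · refine ⟨U, fun u => by simp [key, hp], ha, ?_⟩
    rintro x y z (h | ⟨rfl, rfl, rfl⟩)
    · exact hP x y z h
    · exact hp

theorem den_greedy {A : Mem} {η : Env} (hb : HasBounds A n M)
    (hA : ∀ u v : Fin n, A 0 (u * n + v) = ind (G.Adj u v)) (h3 : ∀ u : Fin n, A 3 u = 0) :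
    GreedyInv G A (fun _ _ _ => True) (greedy.den η A) := by
  have b₀ : ∀ {P A'}, GreedyInv G A P A' → A' 2 0 = n := fun h => by
    rw [h.1 2 (by omega) (by omega), hb.zero]
  -- The invariants of the three nested loops describe the triples processed so far in lexicographic
  -- order.
  have := den_forr_induction (k := 3) (b := 0) (p := .forr 4 0 (.forr 5 0 greedyStep)) (η := η)
    (A := A) (fun i => GreedyInv G A fun a _ _ => a.val < i)
    ⟨fun _ _ _ => rfl, ∅, by simpa using h3, fun Y _ => by simp, by simp⟩ (by
      intro i hi A₁ I₁
      rw [hb.zero] at hi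
      have := den_forr_induction (k := 4) (b := 0) (p := .forr 5 0 greedyStep)
        (η := Function.update η 3 i) (A := A₁)
        (fun j => GreedyInv G A fun a b _ => a.val < i ∨ a.val = i ∧ b.val < j)
        (I₁.mono (by omega)) (by
          intro j hj A₂ I₂
          rw [b₀ I₁] at hj
          have := den_forr_induction (k := 5) (b := 0) (p := greedyStep)
            (η := Function.update (Function.update η 3 i) 4 j) (A := A₂)
            (fun k => GreedyInv G A fun a b c => (a.val < i ∨ a.val = i ∧ b.val < j) ∨
              a.val = i ∧ b.val = j ∧ c.val < k)
            (I₂.mono (by omega)) (by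
              intro k hk A₃ I₃
              rw [b₀ I₂] at hk
              refine (I₃.step hb hA (a := ⟨i, hi⟩) (b := ⟨j, hj⟩) (c := ⟨k, hk⟩) (by simp)
                (by simp) (by simp)).mono ?_
              intro a b c h
              simp only [Fin.ext_iff]
              omega)
          rw [b₀ I₂] at this
          exact this.mono fun a b c h => by omega)
      rw [b₀ I₁] at this
      exact this.mono fun a b c h => by omega)
  rw [hb.zero] at this
  exact this.mono fun a _ _ _ => a.2

/-- The counter starts at 2 and doubles for every member of `U`; the initial 2 leaves room for the
root. -/
theorem den_prepare {A : Mem} {η : Env} (hb : HasBounds A n M)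
    (hA : ∀ u v : Fin n, A 0 (u * n + v) = ind (G.Adj u v)) (h3 : ∀ u : Fin n, A 3 u = 0) :
    (∀ a, a ≠ 3 → a ≠ 8 → a ≠ 14 → prepare.den η A a = A a) ∧ ∃ U : Finset (Fin n),
      (∀ u : Fin n, prepare.den η A 3 u = ind (u ∈ U)) ∧ IsPathFreeOutside G U ∧
      U.card ≤ 3 * distToCluster G ∧ prepare.den η A 8 0 = 2 ^ (U.card + 1) := by
  refine ⟨fun a h h' h'' => den_of_not_writes _
    (by simp [prepare, greedy, greedyStep, addStep, writes, h, h', h'']) _ _, ?_⟩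
  obtain ⟨f, U, hU, ha, hp⟩ := den_greedy (η := η) hb hA h3
  rw [prepare, den_seq, den_seq]
  set A₁ := greedy.den η A
  set A₂ := (Cmd.store 8 (.const 0) (.const 2)).den η A₁
  have f₂ : ∀ a ≠ 8, A₂ a = A₁ a := fun a h => den_store_of_ne h
  classical
  have := den_forr_induction (k := 3) (b := 0) (p := .store 8 (.const 0) (.ite (.read 3 (.bv 3))
    (.add (.read 8 (.const 0)) (.read 8 (.const 0))) (.read 8 (.const 0)))) (η := η) (A := A₂)
    (fun i A' => (∀ a ≠ 8, A' a = A₂ a) ∧ A' 8 0 = 2 * 2 ^ Nat.count (natMem U) i)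
    ⟨fun _ _ => rfl, by simp [A₂, den_store]⟩ (by
      rintro i hi A' ⟨f', h⟩
      rw [f₂ 2 (by omega), f 2 (by omega) (by omega), hb.zero] at hi
      refine ⟨fun a ha => by rw [den_store_of_ne ha, f' a ha], ?_⟩
      have hi' := hU ⟨i, hi⟩
      simp only at hi'
      rw [den_store, Nat.count_succ]
      simp only [Tm.eval_ite, Tm.eval_read, Tm.eval_bv, Tm.eval_const, Tm.eval_add,
        Function.update_self, h, f' 3 (by omega), f₂ 3 (by omega), hi', if_true]
      by_cases hm : (⟨i, hi⟩ : Fin n) ∈ U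
      · rw [ind_pos hm, if_neg one_ne_zero, if_pos ⟨hi, hm⟩]
        ring
      · rw [ind_neg hm, if_pos rfl, if_neg fun h => hm h.2, add_zero])
  rw [f₂ 2 (by omega), f 2 (by omega) (by omega), hb.zero, count_natMem] at this
  refine ⟨U, fun u => by rw [this.1 3 (by omega), f₂ 3 (by omega), hU], ?_, ha.card_le, ?_⟩
  · intro a b c ha hb hc hab hbc hac
    by_contra hn
    exact hp a b c trivial ⟨⟨hab, hbc⟩, ⟨hn, hac⟩, ⟨ha, hb⟩, hc⟩
  · rw [this.2]
    ring

/-- Decide the instance if a modulator is given in the array `3`. -/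
def decideCmd : Cmd := .forr 0 0 rootStep

theorem den_decideCmd {A : Mem} {η : Env} {K U : Finset (Fin n)}
    (hb : HasBounds A n M) (hA : ∀ u v : Fin n, A 0 (u * n + v) = ind (G.Adj u v))
    (hK : ∀ u : Fin n, A 1 u = ind (u ∈ K)) (hU : ∀ u : Fin n, A 3 u = ind (u ∈ U))
    (hM : 2 ^ (U.card + 1) ≤ M) (hp : IsPathFreeOutside G U) (h15 : A 15 0 = 0) :
    decideCmd.den η A 15 0 = ind (HasInducedTree G K) := by
  have := den_forr_induction (k := 0) (b := 0) (p := rootStep) (η := η) (A := A)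
    (fun i A' => (∀ a < 4, A' a = A a) ∧ A' 15 0 = ind (∃ r : Fin n, r.val < i ∧
      ∃ X ⊆ Insert.insert r U, HasSolution G K (Insert.insert r U) r X))
    ⟨fun _ _ => rfl, by simp [h15]⟩ (by
      rintro i hi A' ⟨f, hv⟩
      rw [hb.zero] at hi
      refine ⟨fun a ha => by rw [den_of_not_writes _ (writes_rootStep ha), f a ha], ?_⟩
      rw [den_rootStep (hb.congr (f 2 (by omega))) (by simpa [f 0] using hA)
        (by simpa [f 1] using hK) (by simpa [f 3] using hU) hM (r := ⟨i, hi⟩) (by simp) hv]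
      refine ind_congr ⟨?_, ?_⟩
      · rintro (⟨r, hr, h⟩ | h)
        · exact ⟨r, by omega, h⟩
        · exact ⟨⟨i, hi⟩, by simp, h⟩
      · rintro ⟨r, hr, h⟩
        rcases Nat.lt_succ_iff_lt_or_eq.1 hr with hr | hr
        · exact .inl ⟨r, hr, h⟩
        · obtain rfl : r = ⟨i, hi⟩ := Fin.ext hr
          exact .inr h)
  rw [hb.zero] at this
  rw [decideCmd, this.2, hasInducedTree_iff_exists_pick (W := fun r => Insert.insert r U)
    (fun r => Finset.mem_insert_self r U) fun r a b c ha hb hc => hp a b c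
      (fun h => ha (Finset.mem_insert_of_mem h)) (fun h => hb (Finset.mem_insert_of_mem h))
      (fun h => hc (Finset.mem_insert_of_mem h))]
  exact ind_congr ⟨fun ⟨r, _, h⟩ => ⟨r, h⟩, fun ⟨r, h⟩ => ⟨r, r.2, h⟩⟩

theorem writes_decideCmd_two : decideCmd.writes 2 = false := writes_rootStep (a := 2) (by omega)

end Cmd

/-! ### The program -/

theorem ite_eq_ind {p q : Prop} {_ : Decidable p} (h : p ↔ q) : (if p then 1 else 0) = ind q := by
  by_cases hp : p
  · rw [if_pos hp, ind_pos (h.1 hp)]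
  · rw [if_neg hp, ind_neg fun hq => hp (h.2 hq)]

/-- The expression `6 * n + 1`. -/
def boundExpr : Expr :=
  let e := Expr.add (.var 0) (.add (.var 0) (.var 0))
  .add (.add e e) (.const 1)

/-- The algorithm. -/
def program : Prog :=
  .seq (.store 2 (.const 0) (.var 0)) (.seq (.store 2 (.const 2) boundExpr)
    (.seq (Cmd.prepare.compile (fun _ => 1) 2) (.seq (.store 2 (.const 1) (.read 8 (.const 0)))
      (.seq (Cmd.decideCmd.compile (fun _ => 1) 2) (.assign 0 (.read 15 (.const 0)))))))

theorem exists_runs_program {G : SimpleGraph (Fin n)} {K : Finset (Fin n)} {q B : ℕ}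
    (hq : distToCluster G ≤ q) (hB : 2 ^ (3 * q + 1) ≤ B) (hB' : 6 * n + 1 ≤ B) :
    SolvesWithin program G K (Cmd.prepare.cost B + Cmd.decideCmd.cost B + 27) := by
  let σ₁ := (inputState G K).store 2 0 n
  let σ₂ := σ₁.store 2 2 (6 * n + 1)
  have v₂ : ∀ x, σ₂.var x = if x = 0 then n else 0 := fun x => rfl
  have e₂ : boundExpr.eval σ₁ = 6 * n + 1 := by
    simp [boundExpr, Expr.eval, σ₁, State.store, inputState]
    omega
  have r₂ := Runs.store σ₁ 2 (.const 2) boundExpr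
  rw [e₂] at r₂
  -- The number of subsets is not known yet. Its cell is still 0, which is harmless because
  -- `den_prepare` allows any value.
  have b₂ : HasBounds σ₂.arr n 0 := by
    refine ⟨?_, ?_, ?_⟩ <;> simp [σ₂, σ₁, State.store, inputState]
  have le₂ : ∀ b, σ₂.arr 2 b ≤ B := by
    intro b
    simp only [σ₂, σ₁, State.store, inputState, Function.update_self, Function.update_apply]
    split_ifs <;> omega
  have g₂ : ∀ u v : Fin n, σ₂.arr 0 (u * n + v) = ind (G.Adj u v) := by
    intro u v
    simp only [σ₂, σ₁, State.store, inputState, ne_eq, OfNat.zero_ne_ofNat, not_false_eq_true,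
      Function.update_of_ne, if_true]
    refine ite_eq_ind ⟨?_, fun h => ⟨u, v, rfl, h⟩⟩
    rintro ⟨i, j, h, hij⟩
    obtain ⟨h1, h2⟩ := mul_add_inj v.2 j.2 h
    rwa [Fin.ext h1, Fin.ext h2]
  have k₂ : ∀ u : Fin n, σ₂.arr 1 u = ind (u ∈ K) := by
    intro u
    simp only [σ₂, σ₁, State.store, inputState, ne_eq, OfNat.one_ne_ofNat, not_false_eq_true,
      Function.update_of_ne, if_true, one_ne_zero, if_false]
    refine ite_eq_ind ⟨?_, fun h => ⟨u, h, rfl⟩⟩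
    rintro ⟨i, hi, h⟩
    rwa [Fin.ext h]
  have z₂ : ∀ a, 2 < a → ∀ m, σ₂.arr a m = 0 := by
    intro a ha m
    simp only [σ₂, σ₁, State.store, inputState]
    rw [Function.update_of_ne (by omega), Function.update_of_ne (by omega), if_neg (by omega),
      if_neg (by omega)]
  -- At the top level every bound variable is assigned to register 1, which holds 0.
  obtain ⟨σ₃, t₃, r₃, a₃, p₃, c₃⟩ := Cmd.prepare.runs_compile (B := B) rfl σ₂.arr (fun _ => 0)
    (fun _ => 1) 2 σ₂ le₂ rfl (fun _ => by omega) (fun _ => by simp [v₂])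
  obtain ⟨f₃, U, hU, hp, hc, h8⟩ := Cmd.den_prepare (η := fun _ => 0) b₂ g₂
    fun u => z₂ 3 (by omega) u
  rw [← a₃] at f₃ hU h8
  let σ₄ := σ₃.store 2 1 (σ₃.arr 8 0)
  have f₄ : ∀ a ≠ 2, σ₄.arr a = σ₃.arr a := fun a h => Function.update_of_ne h _ _
  have h2 : σ₄.arr 2 = Function.update (σ₂.arr 2) 1 (2 ^ (U.card + 1)) := by
    simp only [σ₄, State.store, Function.update_self, h8, f₃ 2 (by omega) (by omega) (by omega)]
  have b₄ : HasBounds σ₄.arr n (2 ^ (U.card + 1)) := by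
    refine ⟨?_, ?_, ?_⟩ <;> rw [h2]
    · simp [b₂.zero]
    · simp
    · simp [b₂.two]
  have le₄ : ∀ b, σ₄.arr 2 b ≤ B := by
    intro b
    rw [h2, Function.update_apply]
    split_ifs
    · exact (Nat.pow_le_pow_right (by omega) (by omega)).trans hB
    · exact le₂ b
  obtain ⟨σ₅, t₅, r₅, a₅, p₅, c₅⟩ := Cmd.decideCmd.runs_compile (B := B) Cmd.writes_decideCmd_two
    σ₄.arr (fun _ => 0) (fun _ => 1) 2 σ₄ le₄ rfl (fun _ => by omega)
    (fun _ => by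
      change σ₃.var 1 = 0
      rw [p₃ 1 (by omega), v₂]
      rfl)
  have key := Cmd.den_decideCmd (G := G) (K := K) (U := U) (η := fun _ => 0) b₄
    (fun u v => by rw [f₄ 0 (by omega), f₃ 0 (by omega) (by omega) (by omega), g₂])
    (fun u => by rw [f₄ 1 (by omega), f₃ 1 (by omega) (by omega) (by omega), k₂])
    (fun u => by rw [f₄ 3 (by omega), hU]) le_rfl hp
    (by rw [f₄ 15 (by omega), f₃ 15 (by omega) (by omega) (by omega), z₂ 15 (by omega)])
  rw [← a₅] at key
  refine ⟨_, _, .seq (.store _ _ _ _) (.seq r₂ (.seq r₃ (.seq (.store _ _ _ _)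
    (.seq r₅ (.assign _ _ _))))), ?_, fun h => ?_, fun h => ?_⟩
  · simp only [Expr.cost, boundExpr]
    omega
  · simp [State.assign, Expr.eval, key, h]
  · simp [State.assign, Expr.eval, key, h]

end Greedy

end KInATree

theorem mainTheorem6 :
    ∃ (p : KInATree.Prog) (a b c : ℕ), ∀ (n : ℕ) (G : SimpleGraph (Fin n)) (K : Finset (Fin n))
      (q : ℕ), KInATree.distToCluster G ≤ q →
        KInATree.SolvesWithin p G K (a * 2 ^ (b * q) * (n + 1) ^ c) := by
  obtain ⟨C, D, h⟩ := KInATree.polyBound_add (KInATree.polyBound_add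
    KInATree.Cmd.prepare.polyBound_cost KInATree.Cmd.decideCmd.polyBound_cost)
    (KInATree.polyBound_const 27)
  -- With `B = 6 * 2 ^ (3 * q) * (n + 1)`, which exceeds both `2 ^ (3 * q + 1)` and `6 * n + 1`, the
  -- bound `C * B ^ D` factors into exactly these constants.
  refine ⟨KInATree.program, C * 6 ^ D, 3 * D, D, fun n G K q hq => ?_⟩
  have h1 : 1 ≤ 2 ^ (3 * q) := Nat.one_le_two_pow
  obtain ⟨s, t, hr, ht, hs⟩ := KInATree.exists_runs_program (K := K)
    (B := 6 * 2 ^ (3 * q) * (n + 1)) hq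
    (by rw [pow_succ]; nlinarith [Nat.zero_le (2 ^ (3 * q) * n)])
    (by nlinarith [Nat.mul_le_mul_right n h1])
  refine ⟨s, t, hr, (ht.trans (h _ (by nlinarith [Nat.zero_le (2 ^ (3 * q) * n)]))).trans
    (le_of_eq ?_), hs⟩
  rw [mul_pow, mul_pow, ← pow_mul]
  ring
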